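/- For $x,y\in\mathbb R^2$ with $x^1\neq y^1$, $x^2\neq y^2$, put $$D_1(x,y)=\Big(\frac{|x^1-y^1|}{|x^2-y^2|}+\frac{|x^2-y^2|}{|x^1-y^1|}\Big)^{-1}.$$ A $CZX$ kernel with $\theta_2=1$ is a function $K(x,y)\in\mathbb C$, defined when $x^1\ne y^1$ and $x^2\neq y^2$, such that for some $\theta_1\in(0,1]$ and some constant $A$, $$|K(x,y)|\le A\,\frac{1}{|x^1-y^1|}\frac1{|x^2-y^2|}D_1(x,y),$$ $$|K(x,y)-K((w^1,x^2),y)|\le A\,\frac{|x^1-w^1|^{\theta_1}}{|x^1-y^1|^{1+\theta_1}}\frac1{|x^2-y^2|}D_1(x,y)\quad\text{whenever } |x^1-w^1|\le\tfrac12|x^1-y^1|,$$ together with the three symmetric estimates in the variables $x^2$, $y^1$, $y^2$. A bounded linear operator $T$ on $L^2(\mathbb R^2)$ has kernel $K$ if $\int (Tf)g=\iint K(x,y)f(y)g(x)\,dx\,dy$ for all finite linear combinations $f,g$ of indicators of cubes (squares with sides parallel to the axes) with $\{f\ne0\}\cap\{g\neq0\}=\varnothing$. A collection $\mathscr S$ of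 cubes is $\epsilon$-sparse if there are pairwise disjoint measurable sets $E(S)\subset S$, $S\in\mathscr S$, with $|E(S)|\ge\epsilon|S|$. Write $\langle b\rangle_S=\frac1{|S|}\int_S b$, $\langle f\rangle_{S,p}=\big(\frac1{|S|}\int_S|f|^p\big)^{1/p}\in[0,\infty]$ and $p'=p/(p-1)$. Proposition. There is an absolute constant $\epsilon>0$ such that the following holds. Let $T$ be a bounded linear operator on $L^2(\mathbb R^2)$ that has a $CZX$ kernel with $\theta_2=1$. Then $T$ extends from $L^1\cap L^2$ to $L^1(\mathbb R^2)$, uniquely as an operator that is continuous from $L^1$ into the measurable functions with convergence in measure (the extension is again denoted by $T$), and there is a constant $C>0$, depending only on $T$, such that: for every $p\in(1,\infty)$, every locally integrable $b:\mathbb R^2\to\mathbb C$ and every compactly supported $f\in L^p(\mathbb R^2)$ with $bf\in L^1(\mathbb R^2)$, there is an $\epsilon$-sparse collection $\mathscr S$ of cubes such that the commutator $[b,T]f=bTf-T(bf)$ satisfies, almost everywhere, $$|[b,T]f|\le C\,p'\Big(\sum_{S\in\mathscr S}\langle (b-\langle b\rangle_S)f\rangle_{S,p}1_S+\sum_{S\in\mathscr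 S}|b-\langle b\rangle_S|\,\langle f\rangle_{S,p}1_S\Big).$$ -/

import Mathlib

open MeasureTheory Filter Topology
open scoped ENNReal

noncomputable section

namespace CZX

/-- The plane, with points `x = (x.1, x.2)`; `volume` is two-dimensional Lebesgue measure. -/
abbrev Plane : Type := ℝ × ℝ

/-! ### Kernels -/

/-- The decay factor `D_θ(x, y) = (|x¹ - y¹| / |x² - y²| + |x² - y²| / |x¹ - y¹|) ^ (-θ)`, used only
when `x¹ ≠ y¹` and `x² ≠ y²`. -/
def decay (θ : ℝ) (x y : Plane) : ℝ :=
  (|x.1 - y.1| / |x.2 - y.2| + |x.2 - y.2| / |x.1 - y.1|) ^ (-θ)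

/-- The size estimate and the four mixed Hölder and size estimates, with a common constant `A`.
Nothing is required of `K` where `x¹ = y¹` or `x² = y²`. -/
structure IsKernelWith (θ₁ θ₂ A : ℝ) (K : Plane → Plane → ℂ) : Prop where
  size : ∀ x y : Plane, x.1 ≠ y.1 → x.2 ≠ y.2 →
    ‖K x y‖ ≤ A * ((1 / |x.1 - y.1|) * (1 / |x.2 - y.2|) * decay θ₂ x y)
  holder_x1 : ∀ (x y : Plane) (w : ℝ), x.1 ≠ y.1 → x.2 ≠ y.2 → |x.1 - w| ≤ |x.1 - y.1| / 2 →
    ‖K x y - K (w, x.2) y‖ ≤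
      A * ((|x.1 - w| ^ θ₁ / |x.1 - y.1| ^ (1 + θ₁)) * (1 / |x.2 - y.2|) * decay θ₂ x y)
  holder_x2 : ∀ (x y : Plane) (w : ℝ), x.1 ≠ y.1 → x.2 ≠ y.2 → |x.2 - w| ≤ |x.2 - y.2| / 2 →
    ‖K x y - K (x.1, w) y‖ ≤
      A * ((1 / |x.1 - y.1|) * (|x.2 - w| ^ θ₁ / |x.2 - y.2| ^ (1 + θ₁)) * decay θ₂ x y)
  holder_y1 : ∀ (x y : Plane) (w : ℝ), x.1 ≠ y.1 → x.2 ≠ y.2 → |y.1 - w| ≤ |x.1 - y.1| / 2 →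
    ‖K x y - K x (w, y.2)‖ ≤
      A * ((|y.1 - w| ^ θ₁ / |x.1 - y.1| ^ (1 + θ₁)) * (1 / |x.2 - y.2|) * decay θ₂ x y)
  holder_y2 : ∀ (x y : Plane) (w : ℝ), x.1 ≠ y.1 → x.2 ≠ y.2 → |y.2 - w| ≤ |x.2 - y.2| / 2 →
    ‖K x y - K x (y.1, w)‖ ≤
      A * ((1 / |x.1 - y.1|) * (|y.2 - w| ^ θ₁ / |x.2 - y.2| ^ (1 + θ₁)) * decay θ₂ x y)

/-- `K` is a CZX kernel with parameter `θ₂`: the estimates hold for some Hölder exponent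
`θ₁ ∈ (0, 1]` and some constant. -/
def IsKernel (θ₂ : ℝ) (K : Plane → Plane → ℂ) : Prop :=
  ∃ θ₁ A : ℝ, 0 < θ₁ ∧ θ₁ ≤ 1 ∧ IsKernelWith θ₁ θ₂ A K

/-! ### Cubes, and operators with a kernel -/

/-- A cube of the plane: a square with sides parallel to the axes, given by its lower left corner
and its side length. -/
structure Cube where
  corner : Plane
  side : ℝ
  side_pos : 0 < side

/-- The (half-open) set of points of a cube. -/
def Cube.toSet (Q : Cube) : Set Plane :=
  Set.Ico Q.corner.1 (Q.corner.1 + Q.side) ×ˢ Set.Ico Q.corner.2 (Q.corner.2 + Q.side)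

/-- The finite linear combinations of indicators of cubes. -/
def stepFunctions : Submodule ℂ (Plane → ℂ) :=
  Submodule.span ℂ (Set.range fun Q : Cube => Q.toSet.indicator fun _ => (1 : ℂ))

theorem stepFunctions_memLp {f : Plane → ℂ} (hf : f ∈ stepFunctions) :
    MemLp f 2 (volume : Measure Plane) := by
  induction hf using Submodule.span_induction with
  | mem f h =>
    obtain ⟨Q, rfl⟩ := h
    refine memLp_indicator_const 2 (measurableSet_Ico.prod measurableSet_Ico) _ (Or.inr ?_)
    rw [Measure.volume_eq_prod, Measure.prod_prod]
    simp [ENNReal.mul_eq_top]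
  | zero => exact MemLp.zero
  | add f g _ _ hf hg => exact hf.add hg
  | smul c f _ hf => exact hf.const_smul c

/-- The bounded operator `T` on `L²` has the kernel `K`:
`∫ (T f) g = ∬ K(x, y) f(y) g(x) dx dy` for all finite linear combinations `f`, `g` of indicators
of cubes with `{f ≠ 0} ∩ {g ≠ 0} = ∅`. -/
def HasKernel (T : Lp ℂ 2 (volume : Measure Plane) →L[ℂ] Lp ℂ 2 (volume : Measure Plane))
    (K : Plane → Plane → ℂ) : Prop :=
  ∀ (f g : Plane → ℂ) (hf : f ∈ stepFunctions), g ∈ stepFunctions →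
    {x | f x ≠ 0} ∩ {x | g x ≠ 0} = ∅ →
    ∫ x, (T ((stepFunctions_memLp hf).toLp f) : Plane → ℂ) x * g x =
      ∫ z : Plane × Plane, K z.1 z.2 * f z.2 * g z.1

/-- `g` is the value at the integrable function `f` of the extension of `T` by continuity from
`L¹ ∩ L²` to `L¹`, with values in the measurable functions with convergence in measure: whenever
`uₙ ∈ L¹ ∩ L²` and `uₙ → f` in `L¹`, then `T uₙ → g` in measure. Such sequences exist for every
integrable `f`, so `g` is unique up to null sets; for `f ∈ L¹ ∩ L²` it is `T f`. -/
def IsExtensionValue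
    (T : Lp ℂ 2 (volume : Measure Plane) →L[ℂ] Lp ℂ 2 (volume : Measure Plane))
    (f g : Plane → ℂ) : Prop :=
  Integrable f ∧ AEStronglyMeasurable g ∧
    ∀ u : ℕ → Lp ℂ 2 (volume : Measure Plane), (∀ n, Integrable (u n : Plane → ℂ)) →
      Tendsto (fun n => eLpNorm ((u n : Plane → ℂ) - f) 1 volume) atTop (𝓝 0) →
      TendstoInMeasure volume (fun n => (T (u n) : Plane → ℂ)) atTop g

/-! ### Sparse forms -/

/-- A collection of cubes is `ε`-sparse: there are pairwise disjoint measurable sets `E(S) ⊆ S`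
with `|E(S)| ≥ ε |S|`. -/
def IsSparse (ε : ℝ) (𝒮 : Set Cube) : Prop :=
  ∃ E : Cube → Set Plane, 𝒮.PairwiseDisjoint E ∧
    ∀ S ∈ 𝒮, MeasurableSet (E S) ∧ E S ⊆ S.toSet ∧
      ENNReal.ofReal ε * volume S.toSet ≤ volume (E S)

/-- The average `⟨b⟩_S`. -/
def avg (b : Plane → ℂ) (S : Cube) : ℂ := ⨍ x in S.toSet, b x

/-- The `L^p`-average `⟨f⟩_{S,p} = (|S|⁻¹ ∫_S |f|^p)^(1/p)`, with values in `[0, ∞]`. -/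
def pAvg (p : ℝ) (f : Plane → ℂ) (S : Cube) : ℝ≥0∞ :=
  ((volume S.toSet)⁻¹ * ∫⁻ x in S.toSet, ‖f x‖ₑ ^ p) ^ (1 / p)

/-- `∑_{S ∈ 𝒮} ⟨(b - ⟨b⟩_S) f⟩_{S,p} 1_S(x)`. -/
def sparseFormIn (p : ℝ) (𝒮 : Set Cube) (b f : Plane → ℂ) (x : Plane) : ℝ≥0∞ :=
  ∑' S : 𝒮, (S : Cube).toSet.indicator
    (fun _ => pAvg p (fun y => (b y - avg b S) * f y) S) x

/-- `∑_{S ∈ 𝒮} |b(x) - ⟨b⟩_S| ⟨f⟩_{S,p} 1_S(x)`. -/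
def sparseFormOut (p : ℝ) (𝒮 : Set Cube) (b f : Plane → ℂ) (x : Plane) : ℝ≥0∞ :=
  ∑' S : 𝒮, (S : Cube).toSet.indicator
    (fun y => ‖b y - avg b S‖ₑ * pAvg p f S) x

end CZX

end

/-! With θ₂ = 1 the size bound becomes |K(x, y)| ≲ |x - y|⁻², the size of a standard
Calderón–Zygmund kernel in the plane. What is missing is smoothness. A Hölder gain is measured
against one coordinate distance |x¹ - y¹| or |x² - y²| only, so it is lost near the cross formed by
the vertical and horizontal lines through a point. `norm_sub_center_le` records this: off the triple
of a cube P the oscillation of the kernel over P is bounded by `bump`, which beats |s - c|⁻² only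
away from the cross through the centre c of P.

The tail estimate `lintegral_mul_bump_le` overcomes the defect by integrability. In the annulus of
radius about 3ᵏℓ around a cube of side ℓ, the strips of width about 2ᵏℓ along the cross fill a
fraction about (2/3)ᵏ. By Hölder they cost (2/3)^(k/p') times an L^p-average, and off the strips the
kernel gains 2^(-θk). Summing over k costs a multiple of p', which is the origin of this factor.
Applied to the constant function 1 the same estimate is Hörmander's condition, so the
Calderón–Zygmund decomposition gives weak type (1, 1) (`weak_local`, `weak_L2`) and hence the
extension to L¹ (`exists_tendstoInMeasure`). A duality argument (`ae_opL2_eq`, `exists_isWeakOp`)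
shows that the extension is given by the kernel off the support.

The local estimate `exists_exceptional_set_of_pos` plays the role of a bound for maximal
truncations. Off a small set E the function Φ g and the L^p maximal function of g are controlled. If
E fills at most half of a cube P, then Φ of the part of g outside 3P is bounded on all of P: its
oscillation on P is controlled by the tail estimate, and its value is controlled at one good point,
where it is the difference of Φ g and Φ (g 1_{3P}).

For the commutator, [b, T] = [b - a, T] with a the average of b on 3Q, so that [b, T]f = (b - a) T f
- T((b - a) f). The local estimate is applied to f and to (b - a) f on 3Q. Stopping cubes of the
indicator of the exceptional set are the next generation (`exists_next_cubes`). Telescoping along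
the generations gives the sparse sum inside 3Q. Outside, the cubes 3ᵏQ and the size of the kernel
suffice (`ae_enorm_le_of_far`), and `exists_sparse_domination` joins the two regions. -/

noncomputable section

namespace CZX

/-! ### Geometry of cubes -/

namespace Cube

/-- The centre of a cube. -/
def center (Q : Cube) : Plane := (Q.corner.1 + Q.side / 2, Q.corner.2 + Q.side / 2)

/-- The concentric cube of three times the side length. -/
def triple (Q : Cube) : Cube where
  corner := (Q.corner.1 - Q.side, Q.corner.2 - Q.side)
  side := 3 * Q.side
  side_pos := by have := Q.side_pos; positivity

@[simp] theorem triple_side (Q : Cube) : Q.triple.side = 3 * Q.side := rfl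

theorem triple_center (Q : Cube) : Q.triple.center = Q.center := by
  ext <;> simp only [center, triple] <;> ring

theorem iterate_triple_side (Q : Cube) (k : ℕ) : (triple^[k] Q).side = 3 ^ k * Q.side := by
  induction k with
  | zero => simp
  | succ k ih => rw [Function.iterate_succ_apply', triple_side, ih]; ring

theorem iterate_triple_center (Q : Cube) (k : ℕ) : (triple^[k] Q).center = Q.center := by
  induction k with
  | zero => simp
  | succ k ih => rw [Function.iterate_succ_apply', triple_center, ih]

theorem triple_injective : Function.Injective triple := by
  rintro ⟨⟨a, b⟩, s, hs⟩ ⟨⟨a', b'⟩, s', hs'⟩ h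
  simp only [triple, mk.injEq, Prod.mk.injEq] at h ⊢
  refine ⟨⟨?_, ?_⟩, ?_⟩ <;> linarith [h.1.1, h.1.2, h.2]

theorem mem_toSet {Q : Cube} {x : Plane} : x ∈ Q.toSet ↔
    (Q.corner.1 ≤ x.1 ∧ x.1 < Q.corner.1 + Q.side) ∧
      (Q.corner.2 ≤ x.2 ∧ x.2 < Q.corner.2 + Q.side) := by
  simp [toSet, Set.mem_prod]

theorem measurableSet_toSet (Q : Cube) : MeasurableSet Q.toSet :=
  measurableSet_Ico.prod measurableSet_Ico

theorem corner_mem (Q : Cube) : Q.corner ∈ Q.toSet := by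
  have := Q.side_pos
  rw [mem_toSet]
  refine ⟨⟨le_rfl, ?_⟩, le_rfl, ?_⟩ <;> linarith

theorem center_mem (Q : Cube) : Q.center ∈ Q.toSet := by
  have := Q.side_pos
  rw [mem_toSet]
  simp only [center]
  refine ⟨⟨?_, ?_⟩, ?_, ?_⟩ <;> linarith

theorem volume_toSet (Q : Cube) : volume Q.toSet = ENNReal.ofReal (Q.side ^ 2) := by
  rw [toSet, Measure.volume_eq_prod, Measure.prod_prod]
  simp only [Real.volume_Ico, add_sub_cancel_left]
  rw [← ENNReal.ofReal_mul Q.side_pos.le, sq]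

theorem volume_pos (Q : Cube) : 0 < volume Q.toSet := by
  rw [volume_toSet, ENNReal.ofReal_pos]; exact pow_pos Q.side_pos 2

theorem volume_ne_zero (Q : Cube) : volume Q.toSet ≠ 0 := Q.volume_pos.ne'

theorem volume_ne_top (Q : Cube) : volume Q.toSet ≠ ∞ := by
  rw [volume_toSet]; exact ENNReal.ofReal_ne_top

theorem volume_real (Q : Cube) : volume.real Q.toSet = Q.side ^ 2 := by
  rw [Measure.real, volume_toSet, ENNReal.toReal_ofReal (by positivity)]

theorem volume_triple (Q : Cube) : volume Q.triple.toSet = 9 * volume Q.toSet := by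
  rw [volume_toSet, volume_toSet, triple_side, mul_pow,
    ENNReal.ofReal_mul (by norm_num)]
  norm_num

theorem toSet_subset_closedBall (Q : Cube) : Q.toSet ⊆ Metric.closedBall Q.center (Q.side / 2) := by
  intro x hx
  rw [mem_toSet] at hx
  rw [Metric.mem_closedBall, Prod.dist_eq, max_le_iff, Real.dist_eq, Real.dist_eq, abs_le, abs_le]
  simp only [center]
  refine ⟨⟨?_, ?_⟩, ?_, ?_⟩ <;> linarith [hx.1.1, hx.1.2, hx.2.1, hx.2.2]

theorem ball_subset_toSet (Q : Cube) : Metric.ball Q.center (Q.side / 2) ⊆ Q.toSet := by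
  intro x hx
  rw [Metric.mem_ball, Prod.dist_eq, max_lt_iff, Real.dist_eq, Real.dist_eq, abs_lt, abs_lt] at hx
  simp only [center] at hx
  rw [mem_toSet]
  refine ⟨⟨?_, ?_⟩, ?_, ?_⟩ <;> linarith [hx.1.1, hx.1.2, hx.2.1, hx.2.2]

theorem le_dist_center_of_notMem {Q : Cube} {x : Plane} (hx : x ∉ Q.toSet) :
    Q.side / 2 ≤ dist x Q.center := by
  by_contra! h
  exact hx (Q.ball_subset_toSet h)

theorem dist_center_le {Q : Cube} {x : Plane} (hx : x ∈ Q.toSet) :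
    dist x Q.center ≤ Q.side / 2 := Q.toSet_subset_closedBall hx

theorem abs_fst_sub_center_le {Q : Cube} {x : Plane} (hx : x ∈ Q.toSet) :
    |x.1 - Q.center.1| ≤ Q.side / 2 := by
  have := dist_center_le hx
  rw [Prod.dist_eq, max_le_iff, Real.dist_eq, Real.dist_eq] at this
  exact this.1

theorem abs_snd_sub_center_le {Q : Cube} {x : Plane} (hx : x ∈ Q.toSet) :
    |x.2 - Q.center.2| ≤ Q.side / 2 := by
  have := dist_center_le hx
  rw [Prod.dist_eq, max_le_iff, Real.dist_eq, Real.dist_eq] at this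
  exact this.2

theorem volume_closedBall_center (Q : Cube) :
    volume (Metric.closedBall Q.center (Q.side / 2)) = volume Q.toSet := by
  have : Metric.closedBall Q.center (Q.side / 2) =
      Metric.closedBall Q.center.1 (Q.side / 2) ×ˢ Metric.closedBall Q.center.2 (Q.side / 2) := by
    rw [closedBall_prod_same]
  rw [this, Measure.volume_eq_prod, Measure.prod_prod, Real.volume_closedBall,
    Real.volume_closedBall, ← Measure.volume_eq_prod, volume_toSet, ← ENNReal.ofReal_mul (by linarith [Q.side_pos])]
  congr 1; ring

/-- Balls of the sup metric are squares, so Lebesgue differentiation and Vitali's covering theorem,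
stated for closed balls, apply to cubes. -/
theorem toSet_ae_eq_closedBall (Q : Cube) :
    Q.toSet =ᵐ[volume] Metric.closedBall Q.center (Q.side / 2) :=
  ae_eq_of_subset_of_measure_ge Q.toSet_subset_closedBall Q.volume_closedBall_center.le
    Q.measurableSet_toSet.nullMeasurableSet (by rw [volume_closedBall_center]; exact Q.volume_ne_top)

theorem interior_nonempty (Q : Cube) : (interior Q.toSet).Nonempty :=
  ⟨Q.center, interior_mono Q.ball_subset_toSet
    (by rw [Metric.isOpen_ball.interior_eq]; exact Metric.mem_ball_self (by linarith [Q.side_pos]))⟩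

theorem subset_iff {P Q : Cube} : P.toSet ⊆ Q.toSet ↔
    (Q.corner.1 ≤ P.corner.1 ∧ P.corner.1 + P.side ≤ Q.corner.1 + Q.side) ∧
      (Q.corner.2 ≤ P.corner.2 ∧ P.corner.2 + P.side ≤ Q.corner.2 + Q.side) := by
  have hP := P.side_pos
  constructor
  · intro h
    have h1 : ∀ t, 0 ≤ t → t < P.side → P.corner.1 + t < Q.corner.1 + Q.side ∧
        P.corner.2 + t < Q.corner.2 + Q.side := by
      intro t ht ht'
      have : ((P.corner.1 + t, P.corner.2 + t) : Plane) ∈ Q.toSet := by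
        apply h; rw [mem_toSet]; refine ⟨⟨?_, ?_⟩, ?_, ?_⟩ <;> simp <;> linarith
      rw [mem_toSet] at this
      exact ⟨this.1.2, this.2.2⟩
    have h0 := mem_toSet.1 (h P.corner_mem)
    refine ⟨⟨h0.1.1, ?_⟩, h0.2.1, ?_⟩
    · by_contra! hc
      have := (h1 (Q.corner.1 + Q.side - P.corner.1) (by linarith [h0.1.2]) (by linarith)).1
      linarith
    · by_contra! hc
      have := (h1 (Q.corner.2 + Q.side - P.corner.2) (by linarith [h0.2.2]) (by linarith)).2
      linarith
  · rintro h x hx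
    rw [mem_toSet] at hx ⊢
    refine ⟨⟨?_, ?_⟩, ?_, ?_⟩ <;> linarith [hx.1.1, hx.1.2, hx.2.1, hx.2.2, h.1.1, h.1.2, h.2.1, h.2.2]

theorem triple_subset_triple {P Q : Cube} (h : P.toSet ⊆ Q.toSet) :
    P.triple.toSet ⊆ Q.triple.toSet := by
  rw [subset_iff] at h ⊢
  simp only [triple]
  refine ⟨⟨?_, ?_⟩, ?_, ?_⟩ <;> linarith [h.1.1, h.1.2, h.2.1, h.2.2]

theorem subset_triple (Q : Cube) : Q.toSet ⊆ Q.triple.toSet := by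
  have := Q.side_pos
  rw [subset_iff]
  simp only [triple]
  refine ⟨⟨?_, ?_⟩, ?_, ?_⟩ <;> linarith

theorem subset_iterate_triple (Q : Cube) {k l : ℕ} (h : k ≤ l) :
    (triple^[k] Q).toSet ⊆ (triple^[l] Q).toSet := by
  induction l, h using Nat.le_induction with
  | base => exact subset_rfl
  | succ l _ ih => rw [Function.iterate_succ_apply']; exact ih.trans (subset_triple _)

theorem exists_mem_iterate_triple (Q : Cube) (x : Plane) : ∃ k, x ∈ (triple^[k] Q).toSet := by
  have hs := Q.side_pos
  obtain ⟨k, hk⟩ := pow_unbounded_of_one_lt (dist x Q.center / (Q.side / 2)) (by norm_num : (1:ℝ) < 3)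
  refine ⟨k, ball_subset_toSet _ ?_⟩
  rw [iterate_triple_center, iterate_triple_side, Metric.mem_ball]
  rw [div_lt_iff₀ (by positivity)] at hk
  linarith

theorem exists_subset_of_isBounded {s : Set Plane} (hs : Bornology.IsBounded s) :
    ∃ Q : Cube, s ⊆ Q.toSet := by
  obtain ⟨r, hr⟩ := hs.subset_ball 0
  refine ⟨⟨(-(|r| + 1), -(|r| + 1)), 2 * (|r| + 1), by positivity⟩, hr.trans ?_⟩
  refine Set.Subset.trans ?_ (ball_subset_toSet _)
  simp only [center]
  have : ((-(|r| + 1) + 2 * (|r| + 1) / 2, -(|r| + 1) + 2 * (|r| + 1) / 2) : Plane) = 0 := by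
    ext <;> simp
  rw [this]
  exact Metric.ball_subset_ball (by linarith [le_abs_self r])

/-! ### Dyadic subcubes and stopping cubes -/

/-- The dyadic child of `Q` that contains `x`, for `x` in `Q`. -/
def child (Q : Cube) (x : Plane) : Cube where
  corner := (if x.1 < Q.corner.1 + Q.side / 2 then Q.corner.1 else Q.corner.1 + Q.side / 2,
    if x.2 < Q.corner.2 + Q.side / 2 then Q.corner.2 else Q.corner.2 + Q.side / 2)
  side := Q.side / 2
  side_pos := by have := Q.side_pos; positivity

theorem child_subset (Q : Cube) (x : Plane) : (Q.child x).toSet ⊆ Q.toSet := by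
  have := Q.side_pos
  rw [subset_iff]
  simp only [child]
  refine ⟨⟨?_, ?_⟩, ?_, ?_⟩ <;> split_ifs <;> linarith

theorem mem_child {Q : Cube} {x : Plane} (hx : x ∈ Q.toSet) : x ∈ (Q.child x).toSet := by
  rw [mem_toSet] at hx ⊢
  simp only [child]
  refine ⟨⟨?_, ?_⟩, ?_, ?_⟩ <;> split_ifs <;> linarith [hx.1.1, hx.1.2, hx.2.1, hx.2.2]

theorem child_eq_of_mem {Q : Cube} {x z : Plane} (hz : z ∈ (Q.child x).toSet) :
    Q.child z = Q.child x := by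
  have := Q.side_pos
  rw [mem_toSet] at hz
  simp only [child] at hz ⊢
  congr 2
  · split_ifs at hz ⊢ <;> first | rfl | (exfalso; linarith [hz.1.1, hz.1.2])
  · split_ifs at hz ⊢ <;> first | rfl | (exfalso; linarith [hz.2.1, hz.2.2])

/-- The dyadic subcube of `Q` of generation `n` that contains `x`. -/
def dyadic (Q : Cube) (x : Plane) : ℕ → Cube
  | 0 => Q
  | n + 1 => (dyadic Q x n).child x

theorem mem_dyadic {Q : Cube} {x : Plane} (hx : x ∈ Q.toSet) (n : ℕ) :
    x ∈ (Q.dyadic x n).toSet := by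
  induction n with
  | zero => exact hx
  | succ n ih => exact mem_child ih

theorem dyadic_side (Q : Cube) (x : Plane) (n : ℕ) : (Q.dyadic x n).side = Q.side / 2 ^ n := by
  induction n with
  | zero => simp [dyadic]
  | succ n ih => simp only [dyadic, child, ih, pow_succ]; rw [div_div]

theorem dyadic_subset (Q : Cube) (x : Plane) (n : ℕ) : (Q.dyadic x n).toSet ⊆ Q.toSet := by
  induction n with
  | zero => exact subset_rfl
  | succ n ih => exact (child_subset _ _).trans ih

/-- This is the nestedness of dyadic cubes: points sharing a cube share all its ancestors. -/
theorem dyadic_eq_of_mem {Q : Cube} {x z : Plane} {n : ℕ} (hz : z ∈ (Q.dyadic x n).toSet) :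
    ∀ m ≤ n, Q.dyadic z m = Q.dyadic x m := by
  induction n with
  | zero => intro m hm; rw [Nat.le_zero.1 hm]; rfl
  | succ n ih =>
    have ih' := ih (child_subset _ _ hz)
    intro m hm
    rcases Nat.le_succ_iff.1 hm with h | rfl
    · exact ih' m h
    · simp only [dyadic]
      rw [ih' n le_rfl]
      exact child_eq_of_mem hz

theorem setAverage_eq (Q : Cube) (g : Plane → ℝ) :
    ⨍ y in Metric.closedBall Q.center (Q.side / 2), g y = (∫ y in Q.toSet, g y) / Q.side ^ 2 := by
  rw [MeasureTheory.setAverage_eq, ← setIntegral_congr_set Q.toSet_ae_eq_closedBall, Measure.real,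
    volume_closedBall_center, ← Measure.real, volume_real, smul_eq_mul, div_eq_inv_mul]

/-- The stopping cubes of the Calderón–Zygmund decomposition of `g` at height `t` in `Q`. -/
theorem exists_stopping_cubes (Q : Cube) {g : Plane → ℝ} (hg : Integrable g) (hg0 : ∀ x, 0 ≤ g x)
    {t : ℝ} (ht : ∫ x in Q.toSet, g x ≤ t * Q.side ^ 2) :
    ∃ 𝒬 : Set Cube, 𝒬.Countable ∧ 𝒬.PairwiseDisjoint toSet ∧
      (∀ P ∈ 𝒬, P.toSet ⊆ Q.toSet ∧ t * P.side ^ 2 < ∫ x in P.toSet, g x ∧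
        ∫ x in P.toSet, g x ≤ 4 * t * P.side ^ 2) ∧
      ∀ᵐ x, x ∈ Q.toSet → (∀ P ∈ 𝒬, x ∉ P.toSet) → g x ≤ t := by
  classical
  let bad : Plane → ℕ → Prop := fun x n =>
    t * (Q.dyadic x n).side ^ 2 < ∫ y in (Q.dyadic x n).toSet, g y
  -- The maximal dyadic subcubes on which the average of `g` exceeds `t`.
  let 𝒬 : Set Cube := {P | ∃ x ∈ Q.toSet, ∃ n, P = Q.dyadic x n ∧ bad x n ∧ ∀ m < n, ¬ bad x m}
  have hbad : ∀ {x z n}, z ∈ (Q.dyadic x n).toSet → ∀ m ≤ n, (bad z m ↔ bad x m) := by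
    intro x z n hz m hm
    simp only [bad, dyadic_eq_of_mem hz m hm]
  have hdisj : 𝒬.PairwiseDisjoint toSet := by
    rintro P ⟨x, hx, n, rfl, hn, hmin⟩ P' ⟨x', hx', n', rfl, hn', hmin'⟩ hne
    rw [Function.onFun, Set.disjoint_left]
    intro z hz hz'
    apply hne
    have h1 := (hbad hz n le_rfl).2 hn
    have h1' := (hbad hz' n' le_rfl).2 hn'
    have : n = n' := by
      rcases lt_trichotomy n n' with h | h | h
      · exact absurd ((hbad hz' n h.le).1 h1) (hmin' n h)
      · exact h
      · exact absurd ((hbad hz n' h.le).1 h1') (hmin n' h)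
    subst this
    rw [← dyadic_eq_of_mem hz n le_rfl, ← dyadic_eq_of_mem hz' n le_rfl]
  refine ⟨𝒬, hdisj.countable_of_nonempty_interior fun P _ => P.interior_nonempty, hdisj, ?_, ?_⟩
  · rintro P ⟨x, hx, n, rfl, hn, hmin⟩
    refine ⟨dyadic_subset _ _ _, hn, ?_⟩
    cases n with
    | zero => exact absurd hn (not_lt.2 ht)
    | succ n =>
      -- The parent is not bad and has four times the area, whence the factor `4` in the upper
      -- bound.
      have h1 := hmin n (Nat.lt_succ_self n)
      simp only [bad, not_lt] at h1
      calc _ ≤ ∫ y in (Q.dyadic x n).toSet, g y :=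
            setIntegral_mono_set hg.integrableOn (ae_of_all _ hg0)
              (Eventually.of_forall (child_subset _ _))
        _ ≤ _ := h1
        _ = _ := by rw [dyadic_side, dyadic_side, pow_succ]; field_simp; ring
  · filter_upwards [IsUnifLocDoublingMeasure.ae_tendsto_average (volume : Measure Plane)
      hg.locallyIntegrable 1] with x hx hxQ hxP
    have hnb : ∀ n, ¬ bad x n := by
      intro n hn
      have hex : ∃ n, bad x n := ⟨n, hn⟩
      exact hxP (Q.dyadic x (Nat.find hex))
        ⟨x, hxQ, _, rfl, Nat.find_spec hex, fun m hm => Nat.find_min hex hm⟩ (mem_dyadic hxQ _)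
    -- Lebesgue differentiation along cubes that contain `x` without being centred at it: the
    -- averages over the dyadic cubes at `x`, all at most `t`, converge to `g x`.
    have hlim := hx (l := atTop) (fun n => (Q.dyadic x n).center)
      (fun n => (Q.dyadic x n).side / 2) ?_ (Eventually.of_forall fun n => ?_)
    · refine le_of_tendsto hlim (Eventually.of_forall fun n => ?_)
      rw [setAverage_eq, div_le_iff₀ (pow_pos (side_pos _) 2)]
      exact not_lt.1 (hnb n)
    · rw [tendsto_nhdsWithin_iff]
      refine ⟨?_, Eventually.of_forall fun n => by have := (Q.dyadic x n).side_pos; simpa using this⟩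
      have : Tendsto (fun n : ℕ => Q.side / 2 * (1 / 2 : ℝ) ^ n) atTop (𝓝 0) := by
        simpa using (tendsto_pow_atTop_nhds_zero_of_lt_one (by norm_num : (0:ℝ) ≤ 1 / 2)
          (by norm_num)).const_mul (Q.side / 2)
      refine this.congr fun n => ?_
      rw [dyadic_side, one_div, inv_pow]; ring
    · rw [one_mul]; exact toSet_subset_closedBall _ (mem_dyadic hxQ n)

end Cube

/-- A locally integrable function with vanishing integrals over the small cubes around the points
of a set vanishes almost everywhere on that set. -/
theorem ae_eq_zero_of_forall_cube {g : Plane → ℂ} (hg : LocallyIntegrable g) {U : Set Plane}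
    (hU : IsOpen U) (h : ∀ P : Cube, P.toSet ⊆ U → ∫ x in P.toSet, g x = 0) :
    ∀ᵐ x, x ∈ U → g x = 0 := by
  filter_upwards [IsUnifLocDoublingMeasure.ae_tendsto_average (volume : Measure Plane) hg 1]
    with x hx hxU
  obtain ⟨r, hr, hrU⟩ := Metric.isOpen_iff.1 hU x hxU
  have hlim := hx (l := 𝓝[>] (0 : ℝ)) (fun _ => x) (fun δ => δ) tendsto_id ?_
  · refine tendsto_nhds_unique (hlim.congr' ?_) tendsto_const_nhds |>.symm ▸ rfl
    filter_upwards [Ioo_mem_nhdsGT hr] with δ hδ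
    let P : Cube := ⟨(x.1 - δ, x.2 - δ), 2 * δ, by linarith [hδ.1]⟩
    have hc : P.center = x := by ext <;> simp [P, Cube.center]
    have hs : P.side / 2 = δ := by simp [P]
    have h1 : P.toSet =ᵐ[volume] Metric.closedBall x δ := by
      have := P.toSet_ae_eq_closedBall
      rwa [hc, hs] at this
    have h2 : P.toSet ⊆ U := by
      refine (P.toSet_subset_closedBall.trans ?_).trans hrU
      rw [hc, hs]; exact Metric.closedBall_subset_ball hδ.2
    rw [MeasureTheory.setAverage_eq, ← setIntegral_congr_set h1, h P h2, smul_zero]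
  · filter_upwards [self_mem_nhdsWithin] with δ hδ
    rw [one_mul]; exact Metric.mem_closedBall_self (le_of_lt hδ)

/-! ### Pointwise estimates of kernels -/

/-- The one-dimensional factor `(ℓ / max(|u|, ℓ))^θ`. -/
def falloff (θ ℓ u : ℝ) : ℝ := (ℓ / max |u| ℓ) ^ θ

/-- The majorant of `|K(x, y) - K(c, y)|` for `x` in a cube with centre `c`. -/
def bump (θ : ℝ) (P : Cube) (y : Plane) : ℝ :=
  (falloff θ P.side (y.1 - P.center.1) + falloff θ P.side (y.2 - P.center.2)) /
    dist y P.center ^ 2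

theorem falloff_nonneg {θ ℓ u : ℝ} (hℓ : 0 < ℓ) : 0 ≤ falloff θ ℓ u := by
  unfold falloff; positivity

theorem falloff_le_one {θ ℓ u : ℝ} (hℓ : 0 < ℓ) (hθ : 0 ≤ θ) : falloff θ ℓ u ≤ 1 :=
  Real.rpow_le_one (by positivity) (div_le_one_of_le₀ (le_max_right _ _) (by positivity)) hθ

theorem falloff_le_of_lt {θ ℓ u η : ℝ} (hℓ : 0 < ℓ) (hθ : 0 ≤ θ) (hη : 0 < η) (hu : η < |u|) :
    falloff θ ℓ u ≤ (ℓ / η) ^ θ :=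
  Real.rpow_le_rpow (by positivity)
    (div_le_div_of_nonneg_left hℓ.le hη (hu.le.trans (le_max_left _ _))) hθ

theorem measurable_falloff (θ ℓ : ℝ) : Measurable (falloff θ ℓ) := by
  unfold falloff
  exact (measurable_const.div ((measurable_id.abs).max measurable_const)).pow_const _

theorem measurable_bump (θ : ℝ) (P : Cube) : Measurable (bump θ P) := by
  unfold bump
  exact (((measurable_falloff _ _).comp (measurable_fst.sub_const _)).add
    ((measurable_falloff _ _).comp (measurable_snd.sub_const _))).div
    ((measurable_id.dist measurable_const).pow_const 2)

/-- If `σ` is at distance at least `2ℓ` from `γ`, the Hölder bound is available and `|σ - t| ≥ (3/4)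
|σ - γ|`. Otherwise `falloff` is at least `1/2` and the size bound `B` at both points is enough. -/
theorem norm_sub_le_falloff {κ : ℝ → ℂ} {σ γ ℓ B θ t : ℝ} (hθ : 0 < θ) (hθ1 : θ ≤ 1) (hℓ : 0 < ℓ)
    (hB : 0 ≤ B) (ht : |t - γ| ≤ ℓ / 2) (h1 : ‖κ t‖ ≤ B) (h2 : ‖κ γ‖ ≤ B)
    (h3 : |t - γ| ≤ |σ - t| / 2 → ‖κ t - κ γ‖ ≤ B * (|t - γ| / |σ - t|) ^ θ) :
    ‖κ t - κ γ‖ ≤ 4 * B * falloff θ ℓ (σ - γ) := by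
  rcases le_or_gt (2 * ℓ) |σ - γ| with h | h
  · have h4 : |σ - γ| - ℓ / 2 ≤ |σ - t| := by
      have : |σ - γ| ≤ |σ - t| + |t - γ| := abs_sub_le _ _ _
      linarith
    have h5 : 3 / 4 * |σ - γ| ≤ |σ - t| := by linarith
    refine (h3 (by linarith)).trans ?_
    have h6 : (|t - γ| / |σ - t|) ^ θ ≤ falloff θ ℓ (σ - γ) := by
      refine Real.rpow_le_rpow (by positivity) ?_ hθ.le
      rw [max_eq_left (by linarith)]
      rw [div_le_div_iff₀ (by linarith) (by linarith)]
      nlinarith [abs_nonneg (t - γ)]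
    have h7 := falloff_nonneg (θ := θ) (u := σ - γ) hℓ
    calc _ ≤ B * falloff θ ℓ (σ - γ) := by gcongr
      _ ≤ _ := by nlinarith
  · have h4 : 1 / 2 ≤ falloff θ ℓ (σ - γ) := by
      have h5 : (1 / 2 : ℝ) ≤ ℓ / max |σ - γ| ℓ := by
        rw [div_le_div_iff₀ (by norm_num) (by positivity)]
        have := max_le h.le (by linarith : ℓ ≤ 2 * ℓ)
        linarith
      have h6 : ℓ / max |σ - γ| ℓ ≤ 1 := div_le_one_of_le₀ (le_max_right _ _) (by positivity)
      calc (1 / 2 : ℝ) ≤ ℓ / max |σ - γ| ℓ := h5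
        _ = (ℓ / max |σ - γ| ℓ) ^ (1 : ℝ) := (Real.rpow_one _).symm
        _ ≤ _ := Real.rpow_le_rpow_of_exponent_ge (by positivity) h6 hθ1
    calc _ ≤ ‖κ t‖ + ‖κ γ‖ := norm_sub_le _ _
      _ ≤ 2 * B := by linarith
      _ ≤ _ := by nlinarith

theorem decay_comm (θ : ℝ) (x y : Plane) : decay θ x y = decay θ y x := by
  simp only [decay, abs_sub_comm]

/-- With `a`, `b` the coordinate distances, `(ab)⁻¹ (a/b + b/a)⁻¹ = 1/(a² + b²)`. The exponent `1`
of the decay is what makes the product structure disappear. -/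
theorem size_mul_decay {x y : Plane} (h1 : x.1 ≠ y.1) (h2 : x.2 ≠ y.2) :
    (1 / |x.1 - y.1|) * (1 / |x.2 - y.2|) * decay 1 x y ≤ 1 / dist x y ^ 2 := by
  have ha : 0 < |x.1 - y.1| := abs_pos.2 (sub_ne_zero.2 h1)
  have hb : 0 < |x.2 - y.2| := abs_pos.2 (sub_ne_zero.2 h2)
  rw [Prod.dist_eq, Real.dist_eq, Real.dist_eq, decay]
  set a := |x.1 - y.1|
  set b := |x.2 - y.2|
  rw [Real.rpow_neg (by positivity), Real.rpow_one]
  have h3 : (1 / a) * (1 / b) * (a / b + b / a)⁻¹ = 1 / (a ^ 2 + b ^ 2) := by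
    field_simp
  rw [h3]
  refine one_div_le_one_div_of_le (by positivity) ?_
  rcases max_choice a b with h | h <;> rw [h] <;> nlinarith [sq_nonneg a, sq_nonneg b]

theorem mul_size_le {x y : Plane} (h1 : x.1 ≠ y.1) (h2 : x.2 ≠ y.2) {A : ℝ} (hA : 0 ≤ A) :
    A * ((1 / |x.1 - y.1|) * (1 / |x.2 - y.2|) * decay 1 x y) ≤ A / dist x y ^ 2 := by
  rw [div_eq_mul_one_div A]
  exact mul_le_mul_of_nonneg_left (size_mul_decay h1 h2) hA

/-- The gain is relative to `|x.1 - y.1|`, which can be much smaller than `dist x y`; this is the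
defect compared with a standard kernel. -/
theorem mul_holder_fst_le {x y : Plane} (h1 : x.1 ≠ y.1) (h2 : x.2 ≠ y.2) {A θ d : ℝ} (hA : 0 ≤ A)
    (hd : 0 ≤ d) :
    A * ((d ^ θ / |x.1 - y.1| ^ (1 + θ)) * (1 / |x.2 - y.2|) * decay 1 x y) ≤
      A / dist x y ^ 2 * (d / |x.1 - y.1|) ^ θ := by
  have ha : 0 < |x.1 - y.1| := abs_pos.2 (sub_ne_zero.2 h1)
  refine le_trans (le_of_eq ?_) (mul_le_mul_of_nonneg_right (mul_size_le h1 h2 hA) (by positivity))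
  rw [Real.rpow_add ha, Real.rpow_one, Real.div_rpow hd ha.le]
  have := (Real.rpow_pos_of_pos ha θ).ne'
  field_simp

theorem mul_holder_snd_le {x y : Plane} (h1 : x.1 ≠ y.1) (h2 : x.2 ≠ y.2) {A θ d : ℝ} (hA : 0 ≤ A)
    (hd : 0 ≤ d) :
    A * ((1 / |x.1 - y.1|) * (d ^ θ / |x.2 - y.2| ^ (1 + θ)) * decay 1 x y) ≤
      A / dist x y ^ 2 * (d / |x.2 - y.2|) ^ θ := by
  have ha : 0 < |x.2 - y.2| := abs_pos.2 (sub_ne_zero.2 h2)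
  refine le_trans (le_of_eq ?_) (mul_le_mul_of_nonneg_right (mul_size_le h1 h2 hA) (by positivity))
  rw [Real.rpow_add ha, Real.rpow_one, Real.div_rpow hd ha.le]
  have := (Real.rpow_pos_of_pos ha θ).ne'
  field_simp

namespace IsKernelWith

variable {θ A : ℝ} {K : Plane → Plane → ℂ}

theorem nonneg (hK : IsKernelWith θ 1 A K) : 0 ≤ A := by
  have h := (norm_nonneg _).trans (hK.size (1, 1) (0, 0) (by simp) (by simp))
  have h2 : 0 < decay 1 ((1, 1) : Plane) (0, 0) := by
    unfold decay; simp; positivity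
  simp at h
  exact nonneg_of_mul_nonneg_left h h2

theorem norm_le (hK : IsKernelWith θ 1 A K) {x y : Plane} (h1 : x.1 ≠ y.1) (h2 : x.2 ≠ y.2) :
    ‖K x y‖ ≤ A / dist x y ^ 2 :=
  (hK.size x y h1 h2).trans (mul_size_le h1 h2 hK.nonneg)

/-- The hypotheses are symmetric in the two arguments, so oscillation estimates need proof only in
the second one. -/
theorem swap {θ₁ θ₂ : ℝ} (hK : IsKernelWith θ₁ θ₂ A K) :
    IsKernelWith θ₁ θ₂ A (fun x y => K y x) where
  size x y h1 h2 := by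
    rw [abs_sub_comm x.1, abs_sub_comm x.2, decay_comm]; exact hK.size y x h1.symm h2.symm
  holder_x1 x y w h1 h2 hw := by
    rw [abs_sub_comm x.1 y.1, abs_sub_comm x.2 y.2, decay_comm]
    exact hK.holder_y1 y x w h1.symm h2.symm (by rwa [abs_sub_comm y.1])
  holder_x2 x y w h1 h2 hw := by
    rw [abs_sub_comm x.1 y.1, abs_sub_comm x.2 y.2, decay_comm]
    exact hK.holder_y2 y x w h1.symm h2.symm (by rwa [abs_sub_comm y.2])
  holder_y1 x y w h1 h2 hw := by
    rw [abs_sub_comm x.1 y.1, abs_sub_comm x.2 y.2, decay_comm]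
    exact hK.holder_x1 y x w h1.symm h2.symm (by rwa [abs_sub_comm y.1 x.1])
  holder_y2 x y w h1 h2 hw := by
    rw [abs_sub_comm x.1 y.1, abs_sub_comm x.2 y.2, decay_comm]
    exact hK.holder_x2 y x w h1.symm h2.symm (by rwa [abs_sub_comm y.2 x.2])

theorem norm_sub_fst_le (hK : IsKernelWith θ 1 A K) {x y : Plane} (h1 : x.1 ≠ y.1)
    (h2 : x.2 ≠ y.2) {w : ℝ} (hw : |y.1 - w| ≤ |x.1 - y.1| / 2) :
    ‖K x y - K x (w, y.2)‖ ≤ A / dist x y ^ 2 * (|y.1 - w| / |x.1 - y.1|) ^ θ :=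
  (hK.holder_y1 x y w h1 h2 hw).trans (mul_holder_fst_le h1 h2 hK.nonneg (abs_nonneg _))

theorem norm_sub_snd_le (hK : IsKernelWith θ 1 A K) {x y : Plane} (h1 : x.1 ≠ y.1)
    (h2 : x.2 ≠ y.2) {w : ℝ} (hw : |y.2 - w| ≤ |x.2 - y.2| / 2) :
    ‖K x y - K x (y.1, w)‖ ≤ A / dist x y ^ 2 * (|y.2 - w| / |x.2 - y.2|) ^ θ :=
  (hK.holder_y2 x y w h1 h2 hw).trans (mul_holder_snd_le h1 h2 hK.nonneg (abs_nonneg _))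

/-- The kernel varies little over a cube, seen from outside the triple of the cube. -/
theorem norm_sub_center_le (hK : IsKernelWith θ 1 A K) (hθ : 0 < θ) (hθ1 : θ ≤ 1) {P : Cube}
    {s y : Plane} (hy : y ∈ P.toSet) (hs : s ∉ P.triple.toSet) (h1 : s.1 ≠ y.1) (h2 : s.2 ≠ y.2)
    (hc1 : s.1 ≠ P.center.1) (hc2 : s.2 ≠ P.center.2) :
    ‖K s y - K s P.center‖ ≤ 9 * A * bump θ P s := by
  have hℓ := P.side_pos
  have hA := hK.nonneg
  have hr := Cube.le_dist_center_of_notMem hs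
  rw [Cube.triple_center, Cube.triple_side] at hr
  set c := P.center with hc
  set r := dist s c with hrdef
  have hr0 : 0 < r := by linarith
  have hy1 := Cube.abs_fst_sub_center_le hy
  have hy2 := Cube.abs_snd_sub_center_le hy
  rw [← hc] at hy1 hy2
  -- Off the triple, `r ≥ (3/2) P.side`, so points of `P` are at distance at least `(2/3) r` from
  -- `s`; hence `9/4 = (3/2)²`.
  have key : ∀ z : Plane, |z.1 - c.1| ≤ P.side / 2 → |z.2 - c.2| ≤ P.side / 2 →
      A / dist s z ^ 2 ≤ 9 / 4 * A / r ^ 2 := by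
    intro z hz1 hz2
    have hz : dist z c ≤ P.side / 2 := by
      rw [Prod.dist_eq, Real.dist_eq, Real.dist_eq]; exact max_le hz1 hz2
    have h3 : 2 / 3 * r ≤ dist s z := by
      have := dist_triangle s z c
      rw [← hrdef] at this
      linarith
    calc A / dist s z ^ 2 ≤ A / (2 / 3 * r) ^ 2 :=
          div_le_div_of_nonneg_left hA (by positivity) (by gcongr)
      _ = _ := by field_simp; ring
  have hB : 0 ≤ 9 / 4 * A / r ^ 2 := by positivity
  have hhalf : |(0:ℝ)| ≤ P.side / 2 := by rw [abs_zero]; positivity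
  -- The point `y` is moved to the centre one coordinate at a time, through `(c.1, y.2)`, because
  -- smoothness is only given separately in each coordinate.
  have e1 : ‖K s y - K s (c.1, y.2)‖ ≤
      4 * (9 / 4 * A / r ^ 2) * falloff θ P.side (s.1 - c.1) := by
    refine norm_sub_le_falloff (κ := fun t => K s (t, y.2)) (t := y.1) hθ hθ1 hℓ hB hy1 ?_ ?_ ?_
    · exact (hK.norm_le h1 h2).trans (key y hy1 hy2)
    · exact (hK.norm_le (y := (c.1, y.2)) hc1 h2).trans
        (key (c.1, y.2) (by simpa using hhalf) hy2)
    · intro h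
      exact (hK.norm_sub_fst_le h1 h2 h).trans
        (mul_le_mul_of_nonneg_right (key y hy1 hy2) (by positivity))
  have e2 : ‖K s (c.1, y.2) - K s (c.1, c.2)‖ ≤
      4 * (9 / 4 * A / r ^ 2) * falloff θ P.side (s.2 - c.2) := by
    refine norm_sub_le_falloff (κ := fun t => K s (c.1, t)) (t := y.2) hθ hθ1 hℓ hB hy2 ?_ ?_ ?_
    · exact (hK.norm_le (y := (c.1, y.2)) hc1 h2).trans
        (key (c.1, y.2) (by simpa using hhalf) hy2)
    · exact (hK.norm_le (y := (c.1, c.2)) hc1 hc2).trans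
        (key (c.1, c.2) (by simpa using hhalf) (by simpa using hhalf))
    · intro h
      exact (hK.norm_sub_snd_le (y := (c.1, y.2)) hc1 h2 h).trans
        (mul_le_mul_of_nonneg_right (key (c.1, y.2) (by simpa using hhalf) hy2) (by positivity))
  calc ‖K s y - K s c‖ = ‖(K s y - K s (c.1, y.2)) + (K s (c.1, y.2) - K s (c.1, c.2))‖ := by
        congr 1; ring
    _ ≤ _ := norm_add_le _ _
    _ ≤ _ := add_le_add e1 e2
    _ = 9 * A * bump θ P s := by rw [bump, ← hc, ← hrdef]; field_simp

/-- A kernel is continuous where it is controlled. -/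
theorem continuousOn (hK : IsKernelWith θ 1 A K) (hθ : 0 < θ) :
    ContinuousOn (Function.uncurry K) {z : Plane × Plane | z.1.1 ≠ z.2.1 ∧ z.1.2 ≠ z.2.2} := by
  have hA := hK.nonneg
  rintro ⟨x, y⟩ ⟨h1, h2⟩
  simp only at h1 h2
  apply ContinuousAt.continuousWithinAt
  have ha : 0 < |x.1 - y.1| := abs_pos.2 (sub_ne_zero.2 h1)
  have hb : 0 < |x.2 - y.2| := abs_pos.2 (sub_ne_zero.2 h2)
  obtain ⟨m, hm, hma, hmb⟩ : ∃ m : ℝ, 0 < m ∧ m ≤ |x.1 - y.1| ∧ m ≤ |x.2 - y.2| :=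
    ⟨min _ _, lt_min ha hb, min_le_left _ _, min_le_right _ _⟩
  -- Cost of moving one coordinate by at most `ε` while both coordinate distances stay above `m /
  -- 2`. Four such moves, two of them for the swapped kernel, lead from `(x', y')` to `(x, y)`.
  have step : ∀ {K : Plane → Plane → ℂ}, IsKernelWith θ 1 A K → ∀ {x y : Plane} {ε w : ℝ},
      m / 2 ≤ |x.1 - y.1| → m / 2 ≤ |x.2 - y.2| → ε ≤ m / 8 →
      (|y.1 - w| ≤ ε → ‖K x y - K x (w, y.2)‖ ≤ A / (m / 2) ^ 2 * (ε / (m / 2)) ^ θ) ∧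
      (|y.2 - w| ≤ ε → ‖K x y - K x (y.1, w)‖ ≤ A / (m / 2) ^ 2 * (ε / (m / 2)) ^ θ) := by
    intro K hK x y ε w ha hb hε
    have h1 : x.1 ≠ y.1 := by
      intro h; rw [h, sub_self, abs_zero] at ha; linarith
    have h2 : x.2 ≠ y.2 := by
      intro h; rw [h, sub_self, abs_zero] at hb; linarith
    have hd : m / 2 ≤ dist x y := by
      rw [Prod.dist_eq, Real.dist_eq]; exact ha.trans (le_max_left _ _)
    have hAd : A / dist x y ^ 2 ≤ A / (m / 2) ^ 2 :=
      div_le_div_of_nonneg_left hA (by positivity) (by gcongr)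
    constructor
    · intro hw
      refine (hK.norm_sub_fst_le h1 h2 (by linarith)).trans ?_
      have : |y.1 - w| / |x.1 - y.1| ≤ ε / (m / 2) :=
        div_le_div₀ ((abs_nonneg _).trans hw) hw (by positivity) ha
      gcongr
    · intro hw
      refine (hK.norm_sub_snd_le h1 h2 (by linarith)).trans ?_
      have : |y.2 - w| / |x.2 - y.2| ≤ ε / (m / 2) :=
        div_le_div₀ ((abs_nonneg _).trans hw) hw (by positivity) hb
      gcongr
  rw [ContinuousAt, tendsto_iff_dist_tendsto_zero]
  have hlim : Tendsto (fun z : Plane × Plane =>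
      4 * (A / (m / 2) ^ 2 * (dist z (x, y) / (m / 2)) ^ θ)) (𝓝 (x, y)) (𝓝 0) := by
    have h0 : Tendsto (fun z : Plane × Plane => dist z (x, y) / (m / 2)) (𝓝 (x, y)) (𝓝 0) := by
      have : Continuous fun z : Plane × Plane => dist z (x, y) / (m / 2) := by fun_prop
      simpa using this.tendsto (x, y)
    have h3 := ((h0.rpow_const (p := θ) (Or.inr hθ.le)).const_mul (A / (m / 2) ^ 2)).const_mul 4
    rwa [Real.zero_rpow hθ.ne', mul_zero, mul_zero] at h3
  refine squeeze_zero' (Eventually.of_forall fun _ => dist_nonneg) ?_ hlim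
  filter_upwards [Metric.ball_mem_nhds (x, y) (by positivity : 0 < m / 8)] with ⟨x', y'⟩ hz
  rw [Metric.mem_ball] at hz
  set ε := dist (x', y') (x, y) with hε
  have hε' : dist x' x ≤ ε ∧ dist y' y ≤ ε := by
    rw [hε, Prod.dist_eq]; exact ⟨le_max_left _ _, le_max_right _ _⟩
  have hx' : |x'.1 - x.1| ≤ ε ∧ |x'.2 - x.2| ≤ ε := by
    have := hε'.1; rw [Prod.dist_eq, max_le_iff, Real.dist_eq, Real.dist_eq] at this; exact this
  have hy' : |y'.1 - y.1| ≤ ε ∧ |y'.2 - y.2| ≤ ε := by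
    have := hε'.2; rw [Prod.dist_eq, max_le_iff, Real.dist_eq, Real.dist_eq] at this; exact this
  have tri : ∀ {a b a' b' : ℝ}, m ≤ |a - b| → |a' - a| ≤ ε → |b' - b| ≤ ε →
      m / 2 ≤ |a' - b'| := by
    intro a b a' b' h h3 h4
    have : |a - b| ≤ |a - a'| + |a' - b'| + |b' - b| :=
      (abs_sub_le a b' b).trans (by gcongr; exact abs_sub_le _ _ _)
    rw [abs_sub_comm a a'] at this
    linarith
  have z0 : |(0 : ℝ)| ≤ ε := by rw [abs_zero]; exact dist_nonneg
  have s1 := (step hK.swap (x := y) (y := x') (w := x.1) (by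
      rw [abs_sub_comm]; exact tri hma hx'.1 (by simpa using z0)) (by
      rw [abs_sub_comm]; exact tri hmb hx'.2 (by simpa using z0)) hz.le).1 hx'.1
  have s2 := (step hK.swap (x := y) (y := (x.1, x'.2)) (w := x.2) (by
      rw [abs_sub_comm]; linarith) (by
      rw [abs_sub_comm]; exact tri hmb hx'.2 (by simpa using z0)) hz.le).2 hx'.2
  have s3 := (step hK (x := x') (y := y') (w := y.1) (tri hma hx'.1 hy'.1)
    (tri hmb hx'.2 hy'.2) hz.le).1 hy'.1
  have s4 := (step hK (x := x') (y := (y.1, y'.2)) (w := y.2)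
    (tri hma hx'.1 (by simpa using z0)) (tri hmb hx'.2 hy'.2) hz.le).2 hy'.2
  rw [dist_eq_norm]
  calc ‖K x' y' - K x y‖ = ‖(K x' y' - K x' (y.1, y'.2)) + (K x' (y.1, y'.2) - K x' (y.1, y.2)) +
        (K x' y - K (x.1, x'.2) y) + (K (x.1, x'.2) y - K (x.1, x.2) y)‖ := by congr 1; ring
    _ ≤ _ := norm_add₄_le
    _ ≤ _ := by linarith

end IsKernelWith

/-! ### Generic points, and measurable versions of kernels -/

theorem ae_fst_ne (c : ℝ) : ∀ᵐ y : Plane, c ≠ y.1 := by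
  have h : {y : Plane | ¬ c ≠ y.1} = {c} ×ˢ Set.univ := by
    ext y; simp [eq_comm]
  rw [ae_iff, h, Measure.volume_eq_prod, Measure.prod_prod]; simp

theorem ae_snd_ne (c : ℝ) : ∀ᵐ y : Plane, c ≠ y.2 := by
  have h : {y : Plane | ¬ c ≠ y.2} = Set.univ ×ˢ {c} := by
    ext y; simp [eq_comm]
  rw [ae_iff, h, Measure.volume_eq_prod, Measure.prod_prod]; simp

/-- The points of `ℝ² × ℝ²` where a kernel is controlled. -/
def offDiagonals : Set (Plane × Plane) := {z | z.1.1 ≠ z.2.1 ∧ z.1.2 ≠ z.2.2}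

theorem isOpen_offDiagonals : IsOpen offDiagonals :=
  (isOpen_ne_fun (by fun_prop) (by fun_prop)).inter (isOpen_ne_fun (by fun_prop) (by fun_prop))

theorem ae_mem_offDiagonals : ∀ᵐ z : Plane × Plane, z ∈ offDiagonals := by
  rw [Measure.volume_eq_prod]
  refine (Measure.ae_prod_iff_ae_ae isOpen_offDiagonals.measurableSet).2 (ae_of_all _ fun x => ?_)
  filter_upwards [ae_fst_ne x.1, ae_snd_ne x.2] with y h1 h2 using ⟨h1, h2⟩

/-- A kernel set to `0` where it is not controlled. -/
def cutKernel (K : Plane → Plane → ℂ) (x y : Plane) : ℂ :=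
  offDiagonals.indicator (Function.uncurry K) (x, y)

theorem cutKernel_eq {K : Plane → Plane → ℂ} {x y : Plane} (h1 : x.1 ≠ y.1) (h2 : x.2 ≠ y.2) :
    cutKernel K x y = K x y :=
  Set.indicator_of_mem (s := offDiagonals) (a := (x, y)) ⟨h1, h2⟩ _

/-- The moved coordinate travels at most half its distance to the diagonal, so every point in the
estimates stays where `K` is unchanged. -/
theorem IsKernelWith.cutKernel {θ A : ℝ} {K : Plane → Plane → ℂ} (hK : IsKernelWith θ 1 A K) :
    IsKernelWith θ 1 A (cutKernel K) := by
  have aux : ∀ {a b w : ℝ}, a ≠ b → |a - w| ≤ |a - b| / 2 → w ≠ b := by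
    rintro a b w h1 h2 rfl
    have := abs_pos.2 (sub_ne_zero.2 h1)
    linarith
  have aux' : ∀ {a b w : ℝ}, a ≠ b → |b - w| ≤ |a - b| / 2 → a ≠ w := by
    rintro a b w h1 h2 rfl
    rw [abs_sub_comm] at h2
    have := abs_pos.2 (sub_ne_zero.2 h1)
    linarith
  constructor
  · intro x y h1 h2
    rw [cutKernel_eq h1 h2]; exact hK.size x y h1 h2
  · intro x y w h1 h2 hw
    rw [cutKernel_eq h1 h2, cutKernel_eq (x := (w, x.2)) (aux h1 hw) h2]
    exact hK.holder_x1 x y w h1 h2 hw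
  · intro x y w h1 h2 hw
    rw [cutKernel_eq h1 h2, cutKernel_eq (x := (x.1, w)) h1 (aux h2 hw)]
    exact hK.holder_x2 x y w h1 h2 hw
  · intro x y w h1 h2 hw
    rw [cutKernel_eq h1 h2, cutKernel_eq (y := (w, y.2)) (aux' h1 hw) h2]
    exact hK.holder_y1 x y w h1 h2 hw
  · intro x y w h1 h2 hw
    rw [cutKernel_eq h1 h2, cutKernel_eq (y := (y.1, w)) h1 (aux' h2 hw)]
    exact hK.holder_y2 x y w h1 h2 hw

/-- Measurability is not part of the definition of a kernel; it follows from continuity on the open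
set `offDiagonals`. -/
theorem IsKernelWith.measurable_cutKernel {θ A : ℝ} {K : Plane → Plane → ℂ}
    (hK : IsKernelWith θ 1 A K) (hθ : 0 < θ) : Measurable (Function.uncurry (CZX.cutKernel K)) := by
  have h : Function.uncurry (CZX.cutKernel K) = offDiagonals.indicator (Function.uncurry K) := rfl
  classical
  rw [h, ← Set.piecewise_eq_indicator]
  exact ContinuousOn.measurable_piecewise (s := offDiagonals) (g := 0) (hK.continuousOn hθ)
    continuousOn_const isOpen_offDiagonals.measurableSet

theorem norm_cutKernel_le {θ A : ℝ} {K : Plane → Plane → ℂ} (hK : IsKernelWith θ 1 A K)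
    (x y : Plane) : ‖cutKernel K x y‖ ≤ A / dist x y ^ 2 := by
  by_cases h : (x, y) ∈ offDiagonals
  · rw [cutKernel_eq h.1 h.2]; exact hK.norm_le h.1 h.2
  · rw [cutKernel, Set.indicator_of_notMem h, norm_zero]
    exact div_nonneg hK.nonneg (sq_nonneg _)

theorem HasKernel.cutKernel
    {T : Lp ℂ 2 (volume : Measure Plane) →L[ℂ] Lp ℂ 2 (volume : Measure Plane)}
    {K : Plane → Plane → ℂ} (hT : HasKernel T K) : HasKernel T (CZX.cutKernel K) := by
  intro f g hf hg h
  rw [hT f g hf hg h]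
  refine integral_congr_ae ?_
  filter_upwards [ae_mem_offDiagonals] with z hz
  rw [cutKernel_eq hz.1 hz.2]

/-! ### Averages and the tail estimate -/

/-- Hölder's inequality on a set of relative measure `δ`. The gain `δ ^ (1 - 1 / p)` is what
compensates for the missing smoothness near the cross. -/
theorem lintegral_le_pAvg {p : ℝ} (hp : 1 < p) {g : Plane → ℂ} {S : Cube} {A : Set Plane}
    (hg : AEMeasurable g (volume.restrict A)) (hA : A ⊆ S.toSet) {δ : ℝ} (hδ : 0 ≤ δ)
    (hAδ : volume A ≤ ENNReal.ofReal δ * volume S.toSet) :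
    ∫⁻ x in A, ‖g x‖ₑ ≤ volume S.toSet * ENNReal.ofReal (δ ^ (1 - 1 / p)) * pAvg p g S := by
  have hp0 : 0 < p := by linarith
  have hq : p.HolderConjugate (p.conjExponent) := Real.HolderConjugate.conjExponent hp
  have hq' : 1 / p.conjExponent = 1 - 1 / p := by
    have := hq.inv_add_inv_eq_one
    rw [one_div, one_div]; linarith
  have hs : 0 ≤ 1 - 1 / p := by rw [← hq']; exact one_div_nonneg.2 hq.symm.nonneg
  have h := ENNReal.lintegral_mul_le_Lp_mul_Lq (volume.restrict A) hq (f := fun x => ‖g x‖ₑ)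
    (g := fun _ => 1) hg.enorm aemeasurable_const
  simp only [Pi.mul_apply, mul_one, ENNReal.one_rpow, lintegral_const, Measure.restrict_apply
    MeasurableSet.univ, Set.univ_inter, one_mul, hq'] at h
  refine h.trans ?_
  set V := volume S.toSet with hV
  have hV0 : V ≠ 0 := S.volume_ne_zero
  have hVt : V ≠ ∞ := S.volume_ne_top
  have h1 : ∫⁻ x in A, ‖g x‖ₑ ^ p ≤ V * (V⁻¹ * ∫⁻ x in S.toSet, ‖g x‖ₑ ^ p) := by
    rw [← mul_assoc, ENNReal.mul_inv_cancel hV0 hVt, one_mul]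
    exact lintegral_mono_set hA
  calc _ ≤ (V * (V⁻¹ * ∫⁻ x in S.toSet, ‖g x‖ₑ ^ p)) ^ (1 / p) *
        (ENNReal.ofReal δ * V) ^ (1 - 1 / p) := by gcongr
    _ = V ^ (1 / p) * pAvg p g S * (ENNReal.ofReal (δ ^ (1 - 1 / p)) * V ^ (1 - 1 / p)) := by
      rw [ENNReal.mul_rpow_of_nonneg _ _ (by positivity), ENNReal.mul_rpow_of_nonneg _ _ hs,
        ENNReal.ofReal_rpow_of_nonneg hδ hs, pAvg]
    _ = (V ^ (1 / p) * V ^ (1 - 1 / p)) * ENNReal.ofReal (δ ^ (1 - 1 / p)) * pAvg p g S := by ring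
    _ = _ := by
      rw [← ENNReal.rpow_add _ _ hV0 hVt]; simp

theorem lintegral_cube_le_pAvg {p : ℝ} (hp : 1 < p) {g : Plane → ℂ} {S : Cube}
    (hg : AEMeasurable g (volume.restrict S.toSet)) :
    ∫⁻ x in S.toSet, ‖g x‖ₑ ≤ volume S.toSet * pAvg p g S := by
  have := lintegral_le_pAvg hp hg subset_rfl zero_le_one (by simp)
  simpa using this

/-- On the strip `|u| ≤ η` the falloff is bounded by `1` and the strip is thin; off the strip the
falloff itself is at most `(ℓ / η) ^ θ`. -/
theorem lintegral_falloff_le {p : ℝ} (hp : 1 < p) {g : Plane → ℂ} (hg : AEMeasurable g)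
    {S : Cube} {u : Plane → ℝ} (hu : Measurable u) {η δ ℓ θ : ℝ} (hη : 0 < η) (hδ : 0 ≤ δ)
    (hℓ : 0 < ℓ) (hθ : 0 ≤ θ)
    (hstrip : volume (S.toSet ∩ {y | |u y| ≤ η}) ≤ ENNReal.ofReal δ * volume S.toSet) :
    ∫⁻ y in S.toSet, ‖g y‖ₑ * ENNReal.ofReal (falloff θ ℓ (u y)) ≤
      volume S.toSet * ENNReal.ofReal (δ ^ (1 - 1 / p) + (ℓ / η) ^ θ) * pAvg p g S := by
  have hm : MeasurableSet {y | |u y| ≤ η} := measurableSet_le hu.abs measurable_const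
  calc _ ≤ ∫⁻ y in S.toSet, ({y | |u y| ≤ η}.indicator (fun y => ‖g y‖ₑ) y +
        ENNReal.ofReal ((ℓ / η) ^ θ) * ‖g y‖ₑ) := by
        refine lintegral_mono fun y => ?_
        by_cases hy : |u y| ≤ η
        · rw [Set.indicator_of_mem (s := {y | |u y| ≤ η}) hy]
          refine le_add_right ?_
          calc _ ≤ ‖g y‖ₑ * 1 := by
                gcongr; exact ENNReal.ofReal_le_one.2 (falloff_le_one hℓ hθ)
            _ = _ := mul_one _
        · rw [Set.indicator_of_notMem (s := {y | |u y| ≤ η}) hy, zero_add, mul_comm]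
          gcongr
          exact falloff_le_of_lt hℓ hθ hη (not_le.1 hy)
    _ = (∫⁻ y in S.toSet ∩ {y | |u y| ≤ η}, ‖g y‖ₑ) +
        ENNReal.ofReal ((ℓ / η) ^ θ) * ∫⁻ y in S.toSet, ‖g y‖ₑ := by
        rw [lintegral_add_right' _ (hg.enorm.const_mul _).restrict, lintegral_indicator hm,
          Measure.restrict_restrict hm, Set.inter_comm, lintegral_const_mul'' _ hg.enorm.restrict]
    _ ≤ volume S.toSet * ENNReal.ofReal (δ ^ (1 - 1 / p)) * pAvg p g S +
        ENNReal.ofReal ((ℓ / η) ^ θ) * (volume S.toSet * pAvg p g S) := by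
        gcongr
        · exact lintegral_le_pAvg hp hg.restrict Set.inter_subset_left hδ hstrip
        · exact lintegral_cube_le_pAvg hp hg.restrict
    _ = _ := by
        rw [ENNReal.ofReal_add (by positivity) (by positivity)]; ring

/-- Bernoulli's inequality gives `(1 - 1/3) ^ s ≤ 1 - s / 3`. With `s = 1 - 1 / p` the bound `3 / s`
is three times the conjugate exponent. -/
theorem tsum_geometric_le {s : ℝ} (hs : 0 < s) (hs1 : s ≤ 1) :
    ∑' k : ℕ, ENNReal.ofReal (((2 / 3 : ℝ) ^ s) ^ k) ≤ ENNReal.ofReal (3 / s) := by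
  have h0 : (0 : ℝ) ≤ (2 / 3) ^ s := by positivity
  have h1 : ((2 : ℝ) / 3) ^ s ≤ 1 - s / 3 := by
    have := rpow_one_add_le_one_add_mul_self (s := -1 / 3) (by norm_num) hs.le hs1
    calc ((2 : ℝ) / 3) ^ s = (1 + (-1 / 3)) ^ s := by norm_num
      _ ≤ _ := this
      _ = _ := by ring
  have h2 : ((2 : ℝ) / 3) ^ s < 1 := by linarith
  rw [← ENNReal.ofReal_tsum_of_nonneg (fun k => by positivity)
    (summable_geometric_of_lt_one h0 h2), tsum_geometric_of_lt_one h0 h2]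
  apply ENNReal.ofReal_le_ofReal
  rw [← one_div]
  rw [div_le_div_iff₀ (by linarith) hs]
  linarith

theorem volume_inter_fst_strip_le (S : Cube) {η : ℝ} (hη : 0 ≤ η) (c : ℝ) :
    volume (S.toSet ∩ {y | |y.1 - c| ≤ η}) ≤
      ENNReal.ofReal (2 * η / S.side) * volume S.toSet := by
  have hs := S.side_pos
  have h : S.toSet ∩ {y | |y.1 - c| ≤ η} ⊆
      Metric.closedBall c η ×ˢ Set.Ico S.corner.2 (S.corner.2 + S.side) := by
    rintro y ⟨h1, h2⟩
    exact ⟨by rwa [Metric.mem_closedBall, Real.dist_eq], h1.2⟩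
  refine (measure_mono h).trans (le_of_eq ?_)
  rw [Cube.volume_toSet, Measure.volume_eq_prod, Measure.prod_prod, Real.volume_closedBall,
    Real.volume_Ico, add_sub_cancel_left, ← ENNReal.ofReal_mul (by positivity),
    ← ENNReal.ofReal_mul (by positivity)]
  congr 1; field_simp

theorem volume_inter_snd_strip_le (S : Cube) {η : ℝ} (hη : 0 ≤ η) (c : ℝ) :
    volume (S.toSet ∩ {y | |y.2 - c| ≤ η}) ≤
      ENNReal.ofReal (2 * η / S.side) * volume S.toSet := by
  have hs := S.side_pos
  have h : S.toSet ∩ {y | |y.2 - c| ≤ η} ⊆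
      Set.Ico S.corner.1 (S.corner.1 + S.side) ×ˢ Metric.closedBall c η := by
    rintro y ⟨h1, h2⟩
    exact ⟨h1.1, by rwa [Metric.mem_closedBall, Real.dist_eq]⟩
  refine (measure_mono h).trans (le_of_eq ?_)
  rw [Cube.volume_toSet, Measure.volume_eq_prod, Measure.prod_prod, Real.volume_closedBall,
    Real.volume_Ico, add_sub_cancel_left, ← ENNReal.ofReal_mul (by positivity),
    ← ENNReal.ofReal_mul (by positivity)]
  congr 1; field_simp

theorem compl_triple_subset_iUnion (P : Cube) : P.triple.toSetᶜ ⊆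
    ⋃ k : ℕ, (Cube.triple^[k + 2] P).toSet \ (Cube.triple^[k + 1] P).toSet := by
  classical
  intro x hx
  have hex := P.exists_mem_iterate_triple x
  have h1 : 2 ≤ Nat.find hex := by
    by_contra! h
    exact hx (Cube.subset_iterate_triple P (by omega : Nat.find hex ≤ 1) (Nat.find_spec hex))
  obtain ⟨k, hk⟩ := Nat.exists_eq_add_of_le' h1
  refine Set.mem_iUnion.2 ⟨k, ?_, Nat.find_min hex (by omega)⟩
  rw [← hk]; exact Nat.find_spec hex

/-- The tail estimate: the bump of a cube tests functions by their `p`-averages over the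
dilates of the cube, with a constant proportional to the conjugate exponent. -/
theorem lintegral_mul_bump_le {p : ℝ} (hp : 1 < p) {g : Plane → ℂ} (hg : AEMeasurable g)
    {θ : ℝ} (hθ : 0 < θ) (hθ1 : θ ≤ 1) {P : Cube} {M : ℝ≥0∞}
    (hM : ∀ k : ℕ, pAvg p g (Cube.triple^[k + 1] P) ≤ M) :
    ∫⁻ y in P.triple.toSetᶜ, ‖g y‖ₑ * ENNReal.ofReal (bump θ P y) ≤
      ENNReal.ofReal (648 / θ * (p / (p - 1))) * M := by
  have hℓ := P.side_pos
  have hp0 : 0 < p := by linarith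
  have hp1 : 0 < p - 1 := by linarith
  set s := 1 - 1 / p with hs
  have hs' : s = (p - 1) / p := by rw [hs]; field_simp
  have hs0 : 0 < s := by rw [hs']; positivity
  have hs1 : s ≤ 1 := by rw [hs]; linarith [one_div_pos.2 hp0]
  have main : ∀ k : ℕ, ∫⁻ y in (Cube.triple^[k + 2] P).toSet \ (Cube.triple^[k + 1] P).toSet,
      ‖g y‖ₑ * ENNReal.ofReal (bump θ P y) ≤
      72 * (2 * ENNReal.ofReal (((2 / 3 : ℝ) ^ s) ^ k) +
        ENNReal.ofReal (((2 / 3 : ℝ) ^ θ) ^ k)) * M := by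
    intro k
    set S := Cube.triple^[k + 2] P with hS
    have hSs : S.side = 3 ^ (k + 2) * P.side := Cube.iterate_triple_side P (k + 2)
    -- A width between `ℓ` and `3 ^ (k + 2) ℓ`: both the relative width of the strip, about `(2/3) ^
    -- k`, and the falloff outside it, about `2 ^ (-θ k)`, decay geometrically.
    set η := P.side * 2 ^ (k + 2) with hη
    have hη0 : 0 < η := by positivity
    set δ := 2 * η / S.side with hδ
    have hδ' : δ = 2 * (2 / 3) ^ (k + 2) := by
      rw [hδ, hη, hSs, div_pow]; field_simp
    have hδ0 : 0 ≤ δ := by rw [hδ']; positivity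
    have hsum : δ ^ s + (P.side / η) ^ θ ≤ 2 * ((2 / 3 : ℝ) ^ s) ^ k + ((2 / 3 : ℝ) ^ θ) ^ k := by
      have e1 : δ ^ s ≤ 2 * ((2 / 3 : ℝ) ^ s) ^ k := by
        rw [hδ', Real.mul_rpow (by norm_num) (by positivity)]
        have h1 : (2 : ℝ) ^ s ≤ 2 := by
          calc (2 : ℝ) ^ s ≤ 2 ^ (1 : ℝ) := Real.rpow_le_rpow_of_exponent_le (by norm_num) hs1
            _ = 2 := Real.rpow_one _
        have h2 : (((2 : ℝ) / 3) ^ (k + 2)) ^ s ≤ ((2 / 3 : ℝ) ^ s) ^ k := by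
          rw [← Real.rpow_pow_comm (by norm_num)]
          exact pow_le_pow_of_le_one (by positivity)
            (Real.rpow_le_one (by norm_num) (by norm_num) hs0.le) (by omega)
        gcongr
      have e2 : (P.side / η) ^ θ ≤ ((2 / 3 : ℝ) ^ θ) ^ k := by
        have h3 : P.side / η = (1 / 2) ^ (k + 2) := by
          rw [hη, div_pow, one_pow]; field_simp
        rw [h3, Real.rpow_pow_comm (by norm_num)]
        refine Real.rpow_le_rpow (by positivity) ?_ hθ.le
        calc ((1 : ℝ) / 2) ^ (k + 2) ≤ (1 / 2) ^ k :=
              pow_le_pow_of_le_one (by norm_num) (by norm_num) (by omega)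
          _ ≤ (2 / 3) ^ k := pow_le_pow_left₀ (by norm_num) (by norm_num) k
      linarith
    have f1 := lintegral_falloff_le hp hg (S := S) (u := fun y => y.1 - P.center.1)
      (measurable_fst.sub_const _) hη0 hδ0 hℓ hθ.le
      (volume_inter_fst_strip_le S hη0.le P.center.1)
    have f2 := lintegral_falloff_le hp hg (S := S) (u := fun y => y.2 - P.center.2)
      (measurable_snd.sub_const _) hη0 hδ0 hℓ hθ.le
      (volume_inter_snd_strip_le S hη0.le P.center.2)
    set V := volume S.toSet with hV
    have hV0 : V ≠ 0 := S.volume_ne_zero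
    have hVt : V ≠ ∞ := S.volume_ne_top
    have hVe : V = ENNReal.ofReal (S.side ^ 2) := S.volume_toSet
    have hmS : MeasurableSet (S.toSet \ (Cube.triple^[k + 1] P).toSet) :=
      S.measurableSet_toSet.diff (Cube.measurableSet_toSet _)
    have mf : ∀ i : Plane → ℝ, Measurable i → Measurable fun y => falloff θ P.side (i y) :=
      fun i hi => (measurable_falloff _ _).comp hi
    calc _ ≤ ∫⁻ y in S.toSet \ (Cube.triple^[k + 1] P).toSet,
          36 * V⁻¹ * (‖g y‖ₑ * ENNReal.ofReal (falloff θ P.side (y.1 - P.center.1)) +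
            ‖g y‖ₑ * ENNReal.ofReal (falloff θ P.side (y.2 - P.center.2))) := by
          refine setLIntegral_mono_ae' hmS (ae_of_all _ fun y hy => ?_)
          have hd := Cube.le_dist_center_of_notMem hy.2
          rw [Cube.iterate_triple_center, Cube.iterate_triple_side] at hd
          -- Outside `3 ^ (k + 1) P` the distance to the centre is at least `3 ^ (k + 1) ℓ / 2 =
          -- S.side / 6`.
          have hb : bump θ P y ≤ 36 / S.side ^ 2 * (falloff θ P.side (y.1 - P.center.1) +
              falloff θ P.side (y.2 - P.center.2)) := by
            rw [bump, div_eq_mul_inv, mul_comm]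
            refine mul_le_mul_of_nonneg_right ?_
              (add_nonneg (falloff_nonneg hℓ) (falloff_nonneg hℓ))
            have h6 : S.side / 6 ≤ dist y P.center := by
              have h7 : S.side = 3 * (3 ^ (k + 1) * P.side) := by rw [hSs]; ring
              linarith
            have hSp := S.side_pos
            calc (dist y P.center ^ 2)⁻¹ ≤ ((S.side / 6) ^ 2)⁻¹ := by gcongr
              _ = _ := by field_simp; norm_num
          calc _ ≤ ‖g y‖ₑ * ENNReal.ofReal (36 / S.side ^ 2 *
                (falloff θ P.side (y.1 - P.center.1) + falloff θ P.side (y.2 - P.center.2))) := by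
                gcongr
            _ = _ := by
                rw [ENNReal.ofReal_mul (by positivity), ENNReal.ofReal_add (falloff_nonneg hℓ)
                  (falloff_nonneg hℓ), ENNReal.ofReal_div_of_pos (pow_pos S.side_pos 2), ← hVe,
                  ENNReal.div_eq_inv_mul]
                norm_num
                ring
      _ ≤ ∫⁻ y in S.toSet,
          36 * V⁻¹ * (‖g y‖ₑ * ENNReal.ofReal (falloff θ P.side (y.1 - P.center.1)) +
            ‖g y‖ₑ * ENNReal.ofReal (falloff θ P.side (y.2 - P.center.2))) :=
          lintegral_mono_set Set.sdiff_subset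
      _ = 36 * V⁻¹ * ((∫⁻ y in S.toSet,
          ‖g y‖ₑ * ENNReal.ofReal (falloff θ P.side (y.1 - P.center.1))) + ∫⁻ y in S.toSet,
            ‖g y‖ₑ * ENNReal.ofReal (falloff θ P.side (y.2 - P.center.2))) := by
          have m1 : AEMeasurable (fun y => ‖g y‖ₑ *
              ENNReal.ofReal (falloff θ P.side (y.1 - P.center.1))) (volume.restrict S.toSet) :=
            (hg.enorm.mul (mf _ (measurable_fst.sub_const _)).ennreal_ofReal.aemeasurable).restrict
          have m2 : AEMeasurable (fun y => ‖g y‖ₑ *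
              ENNReal.ofReal (falloff θ P.side (y.2 - P.center.2))) (volume.restrict S.toSet) :=
            (hg.enorm.mul (mf _ (measurable_snd.sub_const _)).ennreal_ofReal.aemeasurable).restrict
          rw [← lintegral_add_left' m1]
          exact lintegral_const_mul'' _ (m1.add m2)
      _ ≤ 36 * V⁻¹ * (V * ENNReal.ofReal (δ ^ s + (P.side / η) ^ θ) * pAvg p g S +
            V * ENNReal.ofReal (δ ^ s + (P.side / η) ^ θ) * pAvg p g S) := by gcongr
      _ = (V⁻¹ * V) * (72 * ENNReal.ofReal (δ ^ s + (P.side / η) ^ θ) * pAvg p g S) := by ring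
      _ = 72 * ENNReal.ofReal (δ ^ s + (P.side / η) ^ θ) * pAvg p g S := by
          rw [ENNReal.inv_mul_cancel hV0 hVt, one_mul]
      _ ≤ 72 * ENNReal.ofReal (2 * ((2 / 3 : ℝ) ^ s) ^ k + ((2 / 3 : ℝ) ^ θ) ^ k) * M := by
          gcongr
          exact hM (k + 1)
      _ = _ := by
          rw [ENNReal.ofReal_add (by positivity) (by positivity), ENNReal.ofReal_mul (by norm_num)]
          norm_num
  calc _ ≤ ∑' k : ℕ, ∫⁻ y in (Cube.triple^[k + 2] P).toSet \ (Cube.triple^[k + 1] P).toSet,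
        ‖g y‖ₑ * ENNReal.ofReal (bump θ P y) :=
        (lintegral_mono_set (compl_triple_subset_iUnion P)).trans (lintegral_iUnion_le _ _)
    _ ≤ ∑' k : ℕ, 72 * (2 * ENNReal.ofReal (((2 / 3 : ℝ) ^ s) ^ k) +
        ENNReal.ofReal (((2 / 3 : ℝ) ^ θ) ^ k)) * M := ENNReal.tsum_le_tsum main
    _ = 72 * (2 * ∑' k : ℕ, ENNReal.ofReal (((2 / 3 : ℝ) ^ s) ^ k) +
        ∑' k : ℕ, ENNReal.ofReal (((2 / 3 : ℝ) ^ θ) ^ k)) * M := by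
        rw [ENNReal.tsum_mul_right, ENNReal.tsum_mul_left, ENNReal.tsum_add, ENNReal.tsum_mul_left]
    _ ≤ 72 * (2 * ENNReal.ofReal (3 / s) + ENNReal.ofReal (3 / θ)) * M := by
        gcongr
        · exact tsum_geometric_le hs0 hs1
        · exact tsum_geometric_le hθ hθ1
    _ = ENNReal.ofReal (72 * (2 * (3 / s) + 3 / θ)) * M := by
        rw [ENNReal.ofReal_mul (by norm_num), ENNReal.ofReal_add (by positivity) (by positivity),
          ENNReal.ofReal_mul (by norm_num)]
        norm_num
    _ ≤ _ := by
        -- Both `1 / s` and `1 / θ` are at least `1`, so the sum is at most `72 * (6 + 3) = 648`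
        -- times their product.
        refine mul_le_mul_left (ENNReal.ofReal_le_ofReal ?_) _
        have h1 : p / (p - 1) = 1 / s := by rw [hs', one_div_div]
        rw [h1]
        have h2 : 1 ≤ 1 / θ := by rw [le_div_iff₀ hθ]; linarith
        have h3 : 1 ≤ 1 / s := by rw [le_div_iff₀ hs0]; linarith
        have h4 : 648 / θ * (1 / s) = 648 * ((1 / θ) * (1 / s)) := by ring
        have h5 : 3 / s = 3 * (1 / s) := by ring
        have h6 : 3 / θ = 3 * (1 / θ) := by ring
        rw [h4, h5, h6]
        nlinarith

theorem pAvg_const_one {p : ℝ} (S : Cube) : pAvg p (fun _ => 1) S = 1 := by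
  rw [pAvg]
  simp [ENNReal.inv_mul_cancel S.volume_ne_zero S.volume_ne_top]

/-- Hörmander's integral condition for the bump. -/
theorem lintegral_bump_le {θ : ℝ} (hθ : 0 < θ) (hθ1 : θ ≤ 1) (P : Cube) :
    ∫⁻ y in P.triple.toSetᶜ, ENNReal.ofReal (bump θ P y) ≤ ENNReal.ofReal (1296 / θ) := by
  -- For the constant `1` all averages equal `1`; the conjugate exponent `2` doubles the constant
  -- `648`.
  have h := lintegral_mul_bump_le (p := 2) (by norm_num) (g := fun _ => (1 : ℂ)) aemeasurable_const
    hθ hθ1 (P := P) (M := 1) (fun k => by rw [pAvg_const_one])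
  simp only [enorm_one, one_mul, mul_one] at h
  refine h.trans (ENNReal.ofReal_le_ofReal (le_of_eq ?_))
  ring

/-! ### Bounded operators on `L²` acting on functions -/

section OpL2

variable (T : Lp ℂ 2 (volume : Measure Plane) →L[ℂ] Lp ℂ 2 (volume : Measure Plane))

open Classical in
/-- The operator `T` applied to a square integrable function. -/
def opL2 (f : Plane → ℂ) : Plane → ℂ :=
  if h : MemLp f 2 volume then (T (h.toLp f) : Plane → ℂ) else 0

variable {T} {f g : Plane → ℂ}

theorem opL2_eq (hf : MemLp f 2 volume) : opL2 T f = (T (hf.toLp f) : Plane → ℂ) := dif_pos hf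

theorem opL2_coe (u : Lp ℂ 2 (volume : Measure Plane)) : opL2 T u = (T u : Plane → ℂ) := by
  rw [opL2_eq (Lp.memLp u), Lp.toLp_coeFn]

theorem memLp_opL2 : MemLp (opL2 T f) 2 volume := by
  by_cases hf : MemLp f 2 volume
  · rw [opL2_eq hf]; exact Lp.memLp _
  · rw [opL2, dif_neg hf]; exact MemLp.zero

theorem opL2_add (hf : MemLp f 2 volume) (hg : MemLp g 2 volume) :
    opL2 T (f + g) =ᵐ[volume] opL2 T f + opL2 T g := by
  rw [opL2_eq hf, opL2_eq hg, opL2_eq (hf.add hg), MemLp.toLp_add, map_add]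
  exact Lp.coeFn_add _ _

theorem opL2_sub (hf : MemLp f 2 volume) (hg : MemLp g 2 volume) :
    opL2 T (f - g) =ᵐ[volume] opL2 T f - opL2 T g := by
  rw [opL2_eq hf, opL2_eq hg, opL2_eq (hf.sub hg), MemLp.toLp_sub, map_sub]
  exact Lp.coeFn_sub _ _

theorem opL2_const_smul (c : ℂ) (hf : MemLp f 2 volume) :
    opL2 T (c • f) =ᵐ[volume] c • opL2 T f := by
  rw [opL2_eq hf, opL2_eq (hf.const_smul c), MemLp.toLp_const_smul, map_smul]
  exact Lp.coeFn_smul _ _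

theorem eLpNorm_opL2_le (hf : MemLp f 2 volume) :
    eLpNorm (opL2 T f) 2 volume ≤ ‖T‖ₑ * eLpNorm f 2 volume := by
  rw [opL2_eq hf, ← Lp.enorm_def]
  refine (T.le_opENorm _).trans (le_of_eq ?_)
  rw [Lp.enorm_toLp]

/-- The pairing in `HasKernel` is bilinear, so the adjoint is conjugated on both sides. The
transpose is used to remove the restriction to step functions and to sum infinitely many atoms. -/
theorem exists_transpose (T : Lp ℂ 2 (volume : Measure Plane) →L[ℂ] Lp ℂ 2 (volume : Measure Plane))
    {ψ : Plane → ℂ} (hψ : MemLp ψ 2 volume) :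
    ∃ h : Plane → ℂ, MemLp h 2 volume ∧
      ∀ f : Plane → ℂ, MemLp f 2 volume → ∫ x, opL2 T f x * ψ x = ∫ x, f x * h x := by
  let v : Lp ℂ 2 (volume : Measure Plane) := ContinuousLinearMap.adjoint T (star (hψ.toLp ψ))
  refine ⟨(star v : Lp ℂ 2 (volume : Measure Plane)), Lp.memLp _, fun f hf => ?_⟩
  have h1 := ContinuousLinearMap.adjoint_inner_left T (hf.toLp f) (star (hψ.toLp ψ))
  rw [L2.inner_def, L2.inner_def] at h1
  have h2 : ∫ x, inner ℂ ((star (hψ.toLp ψ) : Lp ℂ 2 (volume : Measure Plane)) x)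
      (T (hf.toLp f) x) = ∫ x, opL2 T f x * ψ x := by
    refine integral_congr_ae ?_
    filter_upwards [Lp.coeFn_star (hψ.toLp ψ), hψ.coeFn_toLp] with x e1 e2
    rw [e1, opL2_eq hf, Pi.star_apply, e2, RCLike.inner_apply]
    simp
  have h3 : ∫ x, inner ℂ (v x) (hf.toLp f x) =
      ∫ x, f x * (star v : Lp ℂ 2 (volume : Measure Plane)) x := by
    refine integral_congr_ae ?_
    filter_upwards [Lp.coeFn_star v, hf.coeFn_toLp] with x e1 e2
    rw [e1, e2, Pi.star_apply, RCLike.inner_apply]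
    simp
  rw [← h2, ← h3]; exact h1.symm

end OpL2

/-! ### Representation off the support -/

/-- A measurable kernel with `θ₂ = 1` and with the size bound everywhere. -/
structure IsGoodKernel (θ A : ℝ) (K : Plane → Plane → ℂ) : Prop where
  kernel : IsKernelWith θ 1 A K
  pos : 0 < θ
  le_one : θ ≤ 1
  measurable : Measurable (Function.uncurry K)
  norm_le : ∀ x y, ‖K x y‖ ≤ A / dist x y ^ 2

namespace IsGoodKernel

variable {θ A : ℝ} {K : Plane → Plane → ℂ}

theorem nonneg (hK : IsGoodKernel θ A K) : 0 ≤ A := hK.kernel.nonneg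

theorem swap (hK : IsGoodKernel θ A K) : IsGoodKernel θ A fun x y => K y x where
  kernel := hK.kernel.swap
  pos := hK.pos
  le_one := hK.le_one
  measurable := hK.measurable.comp measurable_swap
  norm_le x y := by rw [dist_comm]; exact hK.norm_le y x

theorem norm_mul_le (hK : IsGoodKernel θ A K) {g : Plane → ℂ} {δ : ℝ} (hδ : 0 < δ) {x y : Plane}
    (h : g y ≠ 0 → δ ≤ dist x y) : ‖K x y * g y‖ ≤ A / δ ^ 2 * ‖g y‖ := by
  by_cases hy : g y = 0
  · simp [hy]
  · rw [norm_mul]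
    refine mul_le_mul_of_nonneg_right ((hK.norm_le x y).trans ?_) (norm_nonneg _)
    exact div_le_div_of_nonneg_left hK.nonneg (by positivity) (by gcongr; exact h hy)

theorem aestronglyMeasurable_mul (hK : IsGoodKernel θ A K) {μ ν : Measure Plane} [SFinite μ]
    [SFinite ν] {g : Plane → ℂ} (hg : AEStronglyMeasurable g ν) :
    AEStronglyMeasurable (fun z : Plane × Plane => K z.1 z.2 * g z.2) (μ.prod ν) :=
  hK.measurable.aestronglyMeasurable.mul hg.comp_snd

theorem integrable_mul (hK : IsGoodKernel θ A K) {g : Plane → ℂ} (hg : Integrable g) {δ : ℝ}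
    (hδ : 0 < δ) {x : Plane} (h : ∀ y, g y ≠ 0 → δ ≤ dist x y) :
    Integrable fun y => K x y * g y := by
  refine (hg.norm.const_mul (A / δ ^ 2)).mono'
    ((hK.measurable.comp measurable_prodMk_left).aestronglyMeasurable.mul hg.1)
    (ae_of_all _ fun y => hK.norm_mul_le hδ (h y))

theorem norm_integral_le (hK : IsGoodKernel θ A K) {g : Plane → ℂ} (hg : Integrable g) {δ : ℝ}
    (hδ : 0 < δ) {x : Plane} (h : ∀ y, g y ≠ 0 → δ ≤ dist x y) :
    ‖∫ y, K x y * g y‖ ≤ A / δ ^ 2 * ∫ y, ‖g y‖ := by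
  rw [← integral_const_mul]
  exact norm_integral_le_of_norm_le (hg.norm.const_mul _)
    (ae_of_all _ fun y => hK.norm_mul_le hδ (h y))

theorem integrable_prod (hK : IsGoodKernel θ A K) {g : Plane → ℂ} (hg : Integrable g) {δ : ℝ}
    (hδ : 0 < δ) {P : Cube} (h : ∀ x ∈ P.toSet, ∀ y, g y ≠ 0 → δ ≤ dist x y) :
    Integrable (fun z : Plane × Plane => K z.1 z.2 * g z.2)
      ((volume.restrict P.toSet).prod volume) := by
  have : IsFiniteMeasure (volume.restrict P.toSet) :=
    ⟨by rw [Measure.restrict_apply_univ]; exact P.volume_ne_top.lt_top⟩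
  have h1 : Integrable (fun z : Plane × Plane => A / δ ^ 2 * ‖g z.2‖)
      ((volume.restrict P.toSet).prod volume) :=
    (hg.norm.comp_snd (volume.restrict P.toSet)).const_mul _
  refine h1.mono' (hK.aestronglyMeasurable_mul hg.1) ?_
  have h2 : ∀ᵐ z ∂((volume.restrict P.toSet).prod (volume : Measure Plane)), z.1 ∈ P.toSet :=
    Measure.quasiMeasurePreserving_fst.ae (ae_restrict_mem P.measurableSet_toSet)
  filter_upwards [h2] with z hz using hK.norm_mul_le hδ (h z.1 hz z.2)

/-- The kernel identity for two disjoint cubes says that `h` and the integrated kernel have equal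
integrals over all small cubes away from `P`, hence agree there almost everywhere. This frees one of
the two slots from step functions. -/
theorem ae_transpose_eq (hK : IsGoodKernel θ A K)
    {T : Lp ℂ 2 (volume : Measure Plane) →L[ℂ] Lp ℂ 2 (volume : Measure Plane)}
    (hT : HasKernel T K) {P : Cube} {δ : ℝ} (hδ : 0 < δ) {h : Plane → ℂ} (hh : MemLp h 2 volume)
    (hTh : ∀ f : Plane → ℂ, MemLp f 2 volume →
      ∫ x, opL2 T f x * P.toSet.indicator (fun _ => 1) x = ∫ x, f x * h x) :
    ∀ᵐ y, δ < Metric.infDist y P.toSet → h y = ∫ x in P.toSet, K x y := by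
  set V : Set Plane := {y | δ < Metric.infDist y P.toSet} with hV
  have hVo : IsOpen V := isOpen_lt continuous_const (Metric.continuous_infDist_pt _)
  have hVd : ∀ y ∈ V, ∀ x ∈ P.toSet, δ ≤ dist x y := by
    intro y hy x hx
    rw [dist_comm]
    exact (le_of_lt hy).trans (Metric.infDist_le_dist_of_mem hx)
  have hone : IsFiniteMeasure (volume.restrict P.toSet) :=
    ⟨by rw [Measure.restrict_apply_univ]; exact P.volume_ne_top.lt_top⟩
  -- The cut-off to `V` makes the function bounded, hence locally integrable on the whole plane.
  set k : Plane → ℂ := V.indicator fun y => ∫ x in P.toSet, K x y with hk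
  have hkm : AEStronglyMeasurable k volume :=
    (AEStronglyMeasurable.integral_prod_right' (μ := volume) (ν := volume.restrict P.toSet)
      (f := fun z : Plane × Plane => K z.2 z.1)
      hK.swap.measurable.aestronglyMeasurable).indicator hVo.measurableSet
  have hkb : ∀ y, ‖k y‖ ≤ A / δ ^ 2 * volume.real P.toSet := by
    intro y
    by_cases hy : y ∈ V
    · rw [hk, Set.indicator_of_mem hy]
      refine norm_setIntegral_le_of_norm_le_const P.volume_ne_top.lt_top fun x hx => ?_
      refine (hK.norm_le x y).trans
        (div_le_div_of_nonneg_left hK.nonneg (by positivity) ?_)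
      gcongr; exact hVd y hy x hx
    · rw [hk, Set.indicator_of_notMem hy, norm_zero]
      have := hK.nonneg
      positivity
  have hkl : LocallyIntegrable k volume := by
    have : MemLp k ∞ volume := memLp_top_of_bound hkm _ (ae_of_all _ hkb)
    exact this.locallyIntegrable le_top
  have hhl : LocallyIntegrable h volume := hh.locallyIntegrable (by norm_num)
  have key := ae_eq_zero_of_forall_cube (hhl.sub hkl) hVo ?_
  · filter_upwards [key] with y hy hyV
    have := sub_eq_zero.1 (hy hyV)
    rw [this, hk, Set.indicator_of_mem (show y ∈ V from hyV)]
  · intro R hRV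
    have hR : IntegrableOn h R.toSet :=
      (hhl.integrableOn_isCompact (isCompact_closedBall R.center (R.side / 2))).mono_set
        R.toSet_subset_closedBall
    have hkR : IntegrableOn k R.toSet :=
      (hkl.integrableOn_isCompact (isCompact_closedBall R.center (R.side / 2))).mono_set
        R.toSet_subset_closedBall
    simp only [Pi.sub_apply]
    rw [integral_sub hR hkR, sub_eq_zero]
    have hRs : R.toSet.indicator (fun _ => (1 : ℂ)) ∈ stepFunctions :=
      Submodule.subset_span ⟨R, rfl⟩
    have hPs : P.toSet.indicator (fun _ => (1 : ℂ)) ∈ stepFunctions :=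
      Submodule.subset_span ⟨P, rfl⟩
    have hdist : ∀ x ∈ P.toSet, ∀ y, R.toSet.indicator (fun _ => (1 : ℂ)) y ≠ 0 → δ ≤ dist x y :=
      fun x hx y hy => hVd y (hRV (Set.mem_of_indicator_ne_zero hy)) x hx
    have hint : Integrable (R.toSet.indicator (fun _ => (1 : ℂ))) :=
      (integrable_indicator_iff R.measurableSet_toSet).2
        (integrableOn_const R.volume_ne_top)
    have hprod := hK.integrable_prod hint hδ hdist
    have e1 := hT _ _ hRs hPs (by
      ext x
      simp only [Set.mem_inter_iff, Set.mem_ofPred_eq, Set.mem_empty_iff_false, iff_false, not_and]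
      intro h1 h2
      have := hdist x (Set.mem_of_indicator_ne_zero h2) x h1
      rw [dist_self] at this
      linarith)
    rw [← opL2_eq (stepFunctions_memLp hRs), hTh _ (stepFunctions_memLp hRs)] at e1
    calc ∫ y in R.toSet, h y = ∫ y, R.toSet.indicator (fun _ => (1 : ℂ)) y * h y := by
          rw [← integral_indicator R.measurableSet_toSet]
          refine integral_congr_ae (ae_of_all _ fun y => ?_)
          by_cases hy : y ∈ R.toSet <;> simp [hy]
      _ = _ := e1
      _ = ∫ z in P.toSet ×ˢ Set.univ,
          K z.1 z.2 * R.toSet.indicator (fun _ => (1 : ℂ)) z.2 := by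
          rw [← integral_indicator (P.measurableSet_toSet.prod MeasurableSet.univ)]
          refine integral_congr_ae (ae_of_all _ fun z => ?_)
          by_cases hz : z.1 ∈ P.toSet <;> simp [hz, Set.indicator]
      _ = ∫ x in P.toSet, ∫ y, K x y * R.toSet.indicator (fun _ => (1 : ℂ)) y := by
          rw [Measure.volume_eq_prod, ← Measure.prod_restrict, Measure.restrict_univ,
            MeasureTheory.integral_prod _ hprod]
      _ = ∫ y, ∫ x in P.toSet, K x y * R.toSet.indicator (fun _ => (1 : ℂ)) y :=
          integral_integral_swap hprod
      _ = ∫ y in R.toSet, k y := by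
          rw [← integral_indicator R.measurableSet_toSet]
          refine integral_congr_ae (ae_of_all _ fun y => ?_)
          by_cases hy : y ∈ R.toSet
          · simp [hy, hk, hRV hy]
          · simp [hy]

/-- Off the support of a function, `T` is given by integration against the kernel. -/
theorem ae_opL2_eq (hK : IsGoodKernel θ A K)
    {T : Lp ℂ 2 (volume : Measure Plane) →L[ℂ] Lp ℂ 2 (volume : Measure Plane)}
    (hT : HasKernel T K) {f : Plane → ℂ} (hf : MemLp f 2 volume) (hf1 : Integrable f)
    {U : Set Plane} {δ : ℝ} (hδ : 0 < δ) (hU : ∀ x ∈ U, ∀ y, f y ≠ 0 → δ ≤ dist x y) :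
    ∀ᵐ x, x ∈ U → opL2 T f x = ∫ y, K x y * f y := by
  -- `U` is arbitrary; it is enlarged to an open set at distance `δ / 2` from where `f` is nonzero,
  -- so that cubes inside it can serve as test sets.
  set W := Metric.thickening (δ / 2) U with hW
  have hWo : IsOpen W := Metric.isOpen_thickening
  have hWd : ∀ x ∈ W, ∀ y, f y ≠ 0 → δ / 2 ≤ dist x y := by
    intro x hx y hy
    obtain ⟨u, hu, hxu⟩ := Metric.mem_thickening_iff.1 hx
    have h1 := hU u hu y hy
    have h2 := dist_triangle_left u y x
    linarith
  set k : Plane → ℂ := W.indicator fun x => ∫ y, K x y * f y with hk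
  have hkm : AEStronglyMeasurable k volume :=
    (AEStronglyMeasurable.integral_prod_right' (μ := volume) (ν := volume)
      (hK.aestronglyMeasurable_mul hf.1)).indicator hWo.measurableSet
  have hkb : ∀ x, ‖k x‖ ≤ A / (δ / 2) ^ 2 * ∫ y, ‖f y‖ := by
    intro x
    by_cases hx : x ∈ W
    · rw [hk, Set.indicator_of_mem hx]
      exact hK.norm_integral_le hf1 (by positivity) (hWd x hx)
    · rw [hk, Set.indicator_of_notMem hx, norm_zero]
      have := hK.nonneg
      positivity
  have hkl : LocallyIntegrable k volume := by
    have : MemLp k ∞ volume := memLp_top_of_bound hkm _ (ae_of_all _ hkb)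
    exact this.locallyIntegrable le_top
  have hTl : LocallyIntegrable (opL2 T f) volume := memLp_opL2.locallyIntegrable (by norm_num)
  have key := ae_eq_zero_of_forall_cube (hTl.sub hkl) hWo ?_
  · filter_upwards [key] with x hx hxU
    have hxW : x ∈ W := Metric.self_subset_thickening (by positivity) U hxU
    have := sub_eq_zero.1 (hx hxW)
    rw [this, hk, Set.indicator_of_mem hxW]
  · intro P hPW
    have hT1 : IntegrableOn (opL2 T f) P.toSet :=
      (hTl.integrableOn_isCompact (isCompact_closedBall P.center (P.side / 2))).mono_set
        P.toSet_subset_closedBall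
    have hkP : IntegrableOn k P.toSet :=
      (hkl.integrableOn_isCompact (isCompact_closedBall P.center (P.side / 2))).mono_set
        P.toSet_subset_closedBall
    simp only [Pi.sub_apply]
    rw [integral_sub hT1 hkP, sub_eq_zero]
    have hPs : P.toSet.indicator (fun _ => (1 : ℂ)) ∈ stepFunctions :=
      Submodule.subset_span ⟨P, rfl⟩
    -- Integrating `T f` over `P` amounts to pairing `f` with the transpose of `1_P`. The latter is
    -- known at distance more than `δ / 4` from `P`, hence wherever `f` is nonzero.
    obtain ⟨h, hh, hTh⟩ := exists_transpose T (stepFunctions_memLp hPs)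
    have hae := hK.ae_transpose_eq hT (δ := δ / 4) (by positivity) hh hTh
    have hprod := hK.integrable_prod hf1 (by positivity : 0 < δ / 2) (P := P)
      (fun x hx => hWd x (hPW hx))
    calc ∫ x in P.toSet, opL2 T f x
        = ∫ x, opL2 T f x * P.toSet.indicator (fun _ => (1 : ℂ)) x := by
          rw [← integral_indicator P.measurableSet_toSet]
          refine integral_congr_ae (ae_of_all _ fun y => ?_)
          by_cases hy : y ∈ P.toSet <;> simp [hy]
      _ = ∫ y, f y * h y := hTh f hf
      _ = ∫ y, ∫ x in P.toSet, K x y * f y := by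
          refine integral_congr_ae ?_
          filter_upwards [hae] with y hy
          rw [integral_mul_const]
          by_cases hfy : f y = 0
          · simp [hfy]
          · rw [hy, mul_comm]
            refine lt_of_lt_of_le (by linarith : δ / 4 < δ / 2) ?_
            refine (Metric.le_infDist ⟨_, P.corner_mem⟩).2 fun x hx => ?_
            rw [dist_comm]; exact hWd x (hPW hx) y hfy
      _ = ∫ x in P.toSet, ∫ y, K x y * f y := (integral_integral_swap hprod).symm
      _ = ∫ x in P.toSet, k x := by
          refine setIntegral_congr_fun P.measurableSet_toSet fun x hx => ?_
          rw [hk, Set.indicator_of_mem (hPW hx)]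

end IsGoodKernel

/-! ### The weak type (1, 1) estimate -/

theorem measurable_opL2
    {T : Lp ℂ 2 (volume : Measure Plane) →L[ℂ] Lp ℂ 2 (volume : Measure Plane)}
    (f : Plane → ℂ) : Measurable (opL2 T f) := by
  unfold opL2
  split_ifs
  · exact (Lp.stronglyMeasurable _).measurable
  · exact measurable_const

theorem volume_lt_norm_le {f : Plane → ℂ} (hf : MemLp f 2 volume) {t : ℝ} (ht : 0 < t) :
    volume {x | t < ‖f x‖} ≤ ENNReal.ofReal (1 / t ^ 2) * eLpNorm f 2 volume ^ 2 := by
  have h := meas_ge_le_mul_pow_eLpNorm_enorm (volume : Measure Plane) (p := 2) (by norm_num)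
    (by norm_num) hf.1 (ε := ENNReal.ofReal t) (by simpa using ht) (by simp)
  have e : (ENNReal.ofReal t)⁻¹ ^ (2 : ℝ≥0∞).toReal = ENNReal.ofReal (1 / t ^ 2) := by
    rw [← ENNReal.ofReal_inv_of_pos ht, ENNReal.ofReal_rpow_of_nonneg (by positivity) (by simp)]
    simp
  rw [e] at h
  simp only [ENNReal.toReal_ofNat, ENNReal.rpow_ofNat] at h
  refine (measure_mono fun x hx => ?_).trans h
  simp only [Set.mem_ofPred_eq] at hx ⊢
  rw [← ofReal_norm]
  exact ENNReal.ofReal_le_ofReal hx.le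

namespace IsGoodKernel

variable {θ A : ℝ} {K : Plane → Plane → ℂ}
  {T : Lp ℂ 2 (volume : Measure Plane) →L[ℂ] Lp ℂ 2 (volume : Measure Plane)}

theorem ae_enorm_sub_center_le (hK : IsGoodKernel θ A K) {P : Cube} {x : Plane}
    (hx : x ∉ P.triple.toSet) (h1 : x.1 ≠ P.center.1) (h2 : x.2 ≠ P.center.2) :
    ∀ᵐ y, y ∈ P.toSet →
      ‖K x y - K x P.center‖ₑ ≤ ENNReal.ofReal (9 * A) * ENNReal.ofReal (bump θ P x) := by
  filter_upwards [ae_fst_ne x.1, ae_snd_ne x.2] with y e1 e2 hy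
  rw [← ENNReal.ofReal_mul (by linarith [hK.nonneg]), ← ofReal_norm]
  exact ENNReal.ofReal_le_ofReal
    (hK.kernel.norm_sub_center_le hK.pos hK.le_one hy hx e1 e2 h1 h2)

theorem side_le_dist {P : Cube} {x y : Plane} (hx : x ∉ P.triple.toSet) (hy : y ∈ P.toSet) :
    P.side ≤ dist x y := by
  have h1 := Cube.le_dist_center_of_notMem hx
  have h2 := Cube.dist_center_le hy
  rw [Cube.triple_center, Cube.triple_side] at h1
  have h3 := dist_triangle x y P.center
  linarith

/-- Functions on a cube with integral zero have integrable images off the triple cube. -/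
theorem lintegral_opL2_atom_le (hK : IsGoodKernel θ A K) (hT : HasKernel T K) {P : Cube}
    {f : Plane → ℂ} (hf : MemLp f 2 volume) (hf1 : Integrable f) (hfP : ∀ y ∉ P.toSet, f y = 0)
    (hf0 : ∫ y, f y = 0) :
    ∫⁻ x in P.triple.toSetᶜ, ‖opL2 T f x‖ₑ ≤
      ENNReal.ofReal (9 * A * (1296 / θ)) * ∫⁻ y, ‖f y‖ₑ := by
  have hd : ∀ x ∈ P.triple.toSetᶜ, ∀ y, f y ≠ 0 → P.side ≤ dist x y := fun x hx y hy =>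
    side_le_dist hx (by by_contra h; exact hy (hfP y h))
  have hA := hK.nonneg
  have hθ := hK.pos
  calc _ ≤ ∫⁻ x in P.triple.toSetᶜ, ENNReal.ofReal (9 * A) * ENNReal.ofReal (bump θ P x) *
        ∫⁻ y, ‖f y‖ₑ := by
        refine setLIntegral_mono_ae' P.triple.measurableSet_toSet.compl ?_
        filter_upwards [hK.ae_opL2_eq hT hf hf1 P.side_pos hd, ae_fst_ne P.center.1,
          ae_snd_ne P.center.2] with x hx e1 e2 hxP
        have hi := hK.integrable_mul hf1 P.side_pos (hd x hxP)
        -- The cancellation of `f` allows the kernel at the centre to be subtracted.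
        have h0 : ∫ y, K x P.center * f y = 0 := by rw [integral_const_mul, hf0, mul_zero]
        have h1 : ∫ y, K x y * f y = ∫ y, (K x y - K x P.center) * f y := by
          simp only [sub_mul]
          rw [integral_sub hi (hf1.const_mul _), h0, sub_zero]
        rw [hx hxP, h1]
        refine (enorm_integral_le_lintegral_enorm _).trans ?_
        rw [← lintegral_const_mul'' _ hf1.1.enorm]
        refine lintegral_mono_ae ?_
        filter_upwards [hK.ae_enorm_sub_center_le hxP e1.symm e2.symm] with y hy
        rw [enorm_mul]
        by_cases hyP : y ∈ P.toSet
        · gcongr; exact hy hyP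
        · simp [hfP y hyP]
    _ = ENNReal.ofReal (9 * A) * (∫⁻ x in P.triple.toSetᶜ, ENNReal.ofReal (bump θ P x)) *
        ∫⁻ y, ‖f y‖ₑ := by
        rw [lintegral_mul_const _ ((measurable_bump θ P).ennreal_ofReal.const_mul _),
          lintegral_const_mul _ (measurable_bump θ P).ennreal_ofReal]
    _ ≤ ENNReal.ofReal (9 * A) * ENNReal.ofReal (1296 / θ) * ∫⁻ y, ‖f y‖ₑ := by
        gcongr; exact lintegral_bump_le hK.pos hK.le_one P
    _ = _ := by rw [← ENNReal.ofReal_mul (by positivity)]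

/-- To sum over infinitely many atoms without convergence questions for the images, the `L¹` norm on
`G` is written as a pairing with the unimodular function `ψ`. Then `T` is transposed onto `ψ`, and
the integrable product `b * h` splits over the disjoint cubes. Finite measure of `G` puts `ψ` in
`L²`. -/
theorem lintegral_opL2_atoms_le (hK : IsGoodKernel θ A K) (hT : HasKernel T K) {𝒬 : Set Cube}
    (hc : 𝒬.Countable) (hdisj : 𝒬.PairwiseDisjoint Cube.toSet) {b : Plane → ℂ}
    (hb : MemLp b 2 volume) (hb1 : Integrable b) (hb𝒬 : ∀ y, (∀ P ∈ 𝒬, y ∉ P.toSet) → b y = 0)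
    (hb0 : ∀ P ∈ 𝒬, ∫ y in P.toSet, b y = 0) {G : Set Plane} (hG : MeasurableSet G)
    (hGfin : volume G ≠ ∞) (hG𝒬 : ∀ P ∈ 𝒬, Disjoint G P.triple.toSet) :
    ∫⁻ x in G, ‖opL2 T b x‖ₑ ≤ ENNReal.ofReal (9 * A * (1296 / θ)) * ∫⁻ y, ‖b y‖ₑ := by
  have : Countable 𝒬 := hc.to_subtype
  have hfinG : IsFiniteMeasure (volume.restrict G) :=
    ⟨by rw [Measure.restrict_apply_univ]; exact hGfin.lt_top⟩
  -- Where the image vanishes, division by zero gives the value `0`, so `|ψ| ≤ 1` everywhere.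
  set ψ : Plane → ℂ := G.indicator fun x => star (opL2 T b x) / ‖opL2 T b x‖ with hψdef
  have hψm : Measurable ψ := by
    refine Measurable.indicator ?_ hG
    exact (continuous_star.measurable.comp (measurable_opL2 b)).div
      (Complex.measurable_ofReal.comp (measurable_opL2 b).norm)
  have hψ1 : ∀ x, ‖ψ x‖ ≤ G.indicator (fun _ => (1 : ℝ)) x := by
    intro x
    by_cases hx : x ∈ G
    · rw [hψdef, Set.indicator_of_mem hx, Set.indicator_of_mem hx, norm_div, norm_star,
        Complex.norm_real, norm_norm]
      exact div_self_le_one _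
    · simp [hψdef, hx]
  have hψ : MemLp ψ 2 volume := by
    refine (memLp_indicator_const 2 hG (1 : ℝ) (Or.inr hGfin)).of_le hψm.aestronglyMeasurable
      (ae_of_all _ fun x => ?_)
    refine (hψ1 x).trans (le_abs_self _)
  obtain ⟨h, hh, hTh⟩ := exists_transpose T hψ
  have hTb : IntegrableOn (opL2 T b) G := by
    have : MemLp (opL2 T b) 2 (volume.restrict G) := memLp_opL2.restrict G
    exact this.integrable (by norm_num)
  have e1 : ∫⁻ x in G, ‖opL2 T b x‖ₑ = ‖∫ x, opL2 T b x * ψ x‖ₑ := by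
    have : ∫ x, opL2 T b x * ψ x = ((∫ x in G, ‖opL2 T b x‖ : ℝ) : ℂ) := by
      rw [← integral_complex_ofReal, ← integral_indicator hG]
      refine integral_congr_ae (ae_of_all _ fun x => ?_)
      by_cases hx : x ∈ G
      · simp only [hψdef, Set.indicator_of_mem hx]
        by_cases h0 : opL2 T b x = 0
        · simp [h0]
        · have h0' : (‖opL2 T b x‖ : ℂ) ≠ 0 := by simpa using h0
          rw [← mul_div_assoc, div_eq_iff h0']
          have := Complex.mul_conj (opL2 T b x)
          rw [Complex.normSq_eq_norm_sq] at this
          rw [← starRingEnd_apply, this]; push_cast; ring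
      · simp [hψdef, hx]
    rw [this, ← ofReal_integral_norm_eq_lintegral_enorm hTb, ← ofReal_norm, Complex.norm_real,
      Real.norm_of_nonneg (integral_nonneg fun _ => norm_nonneg _)]
  have hbh : Integrable fun y => b y * h y := hb.integrable_mul hh
  set Ω : Set Plane := ⋃ P : 𝒬, (P : Cube).toSet with hΩ
  have hΩm : MeasurableSet Ω := MeasurableSet.iUnion fun P => Cube.measurableSet_toSet _
  have hpd : Pairwise (Function.onFun Disjoint fun P : 𝒬 => (P : Cube).toSet) := by
    intro P P' hne
    exact hdisj P.2 P'.2 (fun h => hne (Subtype.ext h))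
  have e2 : ∫ y, b y * h y = ∑' P : 𝒬, ∫ y in (P : Cube).toSet, b y * h y := by
    rw [← integral_iUnion (fun P => Cube.measurableSet_toSet _) hpd hbh.integrableOn,
      ← integral_indicator hΩm]
    refine integral_congr_ae (ae_of_all _ fun y => ?_)
    by_cases hy : y ∈ Ω
    · simp only [Set.indicator_of_mem hy]
    · have : b y = 0 := hb𝒬 y fun P hP hyP => hy (Set.mem_iUnion.2 ⟨⟨P, hP⟩, hyP⟩)
      simp [Set.indicator_of_notMem hy, this]
  have e3 : ∀ P : 𝒬, ‖∫ y in (P : Cube).toSet, b y * h y‖ₑ ≤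
      ENNReal.ofReal (9 * A * (1296 / θ)) * ∫⁻ y in (P : Cube).toSet, ‖b y‖ₑ := by
    rintro ⟨P, hP⟩
    have hm := P.measurableSet_toSet
    have hbP : MemLp (P.toSet.indicator b) 2 volume := hb.indicator hm
    have hbP1 : Integrable (P.toSet.indicator b) := hb1.indicator hm
    have e4 : ∫ y in P.toSet, b y * h y = ∫ x, opL2 T (P.toSet.indicator b) x * ψ x := by
      rw [hTh _ hbP, ← integral_indicator hm]
      refine integral_congr_ae (ae_of_all _ fun y => ?_)
      by_cases hy : y ∈ P.toSet <;> simp [hy]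
    have e5 : ∫⁻ y, ‖P.toSet.indicator b y‖ₑ = ∫⁻ y in P.toSet, ‖b y‖ₑ := by
      rw [← lintegral_indicator hm]
      refine lintegral_congr fun y => ?_
      by_cases hy : y ∈ P.toSet <;> simp [hy]
    change ‖∫ y in P.toSet, b y * h y‖ₑ ≤ _ * ∫⁻ y in P.toSet, ‖b y‖ₑ
    rw [e4, ← e5]
    refine le_trans ?_ (hK.lintegral_opL2_atom_le hT hbP hbP1
      (fun y hy => Set.indicator_of_notMem hy b)
      (by rw [integral_indicator hm]; exact hb0 P hP))
    refine (enorm_integral_le_lintegral_enorm _).trans ?_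
    rw [← lintegral_indicator P.triple.measurableSet_toSet.compl]
    refine lintegral_mono fun x => ?_
    by_cases hx : x ∈ G
    · have hx' : x ∈ P.triple.toSetᶜ := Set.disjoint_left.1 (hG𝒬 P hP) hx
      rw [Set.indicator_of_mem hx', enorm_mul]
      have : ‖ψ x‖ₑ ≤ 1 := by
        rw [← ofReal_norm, ENNReal.ofReal_le_one]
        exact (hψ1 x).trans (by rw [Set.indicator_of_mem hx])
      calc _ ≤ ‖opL2 T (P.toSet.indicator b) x‖ₑ * 1 := by gcongr
        _ = _ := mul_one _
    · have : ψ x = 0 := by simp [hψdef, hx]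
      rw [this]; simp
  rw [e1, hTh b hb, e2]
  calc _ ≤ ∑' P : 𝒬, ‖∫ y in (P : Cube).toSet, b y * h y‖ₑ := enorm_tsum_le_tsum_enorm
    _ ≤ ∑' P : 𝒬, ENNReal.ofReal (9 * A * (1296 / θ)) * ∫⁻ y in (P : Cube).toSet, ‖b y‖ₑ :=
        ENNReal.tsum_le_tsum e3
    _ = ENNReal.ofReal (9 * A * (1296 / θ)) * ∫⁻ y in Ω, ‖b y‖ₑ := by
        rw [ENNReal.tsum_mul_left, hΩ,
          lintegral_iUnion (fun P => Cube.measurableSet_toSet _) hpd]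
    _ ≤ _ := by gcongr; exact Measure.restrict_le_self

end IsGoodKernel

theorem enorm_avg_mul_volume_le (f : Plane → ℂ) (P : Cube) :
    ‖avg f P‖ₑ * volume P.toSet ≤ ∫⁻ y in P.toSet, ‖f y‖ₑ := by
  have h := enorm_integral_le_lintegral_enorm (μ := volume.restrict P.toSet) f
  have h1 : ‖avg f P‖ₑ = (volume P.toSet)⁻¹ * ‖∫ y in P.toSet, f y‖ₑ := by
    rw [avg, setAverage_eq, Cube.volume_real, enorm_smul, Cube.volume_toSet,
      ← ENNReal.ofReal_inv_of_pos (pow_pos P.side_pos 2), Real.enorm_eq_ofReal]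
    have := P.side_pos
    positivity
  rw [h1, mul_right_comm, ENNReal.inv_mul_cancel P.volume_ne_zero P.volume_ne_top, one_mul]
  exact h

/-- The Calderón–Zygmund decomposition of a function supported in a cube. -/
theorem exists_calderon_zygmund (R : Cube) {f : Plane → ℂ} (hf : Integrable f)
    (hfR : ∀ x ∉ R.toSet, f x = 0) {t : ℝ} (ht : 0 < t) (hft : ∫ x, ‖f x‖ ≤ t * R.side ^ 2) :
    ∃ (𝒬 : Set Cube) (g : Plane → ℂ), 𝒬.Countable ∧ 𝒬.PairwiseDisjoint Cube.toSet ∧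
      (∀ P ∈ 𝒬, ENNReal.ofReal t * volume P.toSet ≤ ∫⁻ x in P.toSet, ‖f x‖ₑ) ∧
      AEStronglyMeasurable g volume ∧ (∀ᵐ x, ‖g x‖ ≤ 4 * t) ∧
      ∫⁻ x, ‖g x‖ₑ ≤ ∫⁻ x, ‖f x‖ₑ ∧
      (∀ x, (∀ P ∈ 𝒬, x ∉ P.toSet) → g x = f x) ∧
      ∀ P ∈ 𝒬, ∫ x in P.toSet, g x = ∫ x in P.toSet, f x := by
  classical
  have hR : ∫ x in R.toSet, ‖f x‖ ≤ t * R.side ^ 2 :=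
    (setIntegral_le_integral hf.norm (ae_of_all _ fun _ => norm_nonneg _)).trans hft
  obtain ⟨𝒬, hc, hdisj, hP, hae⟩ :=
    R.exists_stopping_cubes hf.norm (fun x => norm_nonneg (f x)) hR
  have : Countable 𝒬 := hc.to_subtype
  have hpd : Pairwise (Function.onFun Disjoint fun P : 𝒬 => (P : Cube).toSet) := by
    intro P P' hne
    exact hdisj P.2 P'.2 (fun h => hne (Subtype.ext h))
  set Ω : Set Plane := ⋃ P : 𝒬, (P : Cube).toSet with hΩ
  have hΩm : MeasurableSet Ω := MeasurableSet.iUnion fun P => Cube.measurableSet_toSet _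
  have hmemΩ : ∀ x, x ∉ Ω ↔ ∀ P ∈ 𝒬, x ∉ P.toSet := by
    intro x; simp [hΩ]
  set g : Plane → ℂ := fun x =>
    if h : ∃ P ∈ 𝒬, x ∈ P.toSet then avg f h.choose else f x with hg
  have g_in : ∀ P ∈ 𝒬, ∀ x ∈ P.toSet, g x = avg f P := by
    intro P hP x hx
    have h : ∃ P ∈ 𝒬, x ∈ P.toSet := ⟨P, hP, hx⟩
    simp only [hg, dif_pos h]
    congr 1
    exact hdisj.elim_set h.choose_spec.1 hP x h.choose_spec.2 hx
  have g_out : ∀ x ∉ Ω, g x = f x := by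
    intro x hx
    have h : ¬ ∃ P ∈ 𝒬, x ∈ P.toSet := by
      rw [hmemΩ] at hx
      rintro ⟨P, hP, hxP⟩
      exact hx P hP hxP
    simp only [hg, dif_neg h]
  have lf : ∀ s : Set Plane, ∫⁻ x in s, ‖f x‖ₑ = ENNReal.ofReal (∫ x in s, ‖f x‖) := fun s =>
    (ofReal_integral_norm_eq_lintegral_enorm hf.integrableOn).symm
  have hvol : ∀ P : Cube, ∀ a : ℝ, 0 ≤ a →
      ENNReal.ofReal a * volume P.toSet = ENNReal.ofReal (a * P.side ^ 2) := fun P a ha => by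
    rw [P.volume_toSet, ENNReal.ofReal_mul ha]
  have havg : ∀ P ∈ 𝒬, ‖avg f P‖ ≤ 4 * t := by
    intro P hPQ
    have h1 := enorm_avg_mul_volume_le f P
    have h2 : ∫⁻ x in P.toSet, ‖f x‖ₑ ≤ ENNReal.ofReal (4 * t) * volume P.toSet := by
      rw [lf, hvol _ _ (by positivity)]
      exact ENNReal.ofReal_le_ofReal (hP P hPQ).2.2
    have h3 := (ENNReal.mul_le_mul_iff_left P.volume_ne_zero P.volume_ne_top).1 (h1.trans h2)
    rw [← ofReal_norm] at h3
    exact (ENNReal.ofReal_le_ofReal_iff (by positivity)).1 h3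
  have gm : AEStronglyMeasurable g volume := by
    have h1 : AEStronglyMeasurable g (volume.restrict Ω) := by
      rw [hΩ, aestronglyMeasurable_iUnion_iff]
      rintro ⟨P, hPQ⟩
      refine (aestronglyMeasurable_const (b := avg f P)).congr ?_
      filter_upwards [ae_restrict_mem P.measurableSet_toSet] with x hx
      exact (g_in P hPQ x hx).symm
    have h2 : AEStronglyMeasurable g (volume.restrict Ωᶜ) := by
      refine hf.1.restrict.congr ?_
      filter_upwards [ae_restrict_mem hΩm.compl] with x hx
      exact (g_out x hx).symm
    have := aestronglyMeasurable_union_iff.2 ⟨h1, h2⟩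
    rwa [Set.union_compl_self, Measure.restrict_univ] at this
  refine ⟨𝒬, g, hc, hdisj, ?_, gm, ?_, ?_, fun x hx => g_out x ((hmemΩ x).2 hx), ?_⟩
  · intro P hPQ
    rw [lf, hvol _ _ ht.le]
    exact ENNReal.ofReal_le_ofReal (hP P hPQ).2.1.le
  · filter_upwards [hae] with x hx
    by_cases hxΩ : x ∈ Ω
    · obtain ⟨P, hxP⟩ := Set.mem_iUnion.1 hxΩ
      rw [g_in P P.2 x hxP]; exact havg P P.2
    · rw [g_out x hxΩ]
      by_cases hxR : x ∈ R.toSet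
      · exact (hx hxR ((hmemΩ x).1 hxΩ)).trans (by linarith)
      · rw [hfR x hxR, norm_zero]; positivity
  · have e1 : ∫⁻ x in Ω, ‖g x‖ₑ ≤ ∫⁻ x in Ω, ‖f x‖ₑ := by
      rw [hΩ, lintegral_iUnion (fun P => Cube.measurableSet_toSet _) hpd,
        lintegral_iUnion (fun P => Cube.measurableSet_toSet _) hpd]
      refine ENNReal.tsum_le_tsum ?_
      rintro ⟨P, hPQ⟩
      refine le_trans (le_of_eq ?_) (enorm_avg_mul_volume_le f P)
      rw [← setLIntegral_const]
      exact setLIntegral_congr_fun P.measurableSet_toSet fun x hx => by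
        simp only [g_in P hPQ x hx]
    have e2 : ∫⁻ x in Ωᶜ, ‖g x‖ₑ = ∫⁻ x in Ωᶜ, ‖f x‖ₑ :=
      setLIntegral_congr_fun hΩm.compl fun x hx => by simp only [g_out x hx]
    rw [← lintegral_add_compl _ hΩm, ← lintegral_add_compl (fun x => ‖f x‖ₑ) hΩm, e2]
    gcongr
  · intro P hPQ
    rw [setIntegral_congr_fun P.measurableSet_toSet (g_in P hPQ), setIntegral_const, avg,
      setAverage_eq, smul_smul, mul_inv_cancel₀, one_smul]
    rw [P.volume_real]; exact (pow_pos P.side_pos 2).ne'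

/-- The weak type constant. -/
def weakConst (θ A : ℝ)
    (T : Lp ℂ 2 (volume : Measure Plane) →L[ℂ] Lp ℂ 2 (volume : Measure Plane)) : ℝ :=
  16 * ‖T‖ ^ 2 + 9 + 4 * (9 * A * (1296 / θ))

namespace IsGoodKernel

variable {θ A : ℝ} {K : Plane → Plane → ℂ}
  {T : Lp ℂ 2 (volume : Measure Plane) →L[ℂ] Lp ℂ 2 (volume : Measure Plane)}

theorem weakConst_pos (hK : IsGoodKernel θ A K) : 0 < weakConst θ A T := by
  have := hK.nonneg
  have := hK.pos
  unfold weakConst; positivity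

/-- The three summands of `weakConst` are the three parts of the classical proof: the good function,
by the `L²` bound and `‖g‖₂² ≤ 4 t ‖f‖₁`; the triples of the stopping cubes; and the atoms off these
triples. The condition on `R.side` keeps `R` itself from being a stopping cube. -/
theorem weak_local (hK : IsGoodKernel θ A K) (hT : HasKernel T K) (R : Cube) {f : Plane → ℂ}
    (hf : MemLp f 2 volume) (hf1 : Integrable f) (hfR : ∀ x ∉ R.toSet, f x = 0) {t : ℝ}
    (ht : 0 < t) (hft : ∫ x, ‖f x‖ ≤ t * R.side ^ 2) :
    volume {x | t < ‖opL2 T f x‖} ≤ ENNReal.ofReal (weakConst θ A T / t) * ∫⁻ x, ‖f x‖ₑ := by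
  obtain ⟨𝒬, g, hc, hdisj, hsize, gm, gb, gint, gout, gP⟩ :=
    exists_calderon_zygmund R hf1 hfR ht hft
  have hA := hK.nonneg
  have hθ := hK.pos
  set I := ∫⁻ x, ‖f x‖ₑ with hI
  have hIfin : I ≠ ∞ := hf1.2.ne
  have hg1 : Integrable g := ⟨gm, gint.trans_lt hf1.2⟩
  have hgsq : eLpNorm g 2 volume ^ 2 ≤ ENNReal.ofReal (4 * t) * I := by
    have : eLpNorm g 2 volume ^ 2 = ∫⁻ x, ‖g x‖ₑ ^ 2 := by
      have h2 := eLpNorm_nnreal_pow_eq_lintegral (f := g) (μ := (volume : Measure Plane)) (p := 2)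
        (by norm_num)
      simpa using h2
    rw [this]
    calc ∫⁻ x, ‖g x‖ₑ ^ 2 ≤ ∫⁻ x, ENNReal.ofReal (4 * t) * ‖g x‖ₑ := by
          refine lintegral_mono_ae ?_
          filter_upwards [gb] with x hx
          rw [sq]
          gcongr
          rw [← ofReal_norm]; exact ENNReal.ofReal_le_ofReal hx
      _ = ENNReal.ofReal (4 * t) * ∫⁻ x, ‖g x‖ₑ := lintegral_const_mul'' _ gm.enorm
      _ ≤ _ := by gcongr
  have hg : MemLp g 2 volume := by
    refine ⟨gm, ?_⟩
    have : eLpNorm g 2 volume ^ 2 < ∞ :=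
      hgsq.trans_lt (ENNReal.mul_lt_top ENNReal.ofReal_lt_top hIfin.lt_top)
    by_contra h
    rw [not_lt, top_le_iff] at h
    rw [h] at this
    simp at this
  set b := f - g with hbdef
  have hb : MemLp b 2 volume := hf.sub hg
  have hb1 : Integrable b := hf1.sub hg1
  have hbout : ∀ y, (∀ P ∈ 𝒬, y ∉ P.toSet) → b y = 0 := by
    intro y hy; rw [hbdef, Pi.sub_apply, gout y hy, sub_self]
  have hb0 : ∀ P ∈ 𝒬, ∫ y in P.toSet, b y = 0 := by
    intro P hP
    simp only [hbdef, Pi.sub_apply]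
    rw [integral_sub hf1.integrableOn hg1.integrableOn, gP P hP, sub_self]
  have hbI : ∫⁻ y, ‖b y‖ₑ ≤ 2 * I := by
    calc ∫⁻ y, ‖b y‖ₑ ≤ ∫⁻ y, (‖f y‖ₑ + ‖g y‖ₑ) := lintegral_mono fun y => enorm_sub_le
      _ = I + ∫⁻ y, ‖g y‖ₑ := lintegral_add_left' hf.1.enorm _
      _ ≤ I + I := by gcongr
      _ = 2 * I := (two_mul I).symm
  have : Countable 𝒬 := hc.to_subtype
  have hpd : Pairwise (Function.onFun Disjoint fun P : 𝒬 => (P : Cube).toSet) := by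
    intro P P' hne
    exact hdisj P.2 P'.2 (fun h => hne (Subtype.ext h))
  set Ωs : Set Plane := ⋃ P : 𝒬, (P : Cube).triple.toSet with hΩs
  have hΩsm : MeasurableSet Ωs := MeasurableSet.iUnion fun P => Cube.measurableSet_toSet _
  have hΩvol : volume Ωs ≤ ENNReal.ofReal (9 / t) * I := by
    have h1 : ∀ P : 𝒬, volume (P : Cube).triple.toSet ≤
        ENNReal.ofReal (9 / t) * ∫⁻ x in (P : Cube).toSet, ‖f x‖ₑ := by
      rintro ⟨P, hP⟩
      rw [Cube.volume_triple]
      calc 9 * volume P.toSet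
          = ENNReal.ofReal (9 / t) * (ENNReal.ofReal t * volume P.toSet) := by
            rw [← mul_assoc, ← ENNReal.ofReal_mul (by positivity), div_mul_cancel₀ _ ht.ne']
            norm_num
        _ ≤ _ := by gcongr; exact hsize P hP
    calc volume Ωs ≤ ∑' P : 𝒬, volume (P : Cube).triple.toSet := measure_iUnion_le _
      _ ≤ ∑' P : 𝒬, ENNReal.ofReal (9 / t) * ∫⁻ x in (P : Cube).toSet, ‖f x‖ₑ :=
          ENNReal.tsum_le_tsum h1
      _ = ENNReal.ofReal (9 / t) * ∫⁻ x in ⋃ P : 𝒬, (P : Cube).toSet, ‖f x‖ₑ := by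
          rw [ENNReal.tsum_mul_left, lintegral_iUnion (fun P => Cube.measurableSet_toSet _) hpd]
      _ ≤ _ := by gcongr; exact setLIntegral_le_lintegral _ _
  have ht2 : 0 < t / 2 := by positivity
  set G : Set Plane := {x | t / 2 < ‖opL2 T b x‖} \ Ωs with hGdef
  have hGm : MeasurableSet G :=
    (measurableSet_lt measurable_const (measurable_opL2 b).norm).diff hΩsm
  have hGfin : volume G ≠ ∞ := by
    refine ((measure_mono Set.sdiff_subset).trans_lt
      ((volume_lt_norm_le memLp_opL2 ht2).trans_lt ?_)).ne
    exact ENNReal.mul_lt_top ENNReal.ofReal_lt_top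
      (ENNReal.pow_lt_top (memLp_opL2 (T := T) (f := b)).2)
  have hGvol : volume G ≤ ENNReal.ofReal (4 * (9 * A * (1296 / θ)) / t) * I := by
    have h1 := hK.lintegral_opL2_atoms_le hT hc hdisj hb hb1 hbout hb0 hGm hGfin (by
      intro P hP
      rw [Set.disjoint_left]
      intro x hx hxP
      exact hx.2 (Set.mem_iUnion.2 ⟨⟨P, hP⟩, hxP⟩))
    have h2 : ENNReal.ofReal (t / 2) * volume G ≤ ∫⁻ x in G, ‖opL2 T b x‖ₑ := by
      rw [← setLIntegral_const]
      refine setLIntegral_mono_ae' hGm (ae_of_all _ fun x hx => ?_)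
      rw [← ofReal_norm]; exact ENNReal.ofReal_le_ofReal (le_of_lt hx.1)
    calc volume G = ENNReal.ofReal (2 / t) * (ENNReal.ofReal (t / 2) * volume G) := by
          rw [← mul_assoc, ← ENNReal.ofReal_mul (by positivity), div_mul_div_comm, mul_comm 2 t,
            div_self (by positivity), ENNReal.ofReal_one, one_mul]
      _ ≤ ENNReal.ofReal (2 / t) * (ENNReal.ofReal (9 * A * (1296 / θ)) * (2 * I)) := by
          exact mul_le_mul_right (h2.trans (h1.trans (mul_le_mul_right hbI _))) _
      _ = ENNReal.ofReal (2 / t) * ENNReal.ofReal (9 * A * (1296 / θ)) * ENNReal.ofReal 2 * I := by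
          rw [ENNReal.ofReal_ofNat]; ring
      _ = _ := by
          rw [← ENNReal.ofReal_mul (by positivity), ← ENNReal.ofReal_mul (by positivity)]
          congr 2; ring
  have hgvol : volume {x | t / 2 < ‖opL2 T g x‖} ≤ ENNReal.ofReal (16 * ‖T‖ ^ 2 / t) * I := by
    refine (volume_lt_norm_le memLp_opL2 ht2).trans ?_
    calc _ ≤ ENNReal.ofReal (1 / (t / 2) ^ 2) * (‖T‖ₑ * eLpNorm g 2 volume) ^ 2 := by
          gcongr; exact eLpNorm_opL2_le hg
      _ = ENNReal.ofReal (1 / (t / 2) ^ 2) * (ENNReal.ofReal (‖T‖ ^ 2) *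
            eLpNorm g 2 volume ^ 2) := by
          rw [mul_pow, ← ofReal_norm, ENNReal.ofReal_pow (norm_nonneg _)]
      _ ≤ ENNReal.ofReal (1 / (t / 2) ^ 2) * (ENNReal.ofReal (‖T‖ ^ 2) *
            (ENNReal.ofReal (4 * t) * I)) := by gcongr
      _ = _ := by
          rw [← mul_assoc, ← mul_assoc, ← ENNReal.ofReal_mul (by positivity),
            ← ENNReal.ofReal_mul (by positivity)]
          congr 2; field_simp; ring
  have hsub : {x | t < ‖opL2 T f x‖} ≤ᵐ[volume]
      ({x | t / 2 < ‖opL2 T g x‖} ∪ (Ωs ∪ G) : Set Plane) := by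
    have hfg : f = g + b := by rw [hbdef]; abel
    have hadd := opL2_add (T := T) hg hb
    rw [← hfg] at hadd
    filter_upwards [hadd] with x hx hxt
    by_contra hcon
    have h1 : ¬ t / 2 < ‖opL2 T g x‖ := fun h => hcon (Or.inl h)
    have h2 : ¬ t / 2 < ‖opL2 T b x‖ := by
      intro h
      by_cases hxΩ : x ∈ Ωs
      · exact hcon (Or.inr (Or.inl hxΩ))
      · exact hcon (Or.inr (Or.inr ⟨h, hxΩ⟩))
    have h3 : t < ‖opL2 T f x‖ := hxt
    rw [hx, Pi.add_apply] at h3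
    have := norm_add_le (opL2 T g x) (opL2 T b x)
    linarith
  calc _ ≤ volume ({x | t / 2 < ‖opL2 T g x‖} ∪ (Ωs ∪ G) : Set Plane) := measure_mono_ae hsub
    _ ≤ volume {x | t / 2 < ‖opL2 T g x‖} + (volume Ωs + volume G) :=
        (measure_union_le _ _).trans (by gcongr; exact measure_union_le _ _)
    _ ≤ ENNReal.ofReal (16 * ‖T‖ ^ 2 / t) * I + (ENNReal.ofReal (9 / t) * I +
          ENNReal.ofReal (4 * (9 * A * (1296 / θ)) / t) * I) := by gcongr
    _ = _ := by
        rw [← add_mul, ← add_mul, ← ENNReal.ofReal_add (by positivity) (by positivity),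
          ← ENNReal.ofReal_add (by positivity) (by positivity), weakConst]
        congr 2; ring

end IsGoodKernel

/-! ### Convergence in measure -/

theorem tendsto_eLpNorm_indicator_sub {p : ℝ≥0∞} (hp0 : p ≠ 0) (hpt : p ≠ ∞) {f : Plane → ℂ}
    (hf : MemLp f p volume) {s : ℕ → Set Plane} (hs : ∀ n, MeasurableSet (s n))
    (h : ∀ x, ∀ᶠ n in atTop, x ∈ s n) :
    Tendsto (fun n => eLpNorm ((s n).indicator f - f) p volume) atTop (𝓝 0) := by
  have hp : 0 < p.toReal := ENNReal.toReal_pos hp0 hpt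
  simp only [eLpNorm_eq_lintegral_rpow_enorm_toReal hp0 hpt]
  have key : Tendsto (fun n => ∫⁻ x, ‖((s n).indicator f - f) x‖ₑ ^ p.toReal) atTop (𝓝 0) := by
    have := tendsto_lintegral_of_dominated_convergence' (μ := (volume : Measure Plane))
      (F := fun n x => ‖((s n).indicator f - f) x‖ₑ ^ p.toReal) (f := fun _ => 0)
      (fun x => ‖f x‖ₑ ^ p.toReal)
      (fun n => ((hf.1.indicator (hs n)).sub hf.1).enorm.pow_const _)
      (fun n => ae_of_all _ fun x => ?_) ?_ (ae_of_all _ fun x => ?_)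
    · simpa using this
    · refine ENNReal.rpow_le_rpow ?_ hp.le
      by_cases hx : x ∈ s n <;> simp [hx]
    · exact (lintegral_rpow_enorm_lt_top_of_eLpNorm_lt_top hp0 hpt hf.2).ne
    · refine tendsto_const_nhds.congr' ?_
      filter_upwards [h x] with n hn
      simp [hn, hp]
  have h2 := key.ennrpow_const (1 / p.toReal)
  rwa [ENNReal.zero_rpow_of_pos (by positivity)] at h2

theorem tendstoInMeasure_add {f f' : ℕ → Plane → ℂ} {g g' : Plane → ℂ}
    (h : TendstoInMeasure volume f atTop g) (h' : TendstoInMeasure volume f' atTop g') :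
    TendstoInMeasure volume (fun n => f n + f' n) atTop (g + g') := by
  rw [tendstoInMeasure_iff_norm] at h h' ⊢
  intro ε hε
  have h1 := (h (ε / 2) (by positivity)).add (h' (ε / 2) (by positivity))
  rw [add_zero] at h1
  refine tendsto_of_tendsto_of_tendsto_of_le_of_le tendsto_const_nhds h1 (fun _ => zero_le)
    fun n => (measure_mono fun x hx => ?_).trans (measure_union_le _ _)
  simp only [Set.mem_union, Set.mem_ofPred_eq, Pi.add_apply] at hx ⊢
  by_contra! hcon
  have : f n x + f' n x - (g x + g' x) = (f n x - g x) + (f' n x - g' x) := by ring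
  rw [this] at hx
  linarith [norm_add_le (f n x - g x) (f' n x - g' x)]

theorem tendstoInMeasure_const_smul {f : ℕ → Plane → ℂ} {g : Plane → ℂ} (c : ℂ)
    (h : TendstoInMeasure volume f atTop g) :
    TendstoInMeasure volume (fun n => c • f n) atTop (c • g) := by
  rw [tendstoInMeasure_iff_norm] at h ⊢
  intro ε hε
  have h1 := h (ε / (‖c‖ + 1)) (by positivity)
  refine tendsto_of_tendsto_of_tendsto_of_le_of_le tendsto_const_nhds h1 (fun _ => zero_le)
    fun n => measure_mono fun x hx => ?_
  simp only [Set.mem_ofPred_eq, Pi.smul_apply, ← smul_sub, norm_smul] at hx ⊢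
  rw [div_le_iff₀ (by positivity)]
  nlinarith [norm_nonneg (f n x - g x)]

/-- Weak type bounds survive limits in measure at the price of halving the level. Two uses turn
`weakConst` into `2 * weakConst` and then `4 * weakConst`. -/
theorem volume_lt_norm_le_of_tendstoInMeasure {f : ℕ → Plane → ℂ} {g : Plane → ℂ}
    (h : TendstoInMeasure volume f atTop g) {t : ℝ} (ht : 0 < t) {B : ℕ → ℝ≥0∞} {b : ℝ≥0∞}
    (hB : Tendsto B atTop (𝓝 b)) (hfB : ∀ᶠ n in atTop, volume {x | t / 2 < ‖f n x‖} ≤ B n) :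
    volume {x | t < ‖g x‖} ≤ b := by
  rw [tendstoInMeasure_iff_norm] at h
  have h1 := hB.add (h (t / 2) (by positivity))
  rw [add_zero] at h1
  refine ge_of_tendsto h1 ?_
  filter_upwards [hfB] with n hn
  calc _ ≤ volume ({x | t / 2 < ‖f n x‖} ∪ {x | t / 2 ≤ ‖f n x - g x‖}) := by
        refine measure_mono fun x hx => ?_
        simp only [Set.mem_union, Set.mem_ofPred_eq] at hx ⊢
        by_contra! hcon
        have := norm_sub_norm_le (g x) (f n x)
        rw [norm_sub_rev] at this
        linarith
    _ ≤ _ := (measure_union_le _ _).trans (by gcongr)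

/-- Cubes exhausting the plane. -/
def bigCube (n : ℕ) : Cube := Cube.triple^[n] ⟨(0, 0), 1, one_pos⟩

theorem eventually_mem_bigCube (x : Plane) : ∀ᶠ n in atTop, x ∈ (bigCube n).toSet := by
  obtain ⟨k, hk⟩ := Cube.exists_mem_iterate_triple ⟨(0, 0), 1, one_pos⟩ x
  filter_upwards [eventually_ge_atTop k] with n hn
  exact Cube.subset_iterate_triple _ hn hk

theorem tendsto_bigCube_side : Tendsto (fun n => (bigCube n).side) atTop atTop := by
  have h : ∀ n, (bigCube n).side = (3 : ℝ) ^ n := fun n => by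
    rw [bigCube, Cube.iterate_triple_side]; simp
  simp only [h]
  exact tendsto_pow_atTop_atTop_of_one_lt (by norm_num)

theorem exists_truncations {f : Plane → ℂ} (hf : Integrable f) : ∃ s : ℕ → Set Plane,
    (∀ n, MeasurableSet (s n)) ∧ (∀ x, ∀ᶠ n in atTop, x ∈ s n) ∧
      ∀ n, MemLp ((s n).indicator f) 2 volume := by
  let F := hf.1.mk f
  have hF : Measurable F := hf.1.stronglyMeasurable_mk.measurable
  refine ⟨fun n => {x | ‖F x‖ ≤ n} ∩ (bigCube n).toSet, fun n =>
    (measurableSet_le hF.norm measurable_const).inter (Cube.measurableSet_toSet _), fun x => ?_,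
    fun n => ?_⟩
  · obtain ⟨m, hm⟩ := exists_nat_ge ‖F x‖
    filter_upwards [eventually_mem_bigCube x, eventually_ge_atTop m] with n h1 h2
    exact ⟨hm.trans (by exact_mod_cast h2), h1⟩
  · have hm : MeasurableSet ({x | ‖F x‖ ≤ n} ∩ (bigCube n).toSet) :=
      (measurableSet_le hF.norm measurable_const).inter (Cube.measurableSet_toSet _)
    rw [memLp_indicator_iff_restrict hm]
    have : IsFiniteMeasure (volume.restrict ({x | ‖F x‖ ≤ n} ∩ (bigCube n).toSet)) :=
      ⟨by
        rw [Measure.restrict_apply_univ]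
        exact (measure_mono Set.inter_subset_right).trans_lt (bigCube n).volume_ne_top.lt_top⟩
    refine MemLp.of_bound hf.1.restrict n ?_
    filter_upwards [ae_restrict_mem hm, ae_restrict_of_ae hf.1.ae_eq_mk] with x hx e
    rw [e]; exact hx.1

/-! ### The extension to integrable functions -/

namespace IsGoodKernel

variable {θ A : ℝ} {K : Plane → Plane → ℂ}
  {T : Lp ℂ 2 (volume : Measure Plane) →L[ℂ] Lp ℂ 2 (volume : Measure Plane)}

/-- For a fixed level the size condition of `weak_local` holds on all sufficiently large cubes, and
the images of the truncations converge in `L²`. -/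
theorem weak_L2 (hK : IsGoodKernel θ A K) (hT : HasKernel T K) {f : Plane → ℂ}
    (hf : MemLp f 2 volume) (hf1 : Integrable f) {t : ℝ} (ht : 0 < t) :
    volume {x | t < ‖opL2 T f x‖} ≤
      ENNReal.ofReal (2 * weakConst θ A T / t) * ∫⁻ x, ‖f x‖ₑ := by
  set u : ℕ → Plane → ℂ := fun n => (bigCube n).toSet.indicator f with hu
  have hum : ∀ n, MemLp (u n) 2 volume := fun n => hf.indicator (Cube.measurableSet_toSet _)
  have hu1 : ∀ n, Integrable (u n) := fun n => hf1.indicator (Cube.measurableSet_toSet _)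
  have hle : ∀ n x, ‖u n x‖ ≤ ‖f x‖ := fun n x => norm_indicator_le_norm_self _ _
  have hlim := tendsto_eLpNorm_indicator_sub (by norm_num) (by norm_num) hf
    (fun n => (bigCube n).measurableSet_toSet) eventually_mem_bigCube
  have hTlim : Tendsto (fun n => eLpNorm (opL2 T (u n) - opL2 T f) 2 volume) atTop (𝓝 0) := by
    have h0 : Tendsto (fun n => ‖T‖ₑ * eLpNorm (u n - f) 2 volume) atTop (𝓝 0) := by
      have := ENNReal.Tendsto.const_mul (a := ‖T‖ₑ) hlim (Or.inr enorm_ne_top)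
      rwa [mul_zero] at this
    refine tendsto_of_tendsto_of_tendsto_of_le_of_le tendsto_const_nhds h0 (fun _ => zero_le)
      fun n => ?_
    rw [← eLpNorm_congr_ae (opL2_sub (T := T) (hum n) hf)]
    exact eLpNorm_opL2_le ((hum n).sub hf)
  have hmeas := tendstoInMeasure_of_tendsto_eLpNorm (by norm_num)
    (fun n => (memLp_opL2 (T := T) (f := u n)).1) memLp_opL2.1 hTlim
  refine volume_lt_norm_le_of_tendstoInMeasure hmeas ht tendsto_const_nhds ?_
  have hside : Tendsto (fun n => t / 2 * (bigCube n).side ^ 2) atTop atTop :=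
    ((tendsto_pow_atTop (by norm_num)).comp tendsto_bigCube_side).const_mul_atTop (by positivity)
  filter_upwards [hside.eventually_ge_atTop (∫ x, ‖f x‖)] with n hn
  refine (hK.weak_local hT (bigCube n) (hum n) (hu1 n)
    (fun x hx => Set.indicator_of_notMem hx f) (by positivity)
    ((integral_mono (hu1 n).norm hf1.norm (hle n)).trans hn)).trans ?_
  have e : weakConst θ A T / (t / 2) = 2 * weakConst θ A T / t := by field_simp
  rw [e]
  gcongr with x
  exact enorm_le_iff_norm_le.2 (hle n x)

theorem tendstoInMeasure_of_tendsto_L1 (hK : IsGoodKernel θ A K) (hT : HasKernel T K)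
    {v w : ℕ → Plane → ℂ} {f g : Plane → ℂ} (hv : ∀ n, MemLp (v n) 2 volume)
    (hv1 : ∀ n, Integrable (v n)) (hw : ∀ n, MemLp (w n) 2 volume) (hw1 : ∀ n, Integrable (w n))
    (hf : Integrable f)
    (hvf : Tendsto (fun n => eLpNorm (v n - f) 1 volume) atTop (𝓝 0))
    (hwf : Tendsto (fun n => eLpNorm (w n - f) 1 volume) atTop (𝓝 0))
    (hg : TendstoInMeasure volume (fun n => opL2 T (v n)) atTop g) :
    TendstoInMeasure volume (fun n => opL2 T (w n)) atTop g := by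
  have hwv : Tendsto (fun n => eLpNorm (w n - v n) 1 volume) atTop (𝓝 0) := by
    have h0 := hwf.add hvf
    rw [add_zero] at h0
    refine tendsto_of_tendsto_of_tendsto_of_le_of_le tendsto_const_nhds h0 (fun _ => zero_le)
      fun n => ?_
    have e : w n - v n = (w n - f) - (v n - f) := by abel
    rw [e]
    exact eLpNorm_sub_le ((hw1 n).1.sub hf.1) ((hv1 n).1.sub hf.1) le_rfl
  have h1 : TendstoInMeasure volume (fun n => opL2 T (w n - v n)) atTop 0 := by
    rw [tendstoInMeasure_iff_norm]
    intro ε hε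
    have h0 : Tendsto (fun n => ENNReal.ofReal (2 * weakConst θ A T / (ε / 2)) *
        eLpNorm (w n - v n) 1 volume) atTop (𝓝 0) := by
      have := ENNReal.Tendsto.const_mul (a := ENNReal.ofReal (2 * weakConst θ A T / (ε / 2))) hwv
        (Or.inr ENNReal.ofReal_ne_top)
      rwa [mul_zero] at this
    refine tendsto_of_tendsto_of_tendsto_of_le_of_le tendsto_const_nhds h0 (fun _ => zero_le)
      fun n => ?_
    rw [eLpNorm_one_eq_lintegral_enorm]
    refine le_trans (measure_mono fun x hx => ?_) (hK.weak_L2 hT ((hw n).sub (hv n))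
      ((hw1 n).sub (hv1 n)) (by positivity : 0 < ε / 2))
    simp only [Set.mem_ofPred_eq, Pi.zero_apply, sub_zero] at hx ⊢
    linarith
  have h2 := tendstoInMeasure_add h1 hg
  rw [zero_add] at h2
  refine h2.congr_left fun n => ?_
  filter_upwards [opL2_sub (T := T) (hw n) (hv n)] with x hx
  simp [hx]

/-- Truncations with `L¹` errors `4 ^ (-n)` are chosen. At level `2 ^ (-n)` the weak bound makes
consecutive images differ only on a set of measure `O(2 ^ (-n))`, so a Borel–Cantelli argument gives
convergence both almost everywhere and in measure. -/
theorem exists_tendstoInMeasure (hK : IsGoodKernel θ A K) (hT : HasKernel T K) {f : Plane → ℂ}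
    (hf : Integrable f) : ∃ (v : ℕ → Plane → ℂ) (g : Plane → ℂ), (∀ n, MemLp (v n) 2 volume) ∧
      (∀ n, Integrable (v n)) ∧ Tendsto (fun n => eLpNorm (v n - f) 1 volume) atTop (𝓝 0) ∧
      AEStronglyMeasurable g volume ∧
      TendstoInMeasure volume (fun n => opL2 T (v n)) atTop g := by
  obtain ⟨s, hs, hsx, hs2⟩ := exists_truncations hf
  have hlim := tendsto_eLpNorm_indicator_sub one_ne_zero ENNReal.one_ne_top
    (memLp_one_iff_integrable.2 hf) hs hsx
  have hch : ∀ n : ℕ, ∃ k, eLpNorm ((s k).indicator f - f) 1 volume ≤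
      ENNReal.ofReal ((1 / 4) ^ n) := fun n =>
    (hlim.eventually_le_const (by rw [ENNReal.ofReal_pos]; positivity)).exists
  choose k hk using hch
  set v : ℕ → Plane → ℂ := fun n => (s (k n)).indicator f with hv
  have hv2 : ∀ n, MemLp (v n) 2 volume := fun n => hs2 _
  have hv1 : ∀ n, Integrable (v n) := fun n => hf.indicator (hs _)
  have hvf : Tendsto (fun n => eLpNorm (v n - f) 1 volume) atTop (𝓝 0) := by
    have h0 : Tendsto (fun n : ℕ => ENNReal.ofReal ((1 / 4 : ℝ) ^ n)) atTop (𝓝 0) := by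
      have := ENNReal.tendsto_ofReal
        (tendsto_pow_atTop_nhds_zero_of_lt_one (by norm_num : (0 : ℝ) ≤ 1 / 4) (by norm_num))
      rwa [ENNReal.ofReal_zero] at this
    exact tendsto_of_tendsto_of_tendsto_of_le_of_le tendsto_const_nhds h0 (fun _ => zero_le) hk
  have hW := hK.weakConst_pos (T := T)
  set W := weakConst θ A T with hWdef
  set d : ℕ → Plane → ℂ := fun n => opL2 T (v n) with hd
  set D : ℕ → Set Plane := fun n => {x | (1 / 2 : ℝ) ^ n < ‖opL2 T (v n - v (n + 1)) x‖} with hD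
  have hDvol : ∀ n, volume (D n) ≤ ENNReal.ofReal (4 * W * (1 / 2) ^ n) := by
    intro n
    refine (hK.weak_L2 hT ((hv2 n).sub (hv2 (n + 1))) ((hv1 n).sub (hv1 (n + 1)))
      (by positivity : 0 < (1 / 2 : ℝ) ^ n)).trans ?_
    rw [← eLpNorm_one_eq_lintegral_enorm]
    have h1 : eLpNorm (v n - v (n + 1)) 1 volume ≤ ENNReal.ofReal (2 * (1 / 4) ^ n) := by
      have e : v n - v (n + 1) = (v n - f) - (v (n + 1) - f) := by abel
      rw [e]
      refine (eLpNorm_sub_le ((hv1 n).1.sub hf.1) ((hv1 (n + 1)).1.sub hf.1) le_rfl).trans ?_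
      refine (add_le_add (hk n) (hk (n + 1))).trans ?_
      rw [← ENNReal.ofReal_add (by positivity) (by positivity)]
      apply ENNReal.ofReal_le_ofReal
      have : ((1 : ℝ) / 4) ^ (n + 1) ≤ (1 / 4) ^ n :=
        pow_le_pow_of_le_one (by norm_num) (by norm_num) (Nat.le_succ n)
      linarith
    calc _ ≤ ENNReal.ofReal (2 * W / (1 / 2) ^ n) * ENNReal.ofReal (2 * (1 / 4) ^ n) := by gcongr
      _ = _ := by
        rw [← ENNReal.ofReal_mul (by positivity)]
        congr 1
        have h4 : ((1 : ℝ) / 4) ^ n = (1 / 2) ^ n * (1 / 2) ^ n := by rw [← mul_pow]; norm_num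
        rw [h4]
        field_simp
        ring
  have hDtail : ∀ n, volume (⋃ m, D (n + m)) ≤ ENNReal.ofReal (8 * W * (1 / 2) ^ n) := by
    intro n
    calc _ ≤ ∑' m, volume (D (n + m)) := measure_iUnion_le _
      _ ≤ ∑' m, ENNReal.ofReal (4 * W * (1 / 2) ^ n * (1 / 2) ^ m) := by
          refine ENNReal.tsum_le_tsum fun m => (hDvol _).trans (le_of_eq ?_)
          rw [pow_add]; ring_nf
      _ = ENNReal.ofReal (∑' m, 4 * W * (1 / 2) ^ n * (1 / 2) ^ m) := by
          rw [ENNReal.ofReal_tsum_of_nonneg (fun m => by positivity)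
            (summable_geometric_two.mul_left _)]
      _ = _ := by rw [tsum_mul_left, tsum_geometric_two]; congr 1; ring
  have hsub : ∀ᵐ x, ∀ n, opL2 T (v n - v (n + 1)) x = d n x - d (n + 1) x :=
    ae_all_iff.2 fun n => opL2_sub (hv2 n) (hv2 (n + 1))
  have hdist : ∀ x, (∀ n, opL2 T (v n - v (n + 1)) x = d n x - d (n + 1) x) → ∀ n,
      x ∉ ⋃ m, D (n + m) →
      ∀ m, dist (d (n + m) x) (d (n + (m + 1)) x) ≤ 2 * (1 / 2) ^ n / 2 / 2 ^ m := by
    intro x hx n hn m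
    have h1 : x ∉ D (n + m) := fun h => hn (Set.mem_iUnion.2 ⟨m, h⟩)
    have h2 : ‖opL2 T (v (n + m) - v (n + m + 1)) x‖ ≤ (1 / 2 : ℝ) ^ (n + m) := by
      by_contra! h; exact h1 h
    rw [hx, ← dist_eq_norm] at h2
    refine h2.trans (le_of_eq ?_)
    rw [pow_add, one_div_pow, one_div_pow]; field_simp
  have hae : ∀ᵐ x, ∃ l, Tendsto (fun n => d n x) atTop (𝓝 l) := by
    have hnull : volume (⋂ n, ⋃ m, D (n + m)) = 0 := by
      have h0 : Tendsto (fun n : ℕ => ENNReal.ofReal (8 * W * (1 / 2) ^ n)) atTop (𝓝 0) := by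
        have := ENNReal.tendsto_ofReal ((tendsto_pow_atTop_nhds_zero_of_lt_one
          (by norm_num : (0 : ℝ) ≤ 1 / 2) (by norm_num)).const_mul (8 * W))
        rwa [mul_zero, ENNReal.ofReal_zero] at this
      exact le_antisymm (ge_of_tendsto' h0 fun n =>
        (measure_mono (Set.iInter_subset _ n)).trans (hDtail n)) zero_le
    have h1 : ∀ᵐ x, x ∉ ⋂ n, ⋃ m, D (n + m) := measure_eq_zero_iff_ae_notMem.1 hnull
    filter_upwards [h1, hsub] with x hx hxs
    rw [Set.mem_iInter, not_forall] at hx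
    obtain ⟨n, hn⟩ := hx
    have hc := cauchySeq_of_le_geometric_two (hdist x hxs n hn)
    obtain ⟨l, hl⟩ := cauchySeq_tendsto_of_complete hc
    refine ⟨l, ?_⟩
    rw [← tendsto_add_atTop_iff_nat n]
    simpa only [add_comm] using hl
  obtain ⟨g, hgm, hg⟩ := measurable_limit_of_tendsto_metrizable_ae
    (fun n => (measurable_opL2 (T := T) (v n)).aemeasurable) hae
  refine ⟨v, g, hv2, hv1, hvf, hgm.aestronglyMeasurable, ?_⟩
  rw [tendstoInMeasure_iff_norm]
  intro ε hε
  have h0 : Tendsto (fun n : ℕ => ENNReal.ofReal (8 * W * (1 / 2) ^ n)) atTop (𝓝 0) := by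
    have := ENNReal.tendsto_ofReal ((tendsto_pow_atTop_nhds_zero_of_lt_one
      (by norm_num : (0 : ℝ) ≤ 1 / 2) (by norm_num)).const_mul (8 * W))
    rwa [mul_zero, ENNReal.ofReal_zero] at this
  have hsmall : ∀ᶠ n : ℕ in atTop, 2 * (1 / 2 : ℝ) ^ n < ε := by
    have := (tendsto_pow_atTop_nhds_zero_of_lt_one
      (by norm_num : (0 : ℝ) ≤ 1 / 2) (by norm_num)).const_mul 2
    rw [mul_zero] at this
    exact this.eventually_lt_const hε
  refine tendsto_of_tendsto_of_tendsto_of_le_of_le' tendsto_const_nhds h0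
    (Eventually.of_forall fun _ => zero_le) ?_
  filter_upwards [hsmall] with n hn
  refine (measure_mono_ae ?_).trans (hDtail n)
  filter_upwards [hsub, hg] with x hxs hxg hx
  by_contra hcon
  have hx' : ε ≤ ‖d n x - g x‖ := hx
  have h1 : Tendsto (fun m => d (n + m) x) atTop (𝓝 (g x)) := by
    have := (tendsto_add_atTop_iff_nat n).2 hxg
    simpa only [add_comm] using this
  have h2 := dist_le_of_le_geometric_two_of_tendsto₀ (hdist x hxs n hcon) h1
  rw [add_zero, dist_eq_norm] at h2
  linarith

theorem exists_isExtensionValue (hK : IsGoodKernel θ A K) (hT : HasKernel T K) {f : Plane → ℂ}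
    (hf : Integrable f) : ∃ g, IsExtensionValue T f g := by
  obtain ⟨v, g, hv2, hv1, hvf, hgm, hg⟩ := hK.exists_tendstoInMeasure hT hf
  refine ⟨g, hf, hgm, fun u hu huf => ?_⟩
  have := hK.tendstoInMeasure_of_tendsto_L1 hT hv2 hv1 (fun n => Lp.memLp (u n)) hu hf hvf huf hg
  simpa only [opL2_coe] using this

end IsGoodKernel

namespace IsExtensionValue

variable {T : Lp ℂ 2 (volume : Measure Plane) →L[ℂ] Lp ℂ 2 (volume : Measure Plane)}
  {f f' g g' : Plane → ℂ}

theorem tendstoInMeasure (h : IsExtensionValue T f g) {v : ℕ → Plane → ℂ}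
    (hv : ∀ n, MemLp (v n) 2 volume) (hv1 : ∀ n, Integrable (v n))
    (hvf : Tendsto (fun n => eLpNorm (v n - f) 1 volume) atTop (𝓝 0)) :
    TendstoInMeasure volume (fun n => opL2 T (v n)) atTop g := by
  have := h.2.2 (fun n => (hv n).toLp (v n))
    (fun n => (integrable_congr (hv n).coeFn_toLp).2 (hv1 n)) (hvf.congr fun n => ?_)
  · simpa only [opL2_eq (hv _)] using this
  · exact eLpNorm_congr_ae ((hv n).coeFn_toLp.symm.sub (ae_eq_refl f))

theorem exists_seq (h : IsExtensionValue T f g) : ∃ s : ℕ → Set Plane,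
    (∀ n, MeasurableSet (s n)) ∧ (∀ x, ∀ᶠ n in atTop, x ∈ s n) ∧
    (∀ n, MemLp ((s n).indicator f) 2 volume) ∧
    Tendsto (fun n => eLpNorm ((s n).indicator f - f) 1 volume) atTop (𝓝 0) ∧
    TendstoInMeasure volume (fun n => opL2 T ((s n).indicator f)) atTop g := by
  obtain ⟨s, hs, hsx, hs2⟩ := exists_truncations h.1
  have hlim := tendsto_eLpNorm_indicator_sub one_ne_zero ENNReal.one_ne_top
    (memLp_one_iff_integrable.2 h.1) hs hsx
  exact ⟨s, hs, hsx, hs2, hlim, h.tendstoInMeasure hs2 (fun n => h.1.indicator (hs n)) hlim⟩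

theorem ae_unique (h : IsExtensionValue T f g) (h' : IsExtensionValue T f' g')
    (hff' : f =ᵐ[volume] f') : g =ᵐ[volume] g' := by
  obtain ⟨s, hs, -, hs2, hlim, hg⟩ := h.exists_seq
  refine tendstoInMeasure_ae_unique hg
    (h'.tendstoInMeasure hs2 (fun n => h.1.indicator (hs n)) (hlim.congr fun n => ?_))
  exact eLpNorm_congr_ae ((ae_eq_refl _).sub hff')

theorem ae_eq_add {k : Plane → ℂ} (h : IsExtensionValue T f g) (h' : IsExtensionValue T f' g')
    (hk : IsExtensionValue T (f + f') k) : k =ᵐ[volume] g + g' := by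
  obtain ⟨s, hs, -, hs2, hlim, hg⟩ := h.exists_seq
  obtain ⟨s', hs', -, hs2', hlim', hg'⟩ := h'.exists_seq
  have h1 := hk.tendstoInMeasure (fun n => (hs2 n).add (hs2' n))
    (fun n => (h.1.indicator (hs n)).add (h'.1.indicator (hs' n))) ?_
  · refine tendstoInMeasure_ae_unique h1 ((tendstoInMeasure_add hg hg').congr_left fun n => ?_)
    exact (opL2_add (hs2 n) (hs2' n)).symm
  · have h0 := hlim.add hlim'
    rw [add_zero] at h0
    refine tendsto_of_tendsto_of_tendsto_of_le_of_le tendsto_const_nhds h0 (fun _ => zero_le)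
      fun n => ?_
    rw [add_sub_add_comm]
    exact eLpNorm_add_le ((h.1.indicator (hs n)).1.sub h.1.1)
      ((h'.1.indicator (hs' n)).1.sub h'.1.1) le_rfl

theorem ae_eq_const_smul {k : Plane → ℂ} (c : ℂ) (h : IsExtensionValue T f g)
    (hk : IsExtensionValue T (c • f) k) : k =ᵐ[volume] c • g := by
  obtain ⟨s, hs, -, hs2, hlim, hg⟩ := h.exists_seq
  have h1 := hk.tendstoInMeasure (fun n => (hs2 n).const_smul c)
    (fun n => (h.1.indicator (hs n)).smul c) ?_
  · refine tendstoInMeasure_ae_unique h1 ((tendstoInMeasure_const_smul c hg).congr_left fun n => ?_)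
    exact (opL2_const_smul c (hs2 n)).symm
  · have h0 := ENNReal.Tendsto.const_mul (a := ‖c‖ₑ) hlim (Or.inr enorm_ne_top)
    rw [mul_zero] at h0
    refine h0.congr fun n => ?_
    rw [← smul_sub, eLpNorm_const_smul]

end IsExtensionValue

/-! ### Weak type operators with a kernel -/

/-- A linear operator on the integrable functions of weak type `(1, 1)` with kernel `K`. -/
structure IsWeakOp (W : ℝ) (K : Plane → Plane → ℂ) (S : (Plane → ℂ) → Plane → ℂ) : Prop where
  congr : ∀ {f g : Plane → ℂ}, Integrable f → f =ᵐ[volume] g → S f =ᵐ[volume] S g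
  add : ∀ {f g : Plane → ℂ}, Integrable f → Integrable g → S (f + g) =ᵐ[volume] S f + S g
  const_smul : ∀ {f : Plane → ℂ} (c : ℂ), Integrable f → S (c • f) =ᵐ[volume] c • S f
  weak : ∀ {f : Plane → ℂ} {t : ℝ}, Integrable f → 0 < t →
    volume {x | t < ‖S f x‖} ≤ ENNReal.ofReal (W / t) * ∫⁻ x, ‖f x‖ₑ
  repr : ∀ {f : Plane → ℂ} {U : Set Plane} {δ : ℝ}, Integrable f → 0 < δ →
    (∀ x ∈ U, ∀ y, f y ≠ 0 → δ ≤ dist x y) → ∀ᵐ x, x ∈ U → S f x = ∫ y, K x y * f y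

/-- The extension becomes a function defined on all functions, with a junk value off `L¹`. The
sparse argument uses only the properties collected in `IsWeakOp`. -/
theorem IsGoodKernel.exists_isWeakOp {θ A : ℝ} {K : Plane → Plane → ℂ} (hK : IsGoodKernel θ A K)
    {T : Lp ℂ 2 (volume : Measure Plane) →L[ℂ] Lp ℂ 2 (volume : Measure Plane)}
    (hT : HasKernel T K) : ∃ S : (Plane → ℂ) → Plane → ℂ,
      (∀ f g, IsExtensionValue T f g → g =ᵐ[volume] S f) ∧
      IsWeakOp (4 * weakConst θ A T) K S := by
  classical
  let S : (Plane → ℂ) → Plane → ℂ := fun f =>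
    if h : Integrable f then (hK.exists_isExtensionValue hT h).choose else 0
  have hS : ∀ {f}, Integrable f → IsExtensionValue T f (S f) := by
    intro f hf
    simp only [S, dif_pos hf]
    exact (hK.exists_isExtensionValue hT hf).choose_spec
  refine ⟨S, fun f g h => h.ae_unique (hS h.1) (ae_eq_refl f), ?_, ?_, ?_, ?_, ?_⟩
  · intro f g hf hfg
    exact (hS hf).ae_unique (hS ((integrable_congr hfg).1 hf)) hfg
  · intro f g hf hg
    exact (hS hf).ae_eq_add (hS hg) (hS (hf.add hg))
  · intro f c hf
    exact (hS hf).ae_eq_const_smul c (hS (hf.smul c))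
  · intro f t hf ht
    obtain ⟨s, hs, -, hs2, -, hg⟩ := (hS hf).exists_seq
    refine volume_lt_norm_le_of_tendstoInMeasure hg ht tendsto_const_nhds
      (Eventually.of_forall fun n => ?_)
    refine (hK.weak_L2 hT (hs2 n) (hf.indicator (hs n)) (by positivity)).trans ?_
    have e : 2 * weakConst θ A T / (t / 2) = 4 * weakConst θ A T / t := by field_simp; ring
    rw [e]
    gcongr with x
    exact enorm_indicator_le_enorm_self _ _
  · intro f U δ hf hδ hU
    obtain ⟨s, hs, hsx, hs2, -, hg⟩ := (hS hf).exists_seq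
    -- Along a subsequence the images of the truncations converge almost everywhere; their kernel
    -- integrals converge by dominated convergence, since the kernel is bounded by `A / δ ^ 2` where
    -- `f` is nonzero.
    obtain ⟨ns, hns, hae⟩ := hg.exists_seq_tendsto_ae
    have hrep : ∀ᵐ x, ∀ n, x ∈ U →
        opL2 T ((s n).indicator f) x = ∫ y, K x y * (s n).indicator f y := by
      refine ae_all_iff.2 fun n => hK.ae_opL2_eq hT (hs2 n) (hf.indicator (hs n)) hδ ?_
      intro x hx y hy
      refine hU x hx y fun h0 => hy ?_
      rw [Set.indicator_apply]; split_ifs <;> simp [h0]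
    filter_upwards [hae, hrep] with x h1 h2 hxU
    have h3 : Tendsto (fun n => ∫ y, K x y * (s n).indicator f y) atTop
        (𝓝 (∫ y, K x y * f y)) := by
      refine tendsto_integral_of_dominated_convergence (fun y => A / δ ^ 2 * ‖f y‖)
        (fun n => (hK.measurable.comp measurable_prodMk_left).aestronglyMeasurable.mul
          (hf.1.indicator (hs n))) (hf.norm.const_mul _) (fun n => ae_of_all _ fun y => ?_)
        (ae_of_all _ fun y => ?_)
      · refine le_trans ?_ (hK.norm_mul_le hδ (hU x hxU y))
        rw [norm_mul, norm_mul]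
        gcongr
        exact norm_indicator_le_norm_self _ _
      · refine tendsto_const_nhds.congr' ?_
        filter_upwards [hsx y] with n hn
        simp [hn]
    refine tendsto_nhds_unique h1 ((h3.comp hns.tendsto_atTop).congr fun n => ?_)
    exact (h2 (ns n) hxU).symm

/-! ### The maximal function over cubes -/

theorem volume_closedBall_plane (c : Plane) {r : ℝ} (hr : 0 ≤ r) :
    volume (Metric.closedBall c r) = ENNReal.ofReal ((2 * r) ^ 2) := by
  have : Metric.closedBall c r = Metric.closedBall c.1 r ×ˢ Metric.closedBall c.2 r := by
    rw [closedBall_prod_same]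
  rw [this, Measure.volume_eq_prod, Measure.prod_prod, Real.volume_closedBall,
    Real.volume_closedBall, ← ENNReal.ofReal_mul (by positivity), sq]

/-- The weak type estimate of the maximal function over cubes. -/
theorem volume_maximal_le {F : Plane → ℝ≥0∞} (hF : ∫⁻ x, F x ≠ ∞) {t : ℝ≥0∞} (ht0 : t ≠ 0)
    (ht : t ≠ ∞) :
    t * volume {x | ∃ S : Cube, x ∈ S.toSet ∧ t * volume S.toSet < ∫⁻ y in S.toSet, F y} ≤
      25 * ∫⁻ x, F x := by
  set I := ∫⁻ x, F x with hI
  set 𝒯 : Set Cube := {S | t * volume S.toSet < ∫⁻ y in S.toSet, F y} with h𝒯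
  have hV : I / t ≠ ∞ := ENNReal.div_ne_top hF ht0
  have hside : ∀ S ∈ 𝒯, S.side / 2 ≤ (I / t).toReal + 1 := by
    intro S hS
    have h1 : t * volume S.toSet ≤ I := (le_of_lt hS).trans (setLIntegral_le_lintegral _ _)
    have h2 : volume S.toSet ≤ I / t := by
      rw [ENNReal.le_div_iff_mul_le (Or.inl ht0) (Or.inl ht), mul_comm]; exact h1
    rw [S.volume_toSet] at h2
    have h3 := (ENNReal.ofReal_le_iff_le_toReal hV).1 h2
    nlinarith [sq_nonneg (S.side - 1)]
  -- Vitali's covering lemma needs the uniform bound on the sides just shown; enlarging by `5` costs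
  -- `5² = 25` in area.
  obtain ⟨u, hu𝒯, hdisj, hcov⟩ := Vitali.exists_disjoint_subfamily_covering_enlargement_closedBall
    𝒯 Cube.center (fun S => S.side / 2) _ hside 5 (by norm_num)
  have hdisj' : u.PairwiseDisjoint Cube.toSet := hdisj.mono fun S => S.toSet_subset_closedBall
  have hc : u.Countable :=
    hdisj'.countable_of_nonempty_interior fun S _ => S.interior_nonempty
  have : Countable u := hc.to_subtype
  have hpd : Pairwise (Function.onFun Disjoint fun P : u => (P : Cube).toSet) := by
    intro P P' hne
    exact hdisj' P.2 P'.2 (fun h => hne (Subtype.ext h))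
  have hsub : {x | ∃ S : Cube, x ∈ S.toSet ∧ t * volume S.toSet < ∫⁻ y in S.toSet, F y} ⊆
      ⋃ S : u, Metric.closedBall (S : Cube).center (5 * ((S : Cube).side / 2)) := by
    rintro x ⟨S, hxS, hS⟩
    obtain ⟨S', hS', hsub⟩ := hcov S hS
    exact Set.mem_iUnion.2 ⟨⟨S', hS'⟩, hsub (S.toSet_subset_closedBall hxS)⟩
  calc _ ≤ t * ∑' S : u, volume (Metric.closedBall (S : Cube).center (5 * ((S : Cube).side / 2))) :=
        by gcongr; exact (measure_mono hsub).trans (measure_iUnion_le _)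
    _ = ∑' S : u, 25 * (t * volume (S : Cube).toSet) := by
        rw [← ENNReal.tsum_mul_left]
        refine tsum_congr fun S => ?_
        have hs := (S : Cube).side_pos
        rw [volume_closedBall_plane _ (by positivity), Cube.volume_toSet]
        have : (2 * (5 * ((S : Cube).side / 2))) ^ 2 = 25 * (S : Cube).side ^ 2 := by ring
        rw [this, ENNReal.ofReal_mul (by norm_num), ENNReal.ofReal_ofNat]
        ring
    _ ≤ ∑' S : u, 25 * ∫⁻ y in (S : Cube).toSet, F y := by
        refine ENNReal.tsum_le_tsum fun S => ?_
        gcongr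
        exact le_of_lt (hu𝒯 S.2)
    _ = 25 * ∫⁻ y in ⋃ S : u, (S : Cube).toSet, F y := by
        rw [ENNReal.tsum_mul_left, lintegral_iUnion (fun P => Cube.measurableSet_toSet _) hpd]
    _ ≤ _ := by gcongr; exact setLIntegral_le_lintegral _ _

/-! ### The local estimate -/

theorem lintegral_rpow_eq_pAvg {p : ℝ} (hp : 0 < p) (g : Plane → ℂ) (S : Cube) :
    ∫⁻ x in S.toSet, ‖g x‖ₑ ^ p = volume S.toSet * pAvg p g S ^ p := by
  rw [pAvg, ← ENNReal.rpow_mul, one_div_mul_cancel hp.ne', ENNReal.rpow_one, ← mul_assoc,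
    ENNReal.mul_inv_cancel S.volume_ne_zero S.volume_ne_top, one_mul]

theorem pAvg_le_of_lintegral_le {p : ℝ} (hp : 0 < p) {g : Plane → ℂ} {S : Cube} {M : ℝ≥0∞}
    (h : ∫⁻ x in S.toSet, ‖g x‖ₑ ^ p ≤ M ^ p * volume S.toSet) : pAvg p g S ≤ M := by
  rw [lintegral_rpow_eq_pAvg hp, mul_comm,
    ENNReal.mul_le_mul_iff_left S.volume_ne_zero S.volume_ne_top] at h
  exact (ENNReal.rpow_le_rpow_iff hp).1 h

theorem lintegral_eq_setLIntegral {R : Cube} {F : Plane → ℝ≥0∞} (h : ∀ x ∉ R.toSet, F x = 0) :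
    ∫⁻ x, F x = ∫⁻ x in R.toSet, F x := by
  rw [← lintegral_indicator R.measurableSet_toSet]
  refine lintegral_congr fun x => ?_
  by_cases hx : x ∈ R.toSet <;> simp [hx, h]

/-- The constant of the local estimate. -/
def localConst (θ A W : ℝ) : ℝ := 576 * W + 36 * W * 14400 + 2 * (9 * A * (648 / θ) * 14400)

section Local

variable {θ A W : ℝ} {K : Plane → Plane → ℂ} {Φ : (Plane → ℂ) → Plane → ℂ}

theorem localConst_pos (hK : IsGoodKernel θ A K) (hW : 0 < W) : 0 < localConst θ A W := by
  have := hK.nonneg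
  have := hK.pos
  unfold localConst; positivity

/-- Oscillation on a cube of the image of a function supported off the triple cube. -/
theorem IsGoodKernel.ae_norm_sub_le (hK : IsGoodKernel θ A K) (hΦ : IsWeakOp W K Φ) {p : ℝ}
    (hp : 1 < p) {g : Plane → ℂ} (hg : Integrable g) {P : Cube} {M : ℝ} (hM : 0 ≤ M)
    (hgM : ∀ k : ℕ, pAvg p g (Cube.triple^[k + 1] P) ≤ ENNReal.ofReal M) :
    ∃ k₀ : ℂ, ∀ᵐ x, x ∈ P.toSet → ‖Φ (P.triple.toSetᶜ.indicator g) x - k₀‖ ≤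
      9 * A * (648 / θ) * (p / (p - 1)) * M := by
  have hA := hK.nonneg
  have hθ := hK.pos
  have hp1 : 0 < p - 1 := by linarith
  have hp0 : 0 < p := by linarith
  set g₂ := P.triple.toSetᶜ.indicator g with hg₂
  have hm : MeasurableSet P.triple.toSetᶜ := P.triple.measurableSet_toSet.compl
  have hg₂i : Integrable g₂ := hg.indicator hm
  have hd : ∀ x ∈ P.toSet, ∀ y, g₂ y ≠ 0 → P.side ≤ dist x y := by
    intro x hx y hy
    rw [dist_comm]
    exact IsGoodKernel.side_le_dist (Set.mem_of_indicator_ne_zero hy) hx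
  -- The reference value is the kernel integral at the centre. Here the first argument of the kernel
  -- moves inside `P`, hence the use of `hK.swap` below.
  refine ⟨∫ y, K P.center y * g₂ y, ?_⟩
  filter_upwards [hΦ.repr hg₂i P.side_pos hd] with x hx hxP
  have i1 := hK.integrable_mul hg₂i P.side_pos (hd x hxP)
  have i2 := hK.integrable_mul hg₂i P.side_pos (hd _ P.center_mem)
  rw [hx hxP, ← integral_sub i1 i2]
  have h1 : ‖∫ y, (K x y * g₂ y - K P.center y * g₂ y)‖ₑ ≤
      ENNReal.ofReal (9 * A * (648 / θ) * (p / (p - 1)) * M) := by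
    refine (enorm_integral_le_lintegral_enorm _).trans ?_
    calc _ ≤ ∫⁻ y, P.triple.toSetᶜ.indicator
          (fun y => ENNReal.ofReal (9 * A) * (‖g y‖ₑ * ENNReal.ofReal (bump θ P y))) y := by
          refine lintegral_mono_ae ?_
          filter_upwards [ae_fst_ne x.1, ae_snd_ne x.2, ae_fst_ne P.center.1, ae_snd_ne P.center.2]
            with y e1 e2 e3 e4
          by_cases hy : y ∈ P.triple.toSetᶜ
          · rw [hg₂, Set.indicator_of_mem hy, Set.indicator_of_mem hy, ← sub_mul, enorm_mul,
              mul_comm ‖g y‖ₑ, ← mul_assoc]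
            gcongr
            rw [← ENNReal.ofReal_mul (by positivity), ← ofReal_norm]
            exact ENNReal.ofReal_le_ofReal (hK.swap.kernel.norm_sub_center_le hK.pos hK.le_one hxP hy
              e1.symm e2.symm e3.symm e4.symm)
          · rw [hg₂, Set.indicator_of_notMem hy, Set.indicator_of_notMem hy]
            simp
      _ = ENNReal.ofReal (9 * A) *
          ∫⁻ y in P.triple.toSetᶜ, ‖g y‖ₑ * ENNReal.ofReal (bump θ P y) := by
          rw [lintegral_indicator hm]
          exact lintegral_const_mul'' _
            (hg.1.enorm.mul (measurable_bump θ P).ennreal_ofReal.aemeasurable).restrict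
      _ ≤ ENNReal.ofReal (9 * A) *
          (ENNReal.ofReal (648 / θ * (p / (p - 1))) * ENNReal.ofReal M) := by
          gcongr
          exact lintegral_mul_bump_le hp hg.1.aemeasurable hK.pos hK.le_one hgM
      _ = _ := by
          rw [← ENNReal.ofReal_mul (by positivity), ← ENNReal.ofReal_mul (by positivity)]
          congr 1; ring
  rw [← ofReal_norm] at h1
  exact (ENNReal.ofReal_le_ofReal_iff (by positivity)).1 h1

/-- `E` collects the points where `Φ g` or the maximal function of `|g| ^ p` is large. On a cube `P`
half free of `E`, the function `Φ (g 1_{(3P)ᶜ})` is nearly constant by `ae_norm_sub_le`, so a bound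
at a single point of `P` suffices. Such a point exists because `Φ (g 1_{3P})` is large only on a
quarter of `P`. -/
theorem exists_exceptional_set_of_pos (hK : IsGoodKernel θ A K) (hW : 0 < W)
    (hΦ : IsWeakOp W K Φ) {p : ℝ} (hp : 1 < p) {Q : Cube} {g : Plane → ℂ} (hg : Integrable g)
    (hgQ : ∀ x ∉ Q.triple.toSet, g x = 0) {L : ℝ} (hL : 0 < L)
    (hgL : pAvg p g Q.triple ≤ ENNReal.ofReal L) :
    ∃ E : Set Plane, MeasurableSet E ∧ E ⊆ Q.toSet ∧
      volume E ≤ ENNReal.ofReal (1 / 32) * volume Q.toSet ∧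
      (∀ᵐ x, x ∈ Q.toSet → x ∉ E → ‖Φ g x‖ ≤ localConst θ A W * (p / (p - 1)) * L) ∧
      ∀ P : Cube, P.toSet ⊆ Q.toSet →
        volume (P.toSet ∩ E) ≤ ENNReal.ofReal (1 / 2) * volume P.toSet →
        ∀ᵐ x, x ∈ P.toSet → ‖Φ (P.triple.toSetᶜ.indicator g) x‖ ≤
          localConst θ A W * (p / (p - 1)) * L := by
  have hA := hK.nonneg
  have hθ := hK.pos
  have hp1 : 0 < p - 1 := by linarith
  have hp0 : 0 < p := by linarith
  have hp' : 1 ≤ p / (p - 1) := by rw [le_div_iff₀ hp1]; linarith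
  set p' := p / (p - 1) with hp'def
  set V := volume Q.toSet with hV
  have hV3 : volume Q.triple.toSet = 9 * V := Q.volume_triple
  -- The weak bound with `|3Q| = 9 |Q|` and `576 = 9 * 64` gives measure at most `|Q| / 64`.
  set E₀ : Set Plane := {x | 576 * W * L < ‖Φ g x‖} with hE₀
  -- `14400 = 25 * 9 * 64`: the maximal constant, the area of the triple, and the target `1/64`.
  -- Since `14400 ^ p ≥ 14400`, one constant serves all `p`.
  set s : ℝ≥0∞ := ENNReal.ofReal (14400 * L) ^ p with hs
  have hs0 : s ≠ 0 := by
    rw [hs]; exact (ENNReal.rpow_pos (by rw [ENNReal.ofReal_pos]; positivity)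
      ENNReal.ofReal_ne_top).ne'
  have hst : s ≠ ∞ := by rw [hs]; exact ENNReal.rpow_ne_top_of_nonneg hp0.le ENNReal.ofReal_ne_top
  set E₁ : Set Plane := {x | ∃ S : Cube, x ∈ S.toSet ∧
    s * volume S.toSet < ∫⁻ y in S.toSet, ‖g y‖ₑ ^ p} with hE₁
  have vE₀ : volume E₀ ≤ ENNReal.ofReal (1 / 64) * V := by
    calc volume E₀ ≤ ENNReal.ofReal (W / (576 * W * L)) * ∫⁻ x, ‖g x‖ₑ :=
          hΦ.weak hg (by positivity)
      _ = ENNReal.ofReal (W / (576 * W * L)) * ∫⁻ x in Q.triple.toSet, ‖g x‖ₑ := by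
          rw [lintegral_eq_setLIntegral (R := Q.triple)]
          intro x hx; rw [hgQ x hx, enorm_zero]
      _ ≤ ENNReal.ofReal (W / (576 * W * L)) * (9 * V * ENNReal.ofReal L) := by
          gcongr
          rw [← hV3]
          exact (lintegral_cube_le_pAvg hp hg.1.aemeasurable.restrict).trans (by gcongr)
      _ = ENNReal.ofReal (W / (576 * W * L)) * ENNReal.ofReal 9 * ENNReal.ofReal L * V := by
          rw [ENNReal.ofReal_ofNat]; ring
      _ = _ := by
          rw [← ENNReal.ofReal_mul (by positivity), ← ENNReal.ofReal_mul (by positivity)]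
          congr 2; field_simp; norm_num
  have vE₁ : volume E₁ ≤ ENNReal.ofReal (1 / 64) * V := by
    have hint : ∫⁻ x, ‖g x‖ₑ ^ p ≤ 9 * V * ENNReal.ofReal L ^ p := by
      rw [lintegral_eq_setLIntegral (R := Q.triple) (fun x hx => by
        rw [hgQ x hx, enorm_zero, ENNReal.zero_rpow_of_pos hp0]), lintegral_rpow_eq_pAvg hp0, hV3]
      gcongr
    have hfin : ∫⁻ x, ‖g x‖ₑ ^ p ≠ ∞ := by
      refine (hint.trans_lt ?_).ne
      exact ENNReal.mul_lt_top (ENNReal.mul_lt_top (by norm_num) Q.volume_ne_top.lt_top)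
        (ENNReal.rpow_lt_top_of_nonneg hp0.le ENNReal.ofReal_ne_top)
    have h1 := volume_maximal_le hfin hs0 hst
    have h2 : ENNReal.ofReal 14400 ≤ ENNReal.ofReal 14400 ^ p := by
      calc ENNReal.ofReal 14400 = ENNReal.ofReal 14400 ^ (1 : ℝ) := (ENNReal.rpow_one _).symm
        _ ≤ _ := ENNReal.rpow_le_rpow_of_exponent_le (by norm_num) hp.le
    have h3 : ENNReal.ofReal 14400 * ENNReal.ofReal L ^ p ≤ s := by
      rw [hs, ENNReal.ofReal_mul (by norm_num), ENNReal.mul_rpow_of_nonneg _ _ hp0.le]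
      gcongr
    have hLp0 : ENNReal.ofReal L ^ p ≠ 0 :=
      (ENNReal.rpow_pos (by rwa [ENNReal.ofReal_pos]) ENNReal.ofReal_ne_top).ne'
    have hLpt : ENNReal.ofReal L ^ p ≠ ∞ :=
      ENNReal.rpow_ne_top_of_nonneg hp0.le ENNReal.ofReal_ne_top
    have h4 : ENNReal.ofReal L ^ p * (ENNReal.ofReal 14400 * volume E₁) ≤
        ENNReal.ofReal L ^ p * (225 * V) := by
      calc _ = ENNReal.ofReal 14400 * ENNReal.ofReal L ^ p * volume E₁ := by ring
        _ ≤ s * volume E₁ := by gcongr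
        _ ≤ 25 * (9 * V * ENNReal.ofReal L ^ p) := h1.trans (by gcongr)
        _ = _ := by ring
    have h5 := (ENNReal.mul_le_mul_iff_right hLp0 hLpt).1 h4
    calc volume E₁ = ENNReal.ofReal (1 / 14400) * (ENNReal.ofReal 14400 * volume E₁) := by
          rw [← mul_assoc, ← ENNReal.ofReal_mul (by norm_num)]; norm_num
      _ ≤ ENNReal.ofReal (1 / 14400) * (ENNReal.ofReal 225 * V) := by
          rw [ENNReal.ofReal_ofNat 225]; gcongr
      _ = _ := by
          rw [← mul_assoc, ← ENNReal.ofReal_mul (by norm_num)]; norm_num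
  -- Nothing is known about the measurability of `E₀` and `E₁`, so a measurable hull is taken.
  set E : Set Plane := toMeasurable volume (E₀ ∪ E₁) ∩ Q.toSet with hE
  have hEm : MeasurableSet E := (measurableSet_toMeasurable _ _).inter Q.measurableSet_toSet
  have hEsub : ∀ x ∈ Q.toSet, x ∉ E → x ∉ E₀ ∧ x ∉ E₁ := by
    intro x hxQ hxE
    have : x ∉ E₀ ∪ E₁ := fun h => hxE ⟨subset_toMeasurable _ _ h, hxQ⟩
    rwa [Set.mem_union, not_or] at this
  have hloc : localConst θ A W * p' * L =
      576 * W * p' * L + 36 * W * 14400 * p' * L + 2 * (9 * A * (648 / θ) * p' * (14400 * L)) := by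
    rw [localConst]; ring
  have hmono : ∀ a, 0 ≤ a → a * L ≤ a * p' * L := by
    intro a ha
    have : a * 1 ≤ a * p' := by gcongr
    rw [mul_one] at this
    gcongr
  have hE₀le : ∀ x ∉ E₀, ‖Φ g x‖ ≤ 576 * W * p' * L := by
    intro x hx
    simp only [hE₀, Set.mem_ofPred_eq, not_lt] at hx
    exact hx.trans (hmono _ (by positivity))
  refine ⟨E, hEm, Set.inter_subset_right, ?_, ae_of_all _ fun x hxQ hxE => ?_, ?_⟩
  · calc volume E ≤ volume (toMeasurable volume (E₀ ∪ E₁)) := measure_mono Set.inter_subset_left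
      _ = volume (E₀ ∪ E₁) := measure_toMeasurable _
      _ ≤ ENNReal.ofReal (1 / 64) * V + ENNReal.ofReal (1 / 64) * V :=
          (measure_union_le _ _).trans (add_le_add vE₀ vE₁)
      _ = _ := by
          rw [← add_mul, ← ENNReal.ofReal_add (by norm_num) (by norm_num)]; norm_num
  · refine (hE₀le x (hEsub x hxQ hxE).1).trans ?_
    rw [hloc]
    have : 0 ≤ 36 * W * 14400 * p' * L + 2 * (9 * A * (648 / θ) * p' * (14400 * L)) := by
      positivity
    linarith
  · intro P hPQ hPE
    set v := volume P.toSet with hv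
    have hv0 : v ≠ 0 := P.volume_ne_zero
    have hvt : v ≠ ∞ := P.volume_ne_top
    have hhalf : ENNReal.ofReal (1 / 2) * v < v := by
      calc _ < 1 * v := by
            rw [ENNReal.mul_lt_mul_iff_left hv0 hvt, ENNReal.ofReal_lt_one]; norm_num
        _ = v := one_mul v
    obtain ⟨z, hzP, hzE⟩ : ∃ z ∈ P.toSet, z ∉ E := by
      by_contra! hcon
      have : P.toSet ∩ E = P.toSet := Set.inter_eq_left.2 hcon
      rw [this] at hPE
      exact absurd hPE (not_le.2 hhalf)
    -- Every dilate of `P` contains the point `z` outside `E₁`, where all averages are controlled.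
    have hgM : ∀ k : ℕ, pAvg p g (Cube.triple^[k + 1] P) ≤ ENNReal.ofReal (14400 * L) := by
      intro k
      refine pAvg_le_of_lintegral_le hp0 ?_
      by_contra! hcon
      exact (hEsub z (hPQ hzP) hzE).2
        ⟨_, Cube.subset_iterate_triple P (Nat.zero_le (k + 1)) hzP, hcon⟩
    obtain ⟨k₀, hk₀⟩ := hK.ae_norm_sub_le hΦ hp hg (M := 14400 * L) (by positivity) hgM
    have hm := P.triple.measurableSet_toSet
    set g₁ := P.triple.toSet.indicator g with hg₁
    set g₂ := P.triple.toSetᶜ.indicator g with hg₂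
    have hg₁i : Integrable g₁ := hg.indicator hm
    have hg₂i : Integrable g₂ := hg.indicator hm.compl
    have hsum : g = g₁ + g₂ := by rw [hg₁, hg₂, Set.indicator_self_add_compl]
    have hΦsum := hΦ.add hg₁i hg₂i
    rw [← hsum] at hΦsum
    -- The average over `3P` is at most `14400 * L`, and `36 = 9 * 4` yields measure at most a
    -- quarter of `P`.
    set B : Set Plane := {x | 36 * W * 14400 * L < ‖Φ g₁ x‖} with hB
    have vB : volume B ≤ ENNReal.ofReal (1 / 4) * v := by
      calc volume B ≤ ENNReal.ofReal (W / (36 * W * 14400 * L)) * ∫⁻ x, ‖g₁ x‖ₑ :=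
            hΦ.weak hg₁i (by positivity)
        _ = ENNReal.ofReal (W / (36 * W * 14400 * L)) * ∫⁻ x in P.triple.toSet, ‖g x‖ₑ := by
            rw [← lintegral_indicator hm]
            simp only [hg₁, enorm_indicator_eq_indicator_enorm]
        _ ≤ ENNReal.ofReal (W / (36 * W * 14400 * L)) *
              (9 * v * ENNReal.ofReal (14400 * L)) := by
            gcongr
            rw [hv, ← P.volume_triple]
            exact (lintegral_cube_le_pAvg hp hg.1.aemeasurable.restrict).trans
              (by gcongr; exact hgM 0)
        _ = ENNReal.ofReal (W / (36 * W * 14400 * L)) * ENNReal.ofReal 9 *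
              ENNReal.ofReal (14400 * L) * v := by
            rw [ENNReal.ofReal_ofNat]; ring
        _ = _ := by
            rw [← ENNReal.ofReal_mul (by positivity), ← ENNReal.ofReal_mul (by positivity)]
            congr 2; field_simp; norm_num
    -- `1/2 + 1/4 < 1`, so a set of positive measure is left, and it meets every full-measure set.
    have hpos : volume (P.toSet \ (E ∪ B)) ≠ 0 := by
      intro h0
      have h1 : P.toSet ⊆ (P.toSet ∩ E) ∪ (B ∪ (P.toSet \ (E ∪ B))) := by
        intro x hx
        by_cases hxE : x ∈ E
        · exact Or.inl ⟨hx, hxE⟩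
        · by_cases hxB : x ∈ B
          · exact Or.inr (Or.inl hxB)
          · exact Or.inr (Or.inr ⟨hx, fun h => h.elim hxE hxB⟩)
      have h2 : v ≤ ENNReal.ofReal (3 / 4) * v := by
        calc v ≤ volume (P.toSet ∩ E) + (volume B + volume (P.toSet \ (E ∪ B))) :=
              (measure_mono h1).trans ((measure_union_le _ _).trans
                (by gcongr; exact measure_union_le _ _))
          _ ≤ ENNReal.ofReal (1 / 2) * v + (ENNReal.ofReal (1 / 4) * v + 0) := by
              rw [h0]; gcongr
          _ = _ := by
              rw [add_zero, ← add_mul, ← ENNReal.ofReal_add (by norm_num) (by norm_num)]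
              norm_num
      have h3 : ENNReal.ofReal (3 / 4) * v < 1 * v := by
        rw [ENNReal.mul_lt_mul_iff_left hv0 hvt, ENNReal.ofReal_lt_one]; norm_num
      rw [one_mul] at h3
      exact absurd h2 (not_le.2 h3)
    obtain ⟨x₀, ⟨hx₀P, hx₀⟩, hx₀a, hx₀b⟩ :=
      Measure.exists_mem_of_measure_ne_zero_of_ae hpos (ae_restrict_of_ae (hk₀.and hΦsum))
    rw [Set.mem_union, not_or] at hx₀
    have n1 := hE₀le x₀ (hEsub x₀ (hPQ hx₀P) hx₀.1).1
    have n2 : ‖Φ g₁ x₀‖ ≤ 36 * W * 14400 * p' * L := by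
      have := hx₀.2
      simp only [hB, Set.mem_ofPred_eq, not_lt] at this
      exact this.trans (hmono _ (by positivity))
    rw [Pi.add_apply] at hx₀b
    have n3 := hx₀a hx₀P
    filter_upwards [hk₀] with x hx hxP
    have n4 := hx hxP
    have e : Φ g₂ x = (Φ g₂ x - k₀) - (Φ g₂ x₀ - k₀) + (Φ g x₀ - Φ g₁ x₀) := by
      rw [hx₀b]; ring
    calc ‖Φ g₂ x‖ = ‖(Φ g₂ x - k₀) - (Φ g₂ x₀ - k₀) + (Φ g x₀ - Φ g₁ x₀)‖ := by rw [← e]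
      _ ≤ (‖Φ g₂ x - k₀‖ + ‖Φ g₂ x₀ - k₀‖) + (‖Φ g x₀‖ + ‖Φ g₁ x₀‖) :=
          (norm_add_le _ _).trans (add_le_add (norm_sub_le _ _) (norm_sub_le _ _))
      _ ≤ _ := by rw [hloc]; linarith

theorem IsWeakOp.ae_eq_zero (hΦ : IsWeakOp W K Φ) {f : Plane → ℂ} (hf : f =ᵐ[volume] 0) :
    Φ f =ᵐ[volume] 0 := by
  have h0 : Integrable (0 : Plane → ℂ) := integrable_zero _ _ _
  have h1 := hΦ.const_smul (f := 0) 0 h0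
  rw [zero_smul, zero_smul] at h1
  exact (hΦ.congr ((integrable_congr hf).2 h0) hf).trans h1

/-- When the average vanishes, so does `g` almost everywhere, and no exceptional set is needed. -/
theorem exists_exceptional_set (hK : IsGoodKernel θ A K) (hW : 0 < W)
    (hΦ : IsWeakOp W K Φ) {p : ℝ} (hp : 1 < p) {Q : Cube} {g : Plane → ℂ} (hg : Integrable g)
    (hgQ : ∀ x ∉ Q.triple.toSet, g x = 0) (hfin : pAvg p g Q.triple ≠ ∞) :
    ∃ E : Set Plane, MeasurableSet E ∧ E ⊆ Q.toSet ∧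
      volume E ≤ ENNReal.ofReal (1 / 32) * volume Q.toSet ∧
      (∀ᵐ x, x ∈ Q.toSet → x ∉ E →
        ‖Φ g x‖ₑ ≤ ENNReal.ofReal (localConst θ A W * (p / (p - 1))) * pAvg p g Q.triple) ∧
      ∀ P : Cube, P.toSet ⊆ Q.toSet →
        volume (P.toSet ∩ E) ≤ ENNReal.ofReal (1 / 2) * volume P.toSet →
        ∀ᵐ x, x ∈ P.toSet → ‖Φ (P.triple.toSetᶜ.indicator g) x‖ₑ ≤
          ENNReal.ofReal (localConst θ A W * (p / (p - 1))) * pAvg p g Q.triple := by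
  have hp0 : 0 < p := by linarith
  have hp1 : 0 < p - 1 := by linarith
  have hc := localConst_pos hK hW
  rcases eq_or_ne (pAvg p g Q.triple) 0 with h0 | h0
  · have hz : g =ᵐ[volume] 0 := by
      have h1 := lintegral_rpow_eq_pAvg hp0 g Q.triple
      rw [h0, ENNReal.zero_rpow_of_pos hp0, mul_zero,
        ← lintegral_eq_setLIntegral (R := Q.triple) (fun x hx => by
        rw [hgQ x hx, enorm_zero, ENNReal.zero_rpow_of_pos hp0]),
        lintegral_eq_zero_iff' (hg.1.enorm.pow_const _)] at h1
      filter_upwards [h1] with x hx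
      simpa [hp0, hp0.not_gt] using hx
    refine ⟨∅, MeasurableSet.empty, Set.empty_subset _, by simp, ?_, fun P _ _ => ?_⟩
    · filter_upwards [hΦ.ae_eq_zero hz] with x hx _ _
      simp [hx]
    · have : P.triple.toSetᶜ.indicator g =ᵐ[volume] 0 := by
        filter_upwards [hz] with x hx
        by_cases hxP : x ∈ P.triple.toSet <;> simp [hxP, hx]
      filter_upwards [hΦ.ae_eq_zero this] with x hx _
      simp [hx]
  · have hL : 0 < (pAvg p g Q.triple).toReal := ENNReal.toReal_pos h0 hfin
    obtain ⟨E, h1, h2, h3, h4, h5⟩ := exists_exceptional_set_of_pos hK hW hΦ hp hg hgQ hL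
      (ENNReal.ofReal_toReal hfin).ge
    have conv : ∀ z : ℂ, ‖z‖ ≤ localConst θ A W * (p / (p - 1)) * (pAvg p g Q.triple).toReal →
        ‖z‖ₑ ≤ ENNReal.ofReal (localConst θ A W * (p / (p - 1))) * pAvg p g Q.triple := by
      intro z hz
      rw [← ofReal_norm]
      refine (ENNReal.ofReal_le_ofReal hz).trans (le_of_eq ?_)
      rw [ENNReal.ofReal_mul (by positivity), ENNReal.ofReal_toReal hfin]
    refine ⟨E, h1, h2, h3, ?_, fun P hP hPE => ?_⟩
    · filter_upwards [h4] with x hx hxQ hxE using conv _ (hx hxQ hxE)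
    · filter_upwards [h5 P hP hPE] with x hx hxP using conv _ (hx hxP)

end Local

/-! ### One step of the sparse domination -/

theorem pAvg_indicator (p : ℝ) (g : Plane → ℂ) (S : Cube) :
    pAvg p (S.toSet.indicator g) S = pAvg p g S := by
  rw [pAvg, pAvg]
  congr 2
  exact setLIntegral_congr_fun S.measurableSet_toSet fun x hx => by
    simp only [Set.indicator_of_mem hx]

theorem pAvg_ne_top {p : ℝ} (hp : 1 < p) {f : Plane → ℂ} (hf : MemLp f (ENNReal.ofReal p) volume)
    (S : Cube) : pAvg p f S ≠ ∞ := by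
  have hp0 : 0 < p := by linarith
  have h := lintegral_rpow_enorm_lt_top_of_eLpNorm_lt_top
    (by rw [Ne, ENNReal.ofReal_eq_zero]; linarith) ENNReal.ofReal_ne_top hf.2
  rw [ENNReal.toReal_ofReal hp0.le] at h
  refine ENNReal.rpow_ne_top_of_nonneg (by positivity) (ENNReal.mul_ne_top ?_ ?_)
  · exact ENNReal.inv_ne_top.2 S.volume_ne_zero
  · exact ((setLIntegral_le_lintegral _ _).trans_lt h).ne

/-- The contribution of a cube to the sparse forms. -/
def sparseTerm (p : ℝ) (b f : Plane → ℂ) (S : Cube) (x : Plane) : ℝ≥0∞ :=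
  pAvg p (fun y => (b y - avg b S) * f y) S + ‖b x - avg b S‖ₑ * pAvg p f S

/-- The commutator applied to the part of `f` in the triple of a cube. -/
def localCommutator (Φ : (Plane → ℂ) → Plane → ℂ) (b f : Plane → ℂ) (Q : Cube) (x : Plane) : ℂ :=
  b x * Φ (Q.triple.toSet.indicator f) x - Φ (Q.triple.toSet.indicator fun y => b y * f y) x

variable {θ A W : ℝ} {K : Plane → Plane → ℂ} {Φ : (Plane → ℂ) → Plane → ℂ}

/-- Constants commute with `Φ`, so `b` may be replaced by `b - a` in the commutator, with `a`
adapted to the cube at hand. -/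
theorem IsWeakOp.ae_indicator_mul (hΦ : IsWeakOp W K Φ) {b f : Plane → ℂ} (hf : Integrable f)
    (hbf : Integrable fun y => b y * f y) (a : ℂ) {s : Set Plane} (hs : MeasurableSet s) :
    Φ (s.indicator fun y => b y * f y) =ᵐ[volume]
      Φ (s.indicator fun y => (b y - a) * f y) + a • Φ (s.indicator f) := by
  have h1 : Integrable fun y => (b y - a) * f y := by
    simp only [sub_mul]; exact hbf.sub (hf.const_mul a)
  have e : (s.indicator fun y => b y * f y) =
      (s.indicator fun y => (b y - a) * f y) + a • s.indicator f := by
    ext y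
    by_cases hy : y ∈ s
    · simp only [Pi.add_apply, Pi.smul_apply, Set.indicator_of_mem hy, smul_eq_mul]; ring
    · simp [hy]
  rw [e]
  have h2 := hΦ.add (h1.indicator hs) ((hf.indicator hs).smul a)
  filter_upwards [h2, hΦ.const_smul a (hf.indicator hs)] with x e1 e2
  rw [e1, Pi.add_apply, Pi.add_apply, e2]

theorem IsWeakOp.ae_indicator_sub (hΦ : IsWeakOp W K Φ) {u : Plane → ℂ} (hu : Integrable u)
    {s t : Set Plane} (hs : MeasurableSet s) (ht : MeasurableSet t) (hst : s ⊆ t) :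
    Φ (t.indicator u) =ᵐ[volume] Φ (s.indicator u) + Φ ((sᶜ ∩ t).indicator u) := by
  have e : t.indicator u = s.indicator u + (sᶜ ∩ t).indicator u := by
    ext y
    by_cases hy : y ∈ s
    · simp [hy, hst hy]
    · by_cases hyt : y ∈ t <;> simp [hy, hyt]
  conv_lhs => rw [e]
  exact hΦ.add (hu.indicator hs) (hu.indicator (hs.compl.inter ht))

theorem enorm_mul_sub_le {β x y : ℂ} {c u v : ℝ≥0∞} (hx : ‖x‖ₑ ≤ c * u) (hy : ‖y‖ₑ ≤ c * v) :
    ‖β * x - y‖ₑ ≤ c * (v + ‖β‖ₑ * u) := by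
  calc ‖β * x - y‖ₑ ≤ ‖β * x‖ₑ + ‖y‖ₑ := enorm_sub_le
    _ ≤ ‖β‖ₑ * (c * u) + c * v := by rw [enorm_mul]; gcongr
    _ = _ := by ring

/-- The next cubes are the stopping cubes of the union `E` of the exceptional sets of `f` and `(b -
a) f` on `3Q`. Off them the local commutator is bounded because `E` is avoided. On a next cube `P`,
passing from `Q` to `P` removes the part of the functions outside `3P`, which is bounded because `E`
fills at most half of `P`. -/
theorem exists_next_cubes (hK : IsGoodKernel θ A K) (hW : 0 < W) (hΦ : IsWeakOp W K Φ) {p : ℝ}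
    (hp : 1 < p) {b f : Plane → ℂ} (hf : MemLp f (ENNReal.ofReal p) volume) (hf1 : Integrable f)
    (hbf : Integrable fun y => b y * f y) (Q : Cube) :
    ∃ 𝒩 : Set Cube, 𝒩.Countable ∧ 𝒩.PairwiseDisjoint Cube.toSet ∧
      (∀ P ∈ 𝒩, P.toSet ⊆ Q.toSet) ∧
      volume (⋃ P ∈ 𝒩, P.toSet) ≤ ENNReal.ofReal (1 / 2) * volume Q.toSet ∧
      ∀ᵐ x, x ∈ Q.toSet →
        ((∀ P ∈ 𝒩, x ∉ P.toSet) → ‖localCommutator Φ b f Q x‖ₑ ≤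
          ENNReal.ofReal (localConst θ A W * (p / (p - 1))) * sparseTerm p b f Q.triple x) ∧
        ∀ P ∈ 𝒩, x ∈ P.toSet → ‖localCommutator Φ b f Q x - localCommutator Φ b f P x‖ₑ ≤
          ENNReal.ofReal (localConst θ A W * (p / (p - 1))) * sparseTerm p b f Q.triple x := by
  have hp0 : 0 < p := by linarith
  have hp1 : 0 < p - 1 := by linarith
  have hC := localConst_pos hK hW
  set c := ENNReal.ofReal (localConst θ A W * (p / (p - 1))) with hc
  have hc0 : c ≠ 0 := by
    rw [hc, Ne, ENNReal.ofReal_eq_zero, not_le]; positivity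
  set R := Q.triple with hR
  have hRm := R.measurableSet_toSet
  set a := avg b R with ha
  have hbaf : Integrable fun y => (b y - a) * f y := by
    simp only [sub_mul]; exact hbf.sub (hf1.const_mul a)
  -- Only `b f ∈ L¹` is given, so this average can be infinite. Then the bound is trivial and the
  -- iteration stops at `Q`.
  by_cases htop : pAvg p (fun y => (b y - a) * f y) R = ∞
  · refine ⟨∅, Set.countable_empty, Set.pairwiseDisjoint_empty, by simp, by simp,
      ae_of_all _ fun x _ => ⟨fun _ => ?_, by simp⟩⟩
    rw [sparseTerm, ← ha, htop, top_add, ENNReal.mul_top hc0]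
    exact le_top
  set g₁ := R.toSet.indicator f with hg₁
  set g₂ := R.toSet.indicator (fun y => (b y - a) * f y) with hg₂
  have hg₁i : Integrable g₁ := hf1.indicator hRm
  have hg₂i : Integrable g₂ := hbaf.indicator hRm
  have n1 : pAvg p g₁ R = pAvg p f R := pAvg_indicator p f R
  have n2 : pAvg p g₂ R = pAvg p (fun y => (b y - a) * f y) R := pAvg_indicator p _ R
  obtain ⟨E₁, m1, s1, v1, o1, i1⟩ := exists_exceptional_set hK hW hΦ hp hg₁i
    (fun x hx => Set.indicator_of_notMem hx _) (by rw [← hR, n1]; exact pAvg_ne_top hp hf R)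
  obtain ⟨E₂, m2, s2, v2, o2, i2⟩ := exists_exceptional_set hK hW hΦ hp hg₂i
    (fun x hx => Set.indicator_of_notMem hx _) (by rw [← hR, n2]; exact htop)
  rw [← hR, n1] at o1 i1
  rw [← hR, n2] at o2 i2
  set E := E₁ ∪ E₂ with hE
  have hEm : MeasurableSet E := m1.union m2
  have hEQ : E ⊆ Q.toSet := Set.union_subset s1 s2
  have hEv : volume E ≤ ENNReal.ofReal (1 / 16) * volume Q.toSet := by
    refine (measure_union_le _ _).trans ((add_le_add v1 v2).trans (le_of_eq ?_))
    rw [← add_mul, ← ENNReal.ofReal_add (by norm_num) (by norm_num)]; norm_num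
  have hEfin : volume E ≠ ∞ := ((measure_mono hEQ).trans_lt Q.volume_ne_top.lt_top).ne
  have hind : Integrable (E.indicator fun _ => (1 : ℝ)) :=
    (integrable_indicator_iff hEm).2 (integrableOn_const hEfin)
  have hintE : ∀ P : Cube, ∫ x in P.toSet, E.indicator (fun _ => (1 : ℝ)) x =
      volume.real (P.toSet ∩ E) := by
    intro P
    rw [setIntegral_indicator hEm, setIntegral_const]
    simp
  -- At height `1/8`, stopping cubes satisfy `|P| / 8 < |P ∩ E| ≤ 4 * |P| / 8 = |P| / 2`. The upper
  -- bound is what the local estimate asks for, and the lower one gives total area at most `8 * |Q|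
  -- / 16 = |Q| / 2`.
  have hheight : ∫ x in Q.toSet, E.indicator (fun _ => (1 : ℝ)) x ≤ 1 / 8 * Q.side ^ 2 := by
    rw [hintE, Set.inter_eq_right.2 hEQ, Measure.real]
    refine ENNReal.toReal_le_of_le_ofReal (by positivity) (hEv.trans ?_)
    rw [Q.volume_toSet, ← ENNReal.ofReal_mul (by norm_num)]
    apply ENNReal.ofReal_le_ofReal
    nlinarith [sq_nonneg Q.side]
  obtain ⟨𝒩, hcount, hdisj, hP, hae⟩ := Q.exists_stopping_cubes hind
    (fun x => Set.indicator_nonneg (fun _ _ => zero_le_one) x) hheight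
  have hfinP : ∀ P : Cube, volume (P.toSet ∩ E) ≠ ∞ := fun P =>
    ((measure_mono Set.inter_subset_left).trans_lt P.volume_ne_top.lt_top).ne
  have hlow : ∀ P ∈ 𝒩, volume P.toSet ≤ 8 * volume (P.toSet ∩ E) := by
    intro P hPN
    have h1 := (hP P hPN).2.1
    rw [hintE] at h1
    have h2 : P.side ^ 2 ≤ 8 * volume.real (P.toSet ∩ E) := by linarith
    rw [P.volume_toSet]
    refine (ENNReal.ofReal_le_ofReal h2).trans (le_of_eq ?_)
    rw [ENNReal.ofReal_mul (by norm_num), ofReal_measureReal (hfinP P), ENNReal.ofReal_ofNat]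
  have hupp : ∀ P ∈ 𝒩, volume (P.toSet ∩ E) ≤ ENNReal.ofReal (1 / 2) * volume P.toSet := by
    intro P hPN
    have h1 := (hP P hPN).2.2
    rw [hintE] at h1
    rw [← ofReal_measureReal (hfinP P), P.volume_toSet, ← ENNReal.ofReal_mul (by norm_num)]
    exact ENNReal.ofReal_le_ofReal (by linarith)
  refine ⟨𝒩, hcount, hdisj, fun P hPN => (hP P hPN).1, ?_, ?_⟩
  · have : Countable 𝒩 := hcount.to_subtype
    calc volume (⋃ P ∈ 𝒩, P.toSet) ≤ ∑' P : 𝒩, volume (P : Cube).toSet :=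
          measure_biUnion_le _ hcount _
      _ ≤ ∑' P : 𝒩, 8 * volume ((P : Cube).toSet ∩ E) :=
          ENNReal.tsum_le_tsum fun P => hlow P P.2
      _ = 8 * volume (⋃ P : 𝒩, (P : Cube).toSet ∩ E) := by
          rw [ENNReal.tsum_mul_left, measure_iUnion]
          · intro P P' hne
            exact (hdisj P.2 P'.2 (fun h => hne (Subtype.ext h))).mono Set.inter_subset_left
              Set.inter_subset_left
          · exact fun P => (Cube.measurableSet_toSet _).inter hEm
      _ ≤ 8 * (ENNReal.ofReal (1 / 16) * volume Q.toSet) := by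
          gcongr
          exact (measure_mono (Set.iUnion_subset fun _ => Set.inter_subset_right)).trans hEv
      _ = _ := by
          rw [← mul_assoc, ← ENNReal.ofReal_ofNat 8, ← ENNReal.ofReal_mul (by norm_num)]
          norm_num
  · have hsplit := hΦ.ae_indicator_mul hf1 hbf a hRm
    have hchild : ∀ᵐ x, ∀ P ∈ 𝒩, x ∈ P.toSet →
        ‖localCommutator Φ b f Q x - localCommutator Φ b f P x‖ₑ ≤ c * sparseTerm p b f R x := by
      refine (ae_ball_iff hcount).2 fun P hPN => ?_
      have hPQ := (hP P hPN).1
      have hsub : P.triple.toSet ⊆ R.toSet := Cube.triple_subset_triple hPQ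
      have hPm := P.triple.measurableSet_toSet
      have hPE := hupp P hPN
      have j1 := i1 P hPQ ((measure_mono
        (Set.inter_subset_inter_right _ Set.subset_union_left)).trans hPE)
      have j2 := i2 P hPQ ((measure_mono
        (Set.inter_subset_inter_right _ Set.subset_union_right)).trans hPE)
      rw [hg₁, Set.indicator_indicator] at j1
      rw [hg₂, Set.indicator_indicator] at j2
      filter_upwards [j1, j2, hΦ.ae_indicator_sub hf1 hPm hRm hsub,
        hΦ.ae_indicator_sub hbf hPm hRm hsub,
        hΦ.ae_indicator_mul hf1 hbf a (hPm.compl.inter hRm)] with x k1 k2 e1 e2 e3 hxP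
      have e : localCommutator Φ b f Q x - localCommutator Φ b f P x =
          (b x - a) * Φ ((P.triple.toSetᶜ ∩ R.toSet).indicator f) x -
            Φ ((P.triple.toSetᶜ ∩ R.toSet).indicator fun y => (b y - a) * f y) x := by
        rw [localCommutator, localCommutator, ← hR, e1, e2, Pi.add_apply, Pi.add_apply, e3,
          Pi.add_apply, Pi.smul_apply, smul_eq_mul]
        ring
      rw [e]
      exact enorm_mul_sub_le (k1 hxP) (k2 hxP)
    filter_upwards [hae, o1, o2, hsplit, hchild] with x h1 h2 h3 h4 h5 hxQ
    refine ⟨fun hxN => ?_, h5⟩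
    -- Almost everywhere off the stopping cubes the indicator of `E` is at most `1/8`, hence zero.
    have hxE : x ∉ E := by
      intro hxE
      have := h1 hxQ hxN
      rw [Set.indicator_of_mem hxE] at this
      norm_num at this
    rw [hE, Set.mem_union, not_or] at hxE
    have e : localCommutator Φ b f Q x = (b x - a) * Φ g₁ x - Φ g₂ x := by
      rw [localCommutator, ← hR, h4, Pi.add_apply, Pi.smul_apply, smul_eq_mul]
      ring
    rw [e]
    exact enorm_mul_sub_le (h2 hxQ hxE.1) (h3 hxQ hxE.2)

/-! ### Iteration of a choice of subcubes -/

/-- The cubes of the `n`-th generation below `Q`. -/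
def generation (next : Cube → Set Cube) (Q : Cube) : ℕ → Set Cube
  | 0 => {Q}
  | n + 1 => ⋃ R ∈ generation next Q n, next R

/-- All cubes below `Q`. -/
def descendants (next : Cube → Set Cube) (Q : Cube) : Set Cube := ⋃ n, generation next Q n

/-- The part of a cube that is not covered by its next cubes. -/
def remainder (next : Cube → Set Cube) (Q : Cube) : Set Plane := Q.toSet \ ⋃ P ∈ next Q, P.toSet

/-- A choice of disjoint subcubes of every cube, covering at most half of the cube. -/
structure IsSparseChoice (next : Cube → Set Cube) : Prop where
  countable : ∀ Q, (next Q).Countable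
  disjoint : ∀ Q, (next Q).PairwiseDisjoint Cube.toSet
  subset : ∀ Q, ∀ P ∈ next Q, P.toSet ⊆ Q.toSet
  volume_le : ∀ Q, volume (⋃ P ∈ next Q, P.toSet) ≤ ENNReal.ofReal (1 / 2) * volume Q.toSet

namespace IsSparseChoice

variable {next : Cube → Set Cube} {Q : Cube}

theorem countable_generation (h : IsSparseChoice next) (n : ℕ) :
    (generation next Q n).Countable := by
  induction n with
  | zero => exact Set.countable_singleton Q
  | succ n ih => exact ih.biUnion fun R _ => h.countable R

theorem countable_descendants (h : IsSparseChoice next) : (descendants next Q).Countable :=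
  Set.countable_iUnion h.countable_generation

theorem exists_ancestor (h : IsSparseChoice next) {m n : ℕ} (hmn : m ≤ n) {P : Cube}
    (hP : P ∈ generation next Q n) : ∃ R ∈ generation next Q m, P.toSet ⊆ R.toSet := by
  induction n, hmn using Nat.le_induction generalizing P with
  | base => exact ⟨P, hP, subset_rfl⟩
  | succ n _ ih =>
    obtain ⟨R, hR, hPR⟩ := Set.mem_iUnion₂.1 hP
    obtain ⟨R', hR', hRR'⟩ := ih hR
    exact ⟨R', hR', (h.subset R P hPR).trans hRR'⟩

theorem subset_of_mem_descendants (h : IsSparseChoice next) {P : Cube}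
    (hP : P ∈ descendants next Q) : P.toSet ⊆ Q.toSet := by
  obtain ⟨n, hn⟩ := Set.mem_iUnion.1 hP
  obtain ⟨R, hR, hPR⟩ := h.exists_ancestor (Nat.zero_le n) hn
  rwa [Set.mem_singleton_iff.1 hR] at hPR

theorem disjoint_generation (h : IsSparseChoice next) (n : ℕ) :
    (generation next Q n).PairwiseDisjoint Cube.toSet := by
  induction n with
  | zero => exact Set.pairwiseDisjoint_singleton _ _
  | succ n ih =>
    intro P hP P' hP' hne
    obtain ⟨R, hR, hPR⟩ := Set.mem_iUnion₂.1 hP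
    obtain ⟨R', hR', hPR'⟩ := Set.mem_iUnion₂.1 hP'
    by_cases hRR : R = R'
    · subst hRR
      exact h.disjoint R hPR hPR' hne
    · exact (ih hR hR' hRR).mono (h.subset R P hPR) (h.subset R' P' hPR')

theorem volume_generation_le (h : IsSparseChoice next) (n : ℕ) :
    volume (⋃ P ∈ generation next Q n, P.toSet) ≤
      ENNReal.ofReal ((1 / 2) ^ n) * volume Q.toSet := by
  induction n with
  | zero => simp [generation]
  | succ n ih =>
    have hc : Countable (generation next Q n) := (h.countable_generation n).to_subtype
    have e : (⋃ P ∈ generation next Q (n + 1), P.toSet) ⊆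
        ⋃ R : generation next Q n, ⋃ P ∈ next R, P.toSet := by
      intro x hx
      obtain ⟨P, hP, hxP⟩ := Set.mem_iUnion₂.1 hx
      obtain ⟨R, hR, hPR⟩ := Set.mem_iUnion₂.1 hP
      exact Set.mem_iUnion.2 ⟨⟨R, hR⟩, Set.mem_iUnion₂.2 ⟨P, hPR, hxP⟩⟩
    calc _ ≤ ∑' R : generation next Q n, volume (⋃ P ∈ next R, P.toSet) :=
          (measure_mono e).trans (measure_iUnion_le _)
      _ ≤ ∑' R : generation next Q n, ENNReal.ofReal (1 / 2) * volume (R : Cube).toSet :=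
          ENNReal.tsum_le_tsum fun R => h.volume_le R
      _ = ENNReal.ofReal (1 / 2) * volume (⋃ P ∈ generation next Q n, P.toSet) := by
          rw [ENNReal.tsum_mul_left, measure_biUnion (h.countable_generation n)
            (h.disjoint_generation n) fun P _ => P.measurableSet_toSet]
      _ ≤ ENNReal.ofReal (1 / 2) * (ENNReal.ofReal ((1 / 2) ^ n) * volume Q.toSet) := by gcongr
      _ = _ := by
          rw [← mul_assoc, ← ENNReal.ofReal_mul (by norm_num), pow_succ, mul_comm (1 / 2 : ℝ)]

theorem ae_exists_notMem_generation (h : IsSparseChoice next) :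
    ∀ᵐ x, ∃ n, ∀ P ∈ generation next Q n, x ∉ P.toSet := by
  have hnull : volume (⋂ n, ⋃ P ∈ generation next Q n, P.toSet) = 0 := by
    have h0 : Tendsto (fun n : ℕ => ENNReal.ofReal ((1 / 2) ^ n) * volume Q.toSet) atTop
        (𝓝 0) := by
      have h1 := ENNReal.tendsto_ofReal (tendsto_pow_atTop_nhds_zero_of_lt_one
        (by norm_num : (0 : ℝ) ≤ 1 / 2) (by norm_num))
      have h2 := ENNReal.Tendsto.mul_const h1 (Or.inr Q.volume_ne_top)
      rwa [ENNReal.ofReal_zero, zero_mul] at h2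
    exact le_antisymm (ge_of_tendsto' h0 fun n =>
      (measure_mono (Set.iInter_subset _ n)).trans (h.volume_generation_le n)) zero_le
  filter_upwards [measure_eq_zero_iff_ae_notMem.1 hnull] with x hx
  rw [Set.mem_iInter, not_forall] at hx
  obtain ⟨n, hn⟩ := hx
  exact ⟨n, fun P hP hxP => hn (Set.mem_iUnion₂.2 ⟨P, hP, hxP⟩)⟩

theorem measurableSet_remainder (h : IsSparseChoice next) (P : Cube) :
    MeasurableSet (remainder next P) :=
  P.measurableSet_toSet.diff (MeasurableSet.biUnion (h.countable P) fun R _ => R.measurableSet_toSet)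

theorem le_volume_remainder (h : IsSparseChoice next) (P : Cube) :
    ENNReal.ofReal (1 / 2) * volume P.toSet ≤ volume (remainder next P) := by
  have h1 := h.volume_le P
  have h2 : volume P.toSet ≤ volume (remainder next P) + volume (⋃ R ∈ next P, R.toSet) := by
    refine (measure_mono fun x hx => ?_).trans (measure_union_le _ _)
    by_cases hxN : x ∈ ⋃ R ∈ next P, R.toSet
    · exact Or.inr hxN
    · exact Or.inl ⟨hx, hxN⟩
  have hfin : ENNReal.ofReal (1 / 2) * volume P.toSet ≠ ∞ :=
    ENNReal.mul_ne_top ENNReal.ofReal_ne_top P.volume_ne_top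
  refine (ENNReal.add_le_add_iff_right hfin).1 ?_
  calc _ = volume P.toSet := by
        rw [← add_mul, ← ENNReal.ofReal_add (by norm_num) (by norm_num)]; norm_num
    _ ≤ _ := h2.trans (by gcongr)

/-- A cube of a later generation lies in some next cube `S` of a cube `R` in the generation of `P`.
Either `R = P`, and `S` was removed from the remainder of `P`, or `R` is disjoint from `P`. -/
theorem disjoint_remainder (h : IsSparseChoice next) :
    (descendants next Q).PairwiseDisjoint (remainder next) := by
  have key : ∀ {m n : ℕ}, m < n → ∀ {P P' : Cube}, P ∈ generation next Q m →
      P' ∈ generation next Q n → Disjoint (remainder next P) (remainder next P') := by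
    intro m n hmn P P' hP hP'
    obtain ⟨S, hS, hPS⟩ := h.exists_ancestor (Nat.succ_le_of_lt hmn) hP'
    obtain ⟨R, hR, hSR⟩ := Set.mem_iUnion₂.1 hS
    rw [Set.disjoint_left]
    intro x hx hx'
    have hxS : x ∈ S.toSet := hPS hx'.1
    by_cases hPR : P = R
    · subst hPR
      exact hx.2 (Set.mem_iUnion₂.2 ⟨S, hSR, hxS⟩)
    · exact Set.disjoint_left.1 (h.disjoint_generation m hP hR hPR) hx.1 (h.subset R S hSR hxS)
  intro P hP P' hP' hne
  obtain ⟨m, hm⟩ := Set.mem_iUnion.1 hP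
  obtain ⟨n, hn⟩ := Set.mem_iUnion.1 hP'
  rcases lt_trichotomy m n with hlt | heq | hgt
  · exact key hlt hm hn
  · subst heq
    exact (h.disjoint_generation m hm hn hne).mono Set.sdiff_subset Set.sdiff_subset
  · exact (key hgt hn hm).symm

/-- No cube repeats along a chain, so telescoping produces a sum over a set of cubes without
multiplicities. -/
theorem not_subset_next (h : IsSparseChoice next) {P R : Cube} (hR : R ∈ next P) :
    ¬ P.toSet ⊆ R.toSet := by
  intro hsub
  have h1 : volume P.toSet ≤ ENNReal.ofReal (1 / 2) * volume P.toSet :=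
    (measure_mono (hsub.trans (Set.subset_biUnion_of_mem (u := Cube.toSet) hR))).trans
      (h.volume_le P)
  have h2 : ENNReal.ofReal (1 / 2) * volume P.toSet < 1 * volume P.toSet := by
    rw [ENNReal.mul_lt_mul_iff_left P.volume_ne_zero P.volume_ne_top, ENNReal.ofReal_lt_one]
    norm_num
  rw [one_mul] at h2
  exact absurd h1 (not_le.2 h2)

/-- Telescoping along the chain of descendants that contain a point. -/
theorem exists_finset_enorm_le (h : IsSparseChoice next) {G : Cube → ℂ} {τ : Cube → ℝ≥0∞}
    {x : Plane}
    (hend : ∀ P ∈ descendants next Q, x ∈ P.toSet → (∀ R ∈ next P, x ∉ R.toSet) → ‖G P‖ₑ ≤ τ P)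
    (hstep : ∀ P ∈ descendants next Q, ∀ R ∈ next P, x ∈ R.toSet → ‖G P - G R‖ₑ ≤ τ P)
    (hx : ∃ n, ∀ P ∈ generation next Q n, x ∉ P.toSet) (hxQ : x ∈ Q.toSet) :
    ∃ s : Finset Cube, (∀ P ∈ s, P ∈ descendants next Q ∧ x ∈ P.toSet) ∧
      ‖G Q‖ₑ ≤ ∑ P ∈ s, τ P := by
  classical
  obtain ⟨N, hN⟩ := hx
  -- Induction on the number `m` of generations left before `N`, where no cube contains `x`. The
  -- inclusion of the collected cubes in `P` is carried along to see that the parent is new.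
  have key : ∀ m n : ℕ, n + m = N → ∀ P ∈ generation next Q n, x ∈ P.toSet →
      ∃ s : Finset Cube, (∀ R ∈ s, R ∈ descendants next Q ∧ x ∈ R.toSet ∧ R.toSet ⊆ P.toSet) ∧
        ‖G P‖ₑ ≤ ∑ R ∈ s, τ R := by
    intro m
    induction m with
    | zero =>
      intro n hn P hP hxP
      rw [add_zero] at hn
      subst hn
      exact absurd hxP (hN P hP)
    | succ m ih =>
      intro n hn P hP hxP
      have hPd : P ∈ descendants next Q := Set.mem_iUnion.2 ⟨n, hP⟩
      by_cases hex : ∃ R ∈ next P, x ∈ R.toSet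
      · obtain ⟨R, hR, hxR⟩ := hex
        obtain ⟨s, hs, hsum⟩ :=
          ih (n + 1) (by omega) R (Set.mem_iUnion₂.2 ⟨P, hP, hR⟩) hxR
        have hPs : P ∉ s := fun hPs => h.not_subset_next hR (hs P hPs).2.2
        refine ⟨insert P s, ?_, ?_⟩
        · intro S hS
          rcases Finset.mem_insert.1 hS with rfl | hS
          · exact ⟨hPd, hxP, subset_rfl⟩
          · exact ⟨(hs S hS).1, (hs S hS).2.1, (hs S hS).2.2.trans (h.subset P R hR)⟩
        · rw [Finset.sum_insert hPs]
          calc ‖G P‖ₑ = ‖(G P - G R) + G R‖ₑ := by rw [sub_add_cancel]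
            _ ≤ ‖G P - G R‖ₑ + ‖G R‖ₑ := enorm_add_le _ _
            _ ≤ _ := add_le_add (hstep P hPd R hR hxR) hsum
      · push Not at hex
        refine ⟨{P}, ?_, ?_⟩
        · intro S hS
          rw [Finset.mem_singleton.1 hS]
          exact ⟨hPd, hxP, subset_rfl⟩
        · rw [Finset.sum_singleton]; exact hend P hPd hxP hex
  obtain ⟨s, hs, hsum⟩ := key N 0 (zero_add N) Q rfl hxQ
  exact ⟨s, fun P hP => ⟨(hs P hP).1, (hs P hP).2.1⟩, hsum⟩

end IsSparseChoice

/-! ### The sparse family -/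

/-- The concentric cube of a third of the side length. -/
def Cube.third (S : Cube) : Cube where
  corner := (S.corner.1 + S.side / 3, S.corner.2 + S.side / 3)
  side := S.side / 3
  side_pos := by have := S.side_pos; positivity

theorem Cube.triple_third (S : Cube) : S.third.triple = S := by
  obtain ⟨⟨a, b⟩, s, hs⟩ := S
  simp only [third, triple, mk.injEq, Prod.mk.injEq]
  refine ⟨⟨?_, ?_⟩, ?_⟩ <;> ring

theorem Cube.third_triple (S : Cube) : S.triple.third = S :=
  Cube.triple_injective (Cube.triple_third _)

/-- The triples of the descendants of `3 Q`, and the cubes `3 ^ k Q` for `k ≥ 3`. -/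
def sparseFamily (next : Cube → Set Cube) (Q : Cube) : Set Cube :=
  Cube.triple '' descendants next Q.triple ∪ {S | ∃ k : ℕ, S = Cube.triple^[k + 3] Q}

/-- For `3P` with `P` a descendant, the remainder of `P` is at least half of `P`, that is `1/18` of
`3P`. For the large dilates of `Q` the annuli between consecutive dilates serve; they are disjoint
from each other and from the remainders, which lie in `3Q`. -/
theorem isSparse_sparseFamily {next : Cube → Set Cube} (h : IsSparseChoice next) (Q : Cube) :
    IsSparse (1 / 18) (sparseFamily next Q) := by
  classical
  set 𝒟 := Cube.triple '' descendants next Q.triple with h𝒟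
  let E : Cube → Set Plane := fun S =>
    if S ∈ 𝒟 then remainder next S.third else S.toSet \ S.third.toSet
  have hin : ∀ S ∈ 𝒟, E S = remainder next S.third := fun S hS => if_pos hS
  have hthird : ∀ S ∈ 𝒟, S.third ∈ descendants next Q.triple := by
    rintro _ ⟨P, hP, rfl⟩; rwa [Cube.third_triple]
  have hout : ∀ S ∉ 𝒟, S ∈ sparseFamily next Q → ∃ k : ℕ, S = Cube.triple^[k + 3] Q ∧
      E S = (Cube.triple^[k + 3] Q).toSet \ (Cube.triple^[k + 2] Q).toSet := by
    intro S hS hSF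
    obtain ⟨k, rfl⟩ := hSF.resolve_left hS
    refine ⟨k, rfl, ?_⟩
    simp only [E, if_neg hS]
    congr 2
    rw [Function.iterate_succ_apply' Cube.triple (k + 2), Cube.third_triple]
  have hsmall : ∀ S ∈ 𝒟, ∀ k, E S ⊆ (Cube.triple^[k + 2] Q).toSet := by
    intro S hS k
    rw [hin S hS]
    refine Set.sdiff_subset.trans ((h.subset_of_mem_descendants (hthird S hS)).trans ?_)
    exact Cube.subset_iterate_triple Q (by omega : 1 ≤ k + 2)
  refine ⟨E, ?_, ?_⟩
  · intro S hS S' hS' hne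
    rw [Function.onFun]
    by_cases hD : S ∈ 𝒟 <;> by_cases hD' : S' ∈ 𝒟
    · rw [hin S hD, hin S' hD']
      refine h.disjoint_remainder (hthird S hD) (hthird S' hD') fun he => hne ?_
      rw [← S.triple_third, he, S'.triple_third]
    · obtain ⟨k, -, hk⟩ := hout S' hD' hS'
      rw [hk]
      exact Set.disjoint_sdiff_right.mono_left (hsmall S hD k)
    · obtain ⟨k, -, hk⟩ := hout S hD hS
      rw [hk]
      exact (Set.disjoint_sdiff_right.mono_left (hsmall S' hD' k)).symm
    · obtain ⟨k, rfl, hk⟩ := hout S hD hS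
      obtain ⟨l, rfl, hl⟩ := hout S' hD' hS'
      rw [hk, hl]
      rcases lt_trichotomy k l with hlt | heq | hgt
      · exact Set.disjoint_sdiff_right.mono_left
          (Set.sdiff_subset.trans (Cube.subset_iterate_triple Q (by omega)))
      · exact absurd (by rw [heq]) hne
      · exact (Set.disjoint_sdiff_right.mono_left
          (Set.sdiff_subset.trans (Cube.subset_iterate_triple Q (by omega)))).symm
  · intro S hS
    have hvol : volume S.toSet = 9 * volume S.third.toSet := by
      rw [← Cube.volume_triple, Cube.triple_third]
    have hsub : S.third.toSet ⊆ S.toSet := by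
      have := S.third.subset_triple
      rwa [Cube.triple_third] at this
    by_cases hD : S ∈ 𝒟
    · rw [hin S hD]
      refine ⟨h.measurableSet_remainder _, Set.sdiff_subset.trans hsub, ?_⟩
      refine le_trans (le_of_eq ?_) (h.le_volume_remainder _)
      rw [hvol, ← mul_assoc, ← ENNReal.ofReal_ofNat 9, ← ENNReal.ofReal_mul (by norm_num)]
      norm_num
    · simp only [E, if_neg hD]
      refine ⟨S.measurableSet_toSet.diff S.third.measurableSet_toSet, Set.sdiff_subset, ?_⟩
      rw [measure_sdiff hsub S.third.measurableSet_toSet.nullMeasurableSet S.third.volume_ne_top]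
      refine ENNReal.le_sub_of_add_le_right S.third.volume_ne_top ?_
      rw [hvol]
      calc _ = ENNReal.ofReal (3 / 2) * volume S.third.toSet := by
            rw [← mul_assoc, ← ENNReal.ofReal_ofNat 9, ← ENNReal.ofReal_mul (by norm_num)]
            nth_rewrite 2 [← one_mul (volume S.third.toSet)]
            rw [← ENNReal.ofReal_one, ← add_mul, ← ENNReal.ofReal_add (by norm_num) (by norm_num)]
            norm_num
        _ ≤ _ := by
            rw [← ENNReal.ofReal_ofNat 9]
            gcongr
            norm_num

theorem sum_sparseTerm_le {p : ℝ} {b f : Plane → ℂ} {𝒮 : Set Cube} {x : Plane} {s : Finset Cube}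
    (hs : ∀ S ∈ s, S ∈ 𝒮 ∧ x ∈ S.toSet) :
    ∑ S ∈ s, sparseTerm p b f S x ≤ sparseFormIn p 𝒮 b f x + sparseFormOut p 𝒮 b f x := by
  rw [sparseFormIn, sparseFormOut, ← ENNReal.tsum_add]
  let τ : Cube → ℝ≥0∞ := fun S =>
    S.toSet.indicator (fun _ => pAvg p (fun y => (b y - avg b S) * f y) S) x +
      S.toSet.indicator (fun y => ‖b y - avg b S‖ₑ * pAvg p f S) x
  change _ ≤ ∑' S : 𝒮, τ S
  rw [tsum_subtype 𝒮 τ]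
  refine le_trans (le_of_eq ?_) (ENNReal.sum_le_tsum s)
  refine Finset.sum_congr rfl fun S hS => ?_
  rw [Set.indicator_of_mem (hs S hS).1]
  simp only [τ, Set.indicator_of_mem (hs S hS).2, sparseTerm]

/-! ### Far from the support -/

section Main

variable {θ A W : ℝ} {K : Plane → Plane → ℂ} {Φ : (Plane → ℂ) → Plane → ℂ}

/-- Far from the support no smoothness is needed: with `S = 3 ^ (k + 2) Q` the distance from `x` to
the support is at least `S.side / 9`, so the size of the kernel costs `81 * A / |S|`. -/
theorem ae_enorm_le_of_far (hK : IsGoodKernel θ A K) (hΦ : IsWeakOp W K Φ) {p : ℝ} (hp : 1 < p)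
    {Q : Cube} {u : Plane → ℂ} (hu : Integrable u) (huQ : ∀ x ∉ Q.toSet, u x = 0) (k : ℕ) :
    ∀ᵐ x, x ∈ (Cube.triple^[k + 1] Q).toSetᶜ →
      ‖Φ u x‖ₑ ≤ ENNReal.ofReal (81 * A) * pAvg p u (Cube.triple^[k + 2] Q) := by
  have hA := hK.nonneg
  set S := Cube.triple^[k + 2] Q with hS
  have hs : S.side = 3 ^ (k + 2) * Q.side := Cube.iterate_triple_side Q _
  have hsp := S.side_pos
  have hd : ∀ x ∈ (Cube.triple^[k + 1] Q).toSetᶜ, ∀ y, u y ≠ 0 → S.side / 9 ≤ dist x y := by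
    intro x hx y hy
    have hyQ : y ∈ Q.toSet := by by_contra h; exact hy (huQ y h)
    have h1 := Cube.le_dist_center_of_notMem hx
    rw [Cube.iterate_triple_center, Cube.iterate_triple_side] at h1
    have h2 := Cube.dist_center_le hyQ
    have h3 := dist_triangle x y Q.center
    have h4 : Q.side ≤ 3 ^ k * Q.side :=
      le_mul_of_one_le_left Q.side_pos.le (one_le_pow₀ (by norm_num))
    have h5 : (3 : ℝ) ^ (k + 1) * Q.side = 3 * (3 ^ k * Q.side) := by ring
    have h6 : S.side = 9 * (3 ^ k * Q.side) := by rw [hs]; ring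
    rw [h5] at h1
    rw [h6]
    linarith
  have hint : ENNReal.ofReal (∫ y, ‖u y‖) ≤ volume S.toSet * pAvg p u S := by
    rw [ofReal_integral_norm_eq_lintegral_enorm hu, lintegral_eq_setLIntegral (R := S)]
    · exact lintegral_cube_le_pAvg hp hu.1.aemeasurable.restrict
    · intro x hx
      rw [huQ x fun h => hx (Cube.subset_iterate_triple Q (Nat.zero_le (k + 2)) h), enorm_zero]
  filter_upwards [hΦ.repr hu (by positivity : 0 < S.side / 9) hd] with x hx hxS
  have h1 := hK.norm_integral_le hu (by positivity : 0 < S.side / 9) (hd x hxS)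
  rw [hx hxS, ← ofReal_norm]
  calc _ ≤ ENNReal.ofReal (A / (S.side / 9) ^ 2 * ∫ y, ‖u y‖) := ENNReal.ofReal_le_ofReal h1
    _ = ENNReal.ofReal (A / (S.side / 9) ^ 2) * ENNReal.ofReal (∫ y, ‖u y‖) :=
        ENNReal.ofReal_mul (by positivity)
    _ ≤ ENNReal.ofReal (A / (S.side / 9) ^ 2) * (volume S.toSet * pAvg p u S) := by gcongr
    _ = _ := by
        rw [S.volume_toSet, ← mul_assoc, ← ENNReal.ofReal_mul (by positivity)]
        congr 2; field_simp; norm_num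

theorem exists_sparse_domination (hK : IsGoodKernel θ A K) (hW : 0 < W) (hΦ : IsWeakOp W K Φ)
    {p : ℝ} (hp : 1 < p) {b f : Plane → ℂ} (hf : MemLp f (ENNReal.ofReal p) volume)
    (hfc : HasCompactSupport f) (hbf : Integrable fun x => b x * f x) :
    ∃ 𝒮 : Set Cube, IsSparse (1 / 18) 𝒮 ∧ ∀ᵐ x,
      ‖b x * Φ f x - Φ (fun y => b y * f y) x‖ₑ ≤
        ENNReal.ofReal ((localConst θ A W + 81 * A) * (p / (p - 1))) *
          (sparseFormIn p 𝒮 b f x + sparseFormOut p 𝒮 b f x) := by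
  classical
  have hA := hK.nonneg
  have hp1 : 0 < p - 1 := by linarith
  have hp' : 1 ≤ p / (p - 1) := by rw [le_div_iff₀ hp1]; linarith
  have hC := localConst_pos hK hW
  obtain ⟨Q, hQ⟩ := Cube.exists_subset_of_isBounded hfc.isCompact.isBounded
  have hfQ : ∀ x ∉ Q.toSet, f x = 0 := fun x hx =>
    image_eq_zero_of_notMem_tsupport fun h => hx (hQ h)
  have hf1 : Integrable f := by
    refine (integrableOn_iff_integrable_of_support_subset (s := Q.toSet) ?_).1 ?_
    · intro x hx; by_contra h; exact hx (hfQ x h)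
    · have : IsFiniteMeasure (volume.restrict Q.toSet) :=
        ⟨by rw [Measure.restrict_apply_univ]; exact Q.volume_ne_top.lt_top⟩
      exact (hf.restrict Q.toSet).integrable (by
        rw [← ENNReal.ofReal_one]; exact ENNReal.ofReal_le_ofReal hp.le)
  -- The next cubes are chosen for every cube at once; `b`, `f` and `p` stay fixed during the
  -- iteration.
  choose next hcount hdisj hsub hvol hae using
    exists_next_cubes hK hW hΦ hp hf hf1 hbf
  have hnext : IsSparseChoice next := ⟨hcount, hdisj, hsub, hvol⟩
  set c := ENNReal.ofReal ((localConst θ A W + 81 * A) * (p / (p - 1))) with hc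
  have hc1 : ENNReal.ofReal (localConst θ A W * (p / (p - 1))) ≤ c :=
    ENNReal.ofReal_le_ofReal (by gcongr; linarith)
  have hc2 : ENNReal.ofReal (81 * A) ≤ c := by
    refine ENNReal.ofReal_le_ofReal ?_
    calc 81 * A = (81 * A) * 1 := (mul_one _).symm
      _ ≤ _ := by gcongr; linarith
  refine ⟨sparseFamily next Q, isSparse_sparseFamily hnext Q, ?_⟩
  -- The iteration starts at `3Q`, whose triple contains the support of `f`, so the local commutator
  -- there is the full one.
  have hin : ∀ᵐ x, x ∈ Q.triple.toSet → ‖localCommutator Φ b f Q.triple x‖ₑ ≤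
      c * (sparseFormIn p (sparseFamily next Q) b f x +
        sparseFormOut p (sparseFamily next Q) b f x) := by
    have hall := (ae_ball_iff (hnext.countable_descendants (Q := Q.triple))).2
      fun P (_ : P ∈ descendants next Q.triple) => hae P
    filter_upwards [hall, hnext.ae_exists_notMem_generation (Q := Q.triple)] with x h1 h2 hxQ
    obtain ⟨s, hs, hsum⟩ := hnext.exists_finset_enorm_le (Q := Q.triple)
      (G := fun P => localCommutator Φ b f P x)
      (τ := fun P => ENNReal.ofReal (localConst θ A W * (p / (p - 1))) *
        sparseTerm p b f P.triple x)
      (fun P hP hxP hn => (h1 P hP hxP).1 hn)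
      (fun P hP R hR hxR => (h1 P hP (hsub P R hR hxR)).2 R hR hxR) h2 hxQ
    refine hsum.trans ?_
    rw [← Finset.mul_sum]
    gcongr
    have e : ∑ P ∈ s, sparseTerm p b f P.triple x =
        ∑ S ∈ s.map ⟨Cube.triple, Cube.triple_injective⟩, sparseTerm p b f S x := by
      rw [Finset.sum_map]; rfl
    rw [e]
    refine sum_sparseTerm_le fun S hS => ?_
    obtain ⟨P, hP, rfl⟩ := Finset.mem_map.1 hS
    exact ⟨Or.inl ⟨P, (hs P hP).1, rfl⟩, P.subset_triple (hs P hP).2⟩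
  have hfar : ∀ᵐ x, ∀ k : ℕ, x ∈ (Cube.triple^[k + 1] Q).toSetᶜ →
      ‖b x * Φ f x - Φ (fun y => b y * f y) x‖ₑ ≤
        c * sparseTerm p b f (Cube.triple^[k + 2] Q) x := by
    refine ae_all_iff.2 fun k => ?_
    -- The constant is adapted to the dilate whose sparse term is to dominate on the annulus.
    set a := avg b (Cube.triple^[k + 2] Q) with ha
    have hbaf : Integrable fun y => (b y - a) * f y := by
      simp only [sub_mul]; exact hbf.sub (hf1.const_mul a)
    have hsplit := hΦ.ae_indicator_mul hf1 hbf a MeasurableSet.univ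
    simp only [Set.indicator_univ] at hsplit
    filter_upwards [ae_enorm_le_of_far hK hΦ hp hf1 hfQ k,
      ae_enorm_le_of_far hK hΦ hp hbaf (fun x hx => by rw [hfQ x hx, mul_zero]) k, hsplit]
      with x h1 h2 h3 hx
    have e : b x * Φ f x - Φ (fun y => b y * f y) x =
        (b x - a) * Φ f x - Φ (fun y => (b y - a) * f y) x := by
      rw [h3, Pi.add_apply, Pi.smul_apply, smul_eq_mul]; ring
    rw [e]
    exact (enorm_mul_sub_le (h1 hx) (h2 hx)).trans (mul_le_mul_left hc2 _)
  have hmem : ∀ k : ℕ, Cube.triple^[k + 2] Q ∈ sparseFamily next Q := by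
    intro k
    cases k with
    -- `9Q` is the triple of the root `3Q` of the iteration, which is why the second part of the
    -- family starts at `27Q`.
    | zero => exact Or.inl ⟨Q.triple, Set.mem_iUnion.2 ⟨0, rfl⟩, rfl⟩
    | succ k => exact Or.inr ⟨k, rfl⟩
  have hzero : ∀ u : Plane → ℂ, (∀ x ∉ Q.toSet, u x = 0) →
      Q.triple.triple.toSet.indicator u = u := by
    intro u hu
    rw [Set.indicator_eq_self]
    intro x hx
    by_contra h
    exact hx (hu x fun hxQ => h (Q.triple.subset_triple (Q.subset_triple hxQ)))
  filter_upwards [hin, hfar] with x h1 h2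
  by_cases hxQ : x ∈ Q.triple.toSet
  · have := h1 hxQ
    rwa [localCommutator, hzero f hfQ,
      hzero _ (fun x hx => by rw [hfQ x hx, mul_zero])] at this
  · obtain ⟨k, hk⟩ := Set.mem_iUnion.1 (compl_triple_subset_iUnion Q hxQ)
    refine (h2 k hk.2).trans (mul_le_mul_right ?_ _)
    have := sum_sparseTerm_le (p := p) (b := b) (f := f) (𝒮 := sparseFamily next Q) (x := x)
      (s := {Cube.triple^[k + 2] Q}) (fun S hS => by
        rw [Finset.mem_singleton.1 hS]; exact ⟨hmem k, hk.1⟩)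
    rwa [Finset.sum_singleton] at this

end Main

end CZX

end

/-! ### The proposition -/

theorem mainTheorem8 :
    ∃ ε : ℝ, 0 < ε ∧
      ∀ (T : Lp ℂ 2 (volume : Measure CZX.Plane) →L[ℂ] Lp ℂ 2 (volume : Measure CZX.Plane))
        (K : CZX.Plane → CZX.Plane → ℂ),
        CZX.IsKernel 1 K → CZX.HasKernel T K →
        -- `T` extends to integrable functions, so that `T f` and `T (b f)` below make sense
        (∀ f : CZX.Plane → ℂ, Integrable f → ∃ g, CZX.IsExtensionValue T f g) ∧
        ∃ C : ℝ, 0 < C ∧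
          ∀ (p : ℝ), 1 < p →
          ∀ (b f : CZX.Plane → ℂ), LocallyIntegrable b →
            MemLp f (ENNReal.ofReal p) → HasCompactSupport f → Integrable (fun x => b x * f x) →
          ∀ (Tf Tbf : CZX.Plane → ℂ), CZX.IsExtensionValue T f Tf →
            CZX.IsExtensionValue T (fun x => b x * f x) Tbf →
          ∃ 𝒮 : Set CZX.Cube, CZX.IsSparse ε 𝒮 ∧
            ∀ᵐ x : CZX.Plane, ‖b x * Tf x - Tbf x‖ₑ ≤
              ENNReal.ofReal (C * (p / (p - 1))) *
                (CZX.sparseFormIn p 𝒮 b f x + CZX.sparseFormOut p 𝒮 b f x) := by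
  refine ⟨1 / 18, by norm_num, ?_⟩
  rintro T K ⟨θ, A, hθ, hθ1, hK⟩ hT
  -- Changing `K` on a null set preserves the kernel identity and makes the kernel measurable with
  -- the size bound everywhere.
  have hgood : CZX.IsGoodKernel θ A (CZX.cutKernel K) :=
    ⟨hK.cutKernel, hθ, hθ1, hK.measurable_cutKernel hθ, CZX.norm_cutKernel_le hK⟩
  refine ⟨fun f hf => hgood.exists_isExtensionValue hT.cutKernel hf, ?_⟩
  obtain ⟨Φ, hΦT, hΦ⟩ := hgood.exists_isWeakOp hT.cutKernel
  have hW : 0 < 4 * CZX.weakConst θ A T := by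
    have := hgood.weakConst_pos (T := T)
    positivity
  refine ⟨CZX.localConst θ A (4 * CZX.weakConst θ A T) + 81 * A,
    add_pos_of_pos_of_nonneg (CZX.localConst_pos hgood hW) (by linarith [hgood.nonneg]), ?_⟩
  intro p hp b f _ hf hfc hbf Tf Tbf hTf hTbf
  obtain ⟨𝒮, hsparse, hae⟩ := CZX.exists_sparse_domination hgood hW hΦ hp hf hfc hbf
  refine ⟨𝒮, hsparse, ?_⟩
  -- Values of the extension are unique almost everywhere, so `Tf` and `Tbf` may be replaced by the
  -- values of `Φ`.
  filter_upwards [hae, hΦT _ _ hTf, hΦT _ _ hTbf] with x h1 h2 h3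
  rw [h2, h3]
  exact h1
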